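/- Let $\alpha>1/2$. For integers $n,p$, a number $a\in(0,1)$ and a positive definite symmetric $p\times p$ matrix $\Sigma$, let $X_1,\dots,X_n$ be i.i.d. $\mathcal N_p(0,\Sigma)$, let $(\varepsilon_{k,j})_{1\le k\le n,\,1\le j\le p}$ be i.i.d. Bernoulli variables with parameter $a$, independent of the $X_k$, and let $Y_k=(\varepsilon_{k,1}X_{k,1},\dots,\varepsilon_{k,p}X_{k,p})^\top$ be observed. Write $P_{a,\Sigma}$ for the law of $(Y_1,\dots,Y_n)$. Put $$\mathcal F(\alpha)=\Big\{\Sigma>0 \text{ symmetric } p\times p:\ \sigma_{ii}=1 \text{ for all } i,\ \frac1p\sum_{1\le i<j\le p}\sigma_{ij}^2|i-j|^{2\alpha}\le 1\Big\},$$ $$Q(\mathcal F(\alpha),\varphi)=\Big\{\Sigma\in\mathcal F(\alpha):\ \frac1p\sum_{1\le i<j\le p}\sigma_{ij}^2\ge\varphi^2\Big\}.$$ A test is a measurable map $\Delta=\Delta(Y_1,\dots,Y_n)\in\{0,1\}$; its total error probability is $\gamma(\Delta,Q)=P_{a,I}(\Delta=1)+\sup_{\Sigma\in Q}P_{a,\Sigma}(\Delta=0)$.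 For $m\in\mathbb N$ and $t\in\mathbb R$ let $$\widehat{\mathcal D}_{n,p,m}=\frac{1}{n(n-1)p\sqrt{2m}}\sum_{1\le k\ne l\le n}\ \sum_{1\le i<j\le p,\ j-i<m}Y_{k,i}Y_{k,j}Y_{l,i}Y_{l,j},\qquad \Delta_m(t)=\mathbf 1\big(\widehat{\mathcal D}_{n,p,m}>t\big).$$ All limits are taken along sequences of $n\to\infty$, $p\to\infty$, $a\in(0,1)$ and $\varphi>0$ (with $m$, $t$ varying along the sequence); $\alpha$ is fixed. 1. Upper bound. Assume $\varphi\to0$ and $a^2n\sqrt p\,\varphi^{2+\frac1{2\alpha}}\to+\infty$. Suppose that (T) $m\to\infty$; $m/p\to0$; for some constants $D>1$ and $K>0$ one has eventually $D\le m^\alpha\varphi\le K^{-2\alpha}$; for some constant $c<K(1-D^{-2})/\sqrt2$ one has eventually $t\le c\,a^4\varphi^{2+\frac1{2\alpha}}$; and $n\sqrt p\,t/a^2\to+\infty$. Then $\gamma(\Delta_m(t),Q(\mathcal F(\alpha),\varphi))\to0$. Moreover, if in addition $p\,\varphi^{1/\alpha}\to\infty$, then sequences $m,t$ satisfying (T)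 exist. 2. Lower bound. Assume $$(R)\qquad a^2n\to\infty,\qquad p=o\big((a^2n)^{4\alpha-1}\big),\qquad a^2n=o\big(p^{2\alpha}\big),$$ and $a^2n\sqrt p\,\varphi^{2+\frac1{2\alpha}}\to0$. Then $\inf_\Delta\gamma(\Delta,Q(\mathcal F(\alpha),\varphi))\to1$, the infimum being over all tests. 3. Separation rate. Let $\widetilde\varphi_\alpha=(a^2n\sqrt p)^{-\frac{2\alpha}{4\alpha+1}}$ and assume (R). If $\varphi/\widetilde\varphi_\alpha\to+\infty$, there are sequences $m,t$ with $\gamma(\Delta_m(t),Q(\mathcal F(\alpha),\varphi))\to0$. If $\varphi/\widetilde\varphi_\alpha\to0$, then $\inf_\Delta\gamma(\Delta,Q(\mathcal F(\alpha),\varphi))\to1$. -/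

import Mathlib

open Filter Topology MeasureTheory ProbabilityTheory
open scoped ENNReal

namespace MissingCov

noncomputable section

/-- A sample of `n` vectors with `p` coordinates. -/
abbrev Sample (n p : ℕ) : Type := Fin n → Fin p → ℝ

/-- The law `P_{a,Σ}` of one observed vector `Y = (ε₁ X₁, …, ε_p X_p)`, where `X ∼ N_p(0, Σ)` and
`ε₁, …, ε_p` are i.i.d. Bernoulli variables with parameter `a`, independent of `X`. -/
def obsLaw {p : ℕ} (a : unitInterval) (S : Matrix (Fin p) (Fin p) ℝ) : Measure (Fin p → ℝ) :=
  ((multivariateGaussian (0 : EuclideanSpace ℝ (Fin p)) S).prod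
      (Measure.pi fun _ : Fin p => bernoulliMeasure (1 : ℝ) 0 a)).map
    fun z i => z.2 i * z.1 i

/-- The law of the sample `Y₁, …, Y_n` of independent vectors with common law `P_{a,Σ}`. -/
def sampleLaw (n : ℕ) {p : ℕ} (a : unitInterval) (S : Matrix (Fin p) (Fin p) ℝ) :
    Measure (Sample n p) :=
  Measure.pi fun _ : Fin n => obsLaw a S

/-- The Sobolev-type ellipsoid `𝓕(α)` of `p × p` covariance matrices. -/
def ellipsoid (p : ℕ) (α : ℝ) : Set (Matrix (Fin p) (Fin p) ℝ) :=
  {S | S.PosDef ∧ (∀ i, S i i = 1) ∧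
    1 / (p : ℝ) * ∑ i, ∑ j ∈ Finset.Ioi i,
      S i j ^ 2 * |((i : ℕ) : ℝ) - ((j : ℕ) : ℝ)| ^ (2 * α) ≤ 1}

/-- The alternative `Q(𝓕(α), φ)`: the ellipsoid with an `ℓ₂` ball around the identity removed. -/
def alternative (p : ℕ) (α φ : ℝ) : Set (Matrix (Fin p) (Fin p) ℝ) :=
  {S | S ∈ ellipsoid p α ∧ φ ^ 2 ≤ 1 / (p : ℝ) * ∑ i, ∑ j ∈ Finset.Ioi i, S i j ^ 2}

/-- A test decides for the alternative (`true`) or for the null hypothesis (`false`).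
This is its type I error probability under `Σ = I`. -/
def typeIError {n p : ℕ} (a : unitInterval) (Δ : Sample n p → Bool) : ℝ≥0∞ :=
  sampleLaw n a (1 : Matrix (Fin p) (Fin p) ℝ) {y | Δ y = true}

/-- The maximal type II error probability of a test over a set `Q` of covariance matrices. -/
def typeIIError {n p : ℕ} (a : unitInterval) (Δ : Sample n p → Bool)
    (Q : Set (Matrix (Fin p) (Fin p) ℝ)) : ℝ≥0∞ :=
  ⨆ S ∈ Q, sampleLaw n a S {y | Δ y = false}

/-- The total error probability `γ(Δ, Q)`. -/
def totalError {n p : ℕ} (a : unitInterval) (Δ : Sample n p → Bool)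
    (Q : Set (Matrix (Fin p) (Fin p) ℝ)) : ℝ≥0∞ :=
  typeIError a Δ + typeIIError a Δ Q

/-- The minimax total error probability: the infimum of `γ(Δ, Q)` over all (measurable) tests. -/
def minimaxError (n : ℕ) {p : ℕ} (a : unitInterval)
    (Q : Set (Matrix (Fin p) (Fin p) ℝ)) : ℝ≥0∞ :=
  ⨅ (Δ : Sample n p → Bool) (_ : Measurable Δ), totalError a Δ Q

/-- The constant-weight U-statistic on the diagonals `1 ≤ j - i < m`. -/
def uStat {n p : ℕ} (m : ℕ) (y : Sample n p) : ℝ :=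
  1 / ((n : ℝ) * ((n : ℝ) - 1) * (p : ℝ)) * (1 / √(2 * (m : ℝ))) *
    ∑ k : Fin n, ∑ l ∈ Finset.univ.filter (fun l : Fin n => k ≠ l),
      ∑ i : Fin p, ∑ j ∈ (Finset.Ioi i).filter (fun j : Fin p => (j : ℕ) - (i : ℕ) < m),
        y k i * y k j * y l i * y l j

/-- The test `Δ_m(t) = 𝟙(D̂_{n,p,m} > t)`. -/
def uTest {n p : ℕ} (m : ℕ) (t : ℝ) (y : Sample n p) : Bool :=
  decide (uStat m y > t)

/-- The effective quantity `a² n √p φ^{2 + 1/(2α)}`. -/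
def signal (α : ℝ) (n p : ℕ) (a : unitInterval) (φ : ℝ) : ℝ :=
  (a : ℝ) ^ 2 * n * √(p : ℝ) * φ ^ (2 + 1 / (2 * α))

/-- The conditions on the number of diagonals `m` and the threshold `t` of the test `Δ_m(t)`,
along a sequence `(n, p, a, φ)`. -/
def IsTuned (α : ℝ) (n p : ℕ → ℕ) (a : ℕ → unitInterval) (φ : ℕ → ℝ)
    (m : ℕ → ℕ) (t : ℕ → ℝ) : Prop :=
  Tendsto m atTop atTop ∧
  Tendsto (fun ν => (m ν : ℝ) / (p ν : ℝ)) atTop (𝓝 0) ∧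
  (∃ D K c : ℝ, 1 < D ∧ 0 < K ∧
    (∀ᶠ ν in atTop, D ≤ (m ν : ℝ) ^ α * φ ν ∧ (m ν : ℝ) ^ α * φ ν ≤ K ^ (-(2 * α))) ∧
    c < K * (1 - (D ^ 2)⁻¹) / √2 ∧
    (∀ᶠ ν in atTop, t ν ≤ c * (a ν : ℝ) ^ 4 * φ ν ^ (2 + 1 / (2 * α)))) ∧
  Tendsto (fun ν => (n ν : ℝ) * √(p ν : ℝ) * t ν / (a ν : ℝ) ^ 2) atTop atTop

/-- The separation rate `(a² n √p)^{-2α/(4α+1)}`. -/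
def separationRate (α : ℝ) (n p : ℕ) (a : unitInterval) : ℝ :=
  ((a : ℝ) ^ 2 * n * √(p : ℝ)) ^ (-(2 * α / (4 * α + 1)))

/-- The regime of the lower bound: `a² n → ∞`, `p = o((a² n)^{4α-1})` and `a² n = o(p^{2α})`. -/
def LowerBoundRegime (α : ℝ) (n p : ℕ → ℕ) (a : ℕ → unitInterval) : Prop :=
  Tendsto (fun ν => (a ν : ℝ) ^ 2 * (n ν : ℝ)) atTop atTop ∧
  (fun ν => (p ν : ℝ)) =o[atTop] (fun ν => ((a ν : ℝ) ^ 2 * (n ν : ℝ)) ^ (4 * α - 1)) ∧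
  (fun ν => (a ν : ℝ) ^ 2 * (n ν : ℝ)) =o[atTop] (fun ν => (p ν : ℝ) ^ (2 * α))

end

end MissingCov

/-!
The problem is to detect correlation in Gaussian vectors whose coordinates are erased independently
with probability `1 - a`.

*Upper bound.* Up to its normalization, the statistic is `∑_{k ≠ l} ⟨F(Y_k), F(Y_l)⟩`, where `F(y)`
lists the products `y_i y_j` on the band `0 < j - i < m`. Its mean is `a⁴ n (n - 1)` times the
energy `E = ∑ σ_ij²` of the band. Hoeffding's decomposition bounds its variance by `E` and by the
Frobenius norm `Γ` of the covariance matrix of `F(Y)` (`integral_uStat_sub_mean_sq_le`), and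
`Γ² ≤ 288 a⁴ m p` uniformly over the ellipsoid (`sum_sq_covariance_bandProd_le`). By Isserlis' formula
this amounts to sums of `σ_ik² σ_jl²` over two positions `(i, j)` and `(k, l)` of the band; there,
the entry nearer to the diagonal is bounded by one, and its possible positions are counted by the
distance of the other entry from the diagonal, which the ellipsoid with `α > 1/2` can pay for
(`sum_band_mul_sq_mul_sq_le`). The ellipsoid also bounds the energy off the band (`le_bandEnergy`),
and Chebyshev's inequality bounds both errors.

*Lower bound.* The coordinates are cut into blocks of length `T ≈ (4 φ)^{-1/α}`; inside a block the
correlations are `s u_i u_j` with independent random signs `u_i` and `s = 4 φ / √T`, and they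
vanish between blocks. These matrices lie in the alternative (`priorCov_mem_alternative`), and each
of them comes from a model with one Gaussian factor per block. Given the factors, the coordinates
are independent, so that the likelihood ratio `L_u` of an observation is explicit, and `E L_u L_v`
is a product over the blocks of integrals of `∏ (a · mehler + 1 - a)` (`lintegral_obsDensity_mul`).
Expanding the product gives an average over the random set of coordinates observed in the block;
for a fixed set the integral is the inverse square root of a determinant, whose second-order
expansion is averaged (`lintegral_prod_thinned_mehler_le`). The resulting bound depends on `u v`
through the squared block sums of signs only, and these are exponentially integrable
(`sum_exp_blockSum_sq_le`). The linear terms in `s² a²` cancel in the mean, and the second moment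
of the mixture of the likelihood ratios of the sample is at most `exp (84 (a² n s²)² T p)`
(`sum_lintegral_sampleDensity_mul_le`). Its exponent is of the order of `signal²`, hence no test
separates the prior from the identity (`one_le_minimaxError_add`, `tendsto_minimaxError_of_room`).

The block length has to stay below `p` and below `a² n`. In the regime of the lower bound there is
room for blocks at the separation rate `φ̃`; a smaller `φ` is replaced by `δ φ̃` with `δ → 0`
slowly, which only shrinks the alternative (`tendsto_minimaxError_of_separationRate`). Similarly, a
large `φ` is replaced by `min φ √φ̃` in the upper bound (`exists_tendsto_totalError_uTest`).
-/

namespace MissingCov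

/-! ### Fourth moments of Gaussian vectors -/

section GaussianMoments

lemma integral_pow_four_gaussianReal (v : NNReal) :
    ∫ x, x ^ 4 ∂(gaussianReal 0 v) = 3 * (v : ℝ) ^ 2 := by
  have h := iteratedDeriv_mgf_zero (X := fun x : ℝ => x) (μ := gaussianReal 0 v) (by simp) 4
  have e : (mgf (fun x : ℝ => x) (gaussianReal 0 v)) = fun t => Real.exp (v * t ^ 2 / 2) := by
    rw [mgf_fun_id_gaussianReal]; simp
  have key : ∀ (P P' : ℝ → ℝ), (∀ t, HasDerivAt P (P' t) t) →
      deriv (fun t => P t * Real.exp (v * t ^ 2 / 2)) =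
        fun t => (P' t + v * t * P t) * Real.exp (v * t ^ 2 / 2) := by
    intro P P' hP
    funext t
    have h1 : HasDerivAt (fun t : ℝ => (v : ℝ) * t ^ 2 / 2) (v * t) t := by
      have := ((hasDerivAt_pow 2 t).const_mul (v : ℝ)).div_const 2
      convert! this using 1; simp; ring
    have := (hP t).mul h1.exp
    exact this.deriv.trans (by ring)
  have e0 : (fun t : ℝ => Real.exp (v * t ^ 2 / 2)) =
      fun t => (fun _ => (1 : ℝ)) t * Real.exp (v * t ^ 2 / 2) := by simp
  rw [e, iteratedDeriv_succ', e0, key _ (fun _ => 0) (fun t => hasDerivAt_const t 1),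
    iteratedDeriv_succ', key _ (fun _ => (v : ℝ)) (fun t => by
      simpa using (hasDerivAt_id t).const_mul (v : ℝ)),
    iteratedDeriv_succ', key _ (fun t => 2 * v ^ 2 * t) (fun t => by
      have := (((hasDerivAt_id t).const_mul (v : ℝ)).mul
        ((hasDerivAt_id t).const_mul (v : ℝ))).const_add (v : ℝ)
      convert! this using 1
      · funext s; simp
      · simp; ring),
    iteratedDeriv_one, key _ (fun t => 3 * v ^ 2 + 3 * v ^ 3 * t ^ 2) (fun t => by
      have h1 := ((hasDerivAt_id t).const_mul (3 * (v : ℝ) ^ 2)).add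
        ((hasDerivAt_pow 3 t).const_mul ((v : ℝ) ^ 3))
      convert! h1 using 1
      · funext s; simp; ring
      · simp; ring)] at h
  simp only [Pi.pow_apply] at h
  rw [← h]; simp

variable {ι : Type*} [Fintype ι] [DecidableEq ι]

lemma memLp_eval_multivariateGaussian (S : Matrix ι ι ℝ) (i : ι) (q : NNReal) :
    MemLp (fun x : EuclideanSpace ℝ ι => x i) q (multivariateGaussian 0 S) :=
  IsGaussian.memLp_dual (multivariateGaussian 0 S) (EuclideanSpace.proj (𝕜 := ℝ) i) q (by simp)

lemma integral_linear_pow_four {S : Matrix ι ι ℝ} (hS : S.PosSemidef) {κ : Type*} [Fintype κ]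
    (c : κ → ℝ) (f : κ → ι) :
    ∫ x : EuclideanSpace ℝ ι, (∑ r, c r * x (f r)) ^ 4 ∂(multivariateGaussian 0 S) =
      3 * (∑ r, ∑ s, c r * c s * S (f r) (f s)) ^ 2 := by
  set L : StrongDual ℝ (EuclideanSpace ℝ ι) :=
    ∑ r, c r • EuclideanSpace.proj (𝕜 := ℝ) (f r) with hL
  have hLx : ∀ x, L x = ∑ r, c r * x (f r) := fun x => by simp [hL]
  have hmap := IsGaussian.map_eq_gaussianReal (μ := multivariateGaussian 0 S) L
  have hmean : (multivariateGaussian 0 S)[L] = 0 := by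
    rw [L.integral_comp_id_comm IsGaussian.integrable_id]; simp
  have hvar : Var[L; multivariateGaussian 0 S] =
      ∑ r, ∑ s, c r * c s * S (f r) (f s) := by
    have e : (L : EuclideanSpace ℝ ι → ℝ) = fun x => ∑ r, (fun r x => c r * x (f r)) r x := by
      funext x; rw [hLx]
    rw [e, variance_fun_sum (fun r => (memLp_eval_multivariateGaussian S (f r) 2).const_mul (c r))]
    refine Finset.sum_congr rfl fun r _ => Finset.sum_congr rfl fun s _ => ?_
    rw [covariance_const_mul_left, covariance_const_mul_right,
      covariance_eval_multivariateGaussian hS]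
    ring
  have h0 : 0 ≤ Var[L; multivariateGaussian 0 S] := variance_nonneg _ _
  have h4 := integral_pow_four_gaussianReal (Var[L; multivariateGaussian 0 S]).toNNReal
  rw [hmean] at hmap
  rw [← hmap, integral_map (by fun_prop) (by fun_prop), Real.coe_toNNReal _ h0, hvar] at h4
  simpa [hLx] using h4

/-- Isserlis' formula for the fourth moments of a centred Gaussian vector, by polarization of the
identity `E L⁴ = 3 (E L²)²`, valid for every linear functional `L`. -/
lemma integral_mul_four_multivariateGaussian {S : Matrix ι ι ℝ} (hS : S.PosSemidef)
    (i j k l : ι) :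
    ∫ x : EuclideanSpace ℝ ι, x i * x j * (x k * x l) ∂(multivariateGaussian 0 S) =
      S i j * S k l + S i k * S j l + S i l * S j k := by
  have hsymm : ∀ a b, S a b = S b a := fun a b => by
    simpa using (hS.isHermitian.apply a b).symm
  have hint : ∀ c : Fin 4 → ℝ, Integrable (fun x : EuclideanSpace ℝ ι =>
      (∑ r, c r * x (![i, j, k, l] r)) ^ 4) (multivariateGaussian 0 S) := by
    intro c
    have h4 : MemLp (fun x : EuclideanSpace ℝ ι => ∑ r, c r * x (![i, j, k, l] r)) (4 : ℕ)
        (multivariateGaussian 0 S) :=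
      memLp_finsetSum _ fun r _ => by
        simpa using (memLp_eval_multivariateGaussian S (![i, j, k, l] r) 4).const_mul (c r)
    have := h4.integrable_norm_pow (by norm_num)
    refine this.congr (ae_of_all _ fun x => ?_)
    simp only [Real.norm_eq_abs]
    exact Even.pow_abs (by decide) _
  have e : ∀ x : EuclideanSpace ℝ ι, x i * x j * (x k * x l) = 1 / 192 *
      ((∑ r, ![1, 1, 1, 1] r * x (![i, j, k, l] r)) ^ 4
      - (∑ r, ![1, 1, 1, -1] r * x (![i, j, k, l] r)) ^ 4
      - (∑ r, ![1, 1, -1, 1] r * x (![i, j, k, l] r)) ^ 4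
      - (∑ r, ![1, -1, 1, 1] r * x (![i, j, k, l] r)) ^ 4
      + (∑ r, ![1, 1, -1, -1] r * x (![i, j, k, l] r)) ^ 4
      + (∑ r, ![1, -1, 1, -1] r * x (![i, j, k, l] r)) ^ 4
      + (∑ r, ![1, -1, -1, 1] r * x (![i, j, k, l] r)) ^ 4
      - (∑ r, ![1, -1, -1, -1] r * x (![i, j, k, l] r)) ^ 4) := by
    intro x
    simp [Fin.sum_univ_four]
    ring
  simp_rw [e]
  rw [integral_const_mul, integral_sub, integral_add, integral_add, integral_add, integral_sub,
    integral_sub, integral_sub]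
  · simp_rw [integral_linear_pow_four hS]
    simp [Fin.sum_univ_four]
    rw [hsymm j i, hsymm k i, hsymm l i, hsymm k j, hsymm l j, hsymm l k]
    ring
  all_goals
    repeat first
      | exact hint _
      | apply Integrable.sub
      | apply Integrable.add

end GaussianMoments

/-! ### Moments of the observations -/

section ObservationMoments

variable {p : ℕ}

instance isProbabilityMeasure_obsLaw (a : unitInterval) (S : Matrix (Fin p) (Fin p) ℝ) :
    IsProbabilityMeasure (obsLaw a S) :=
  Measure.isProbabilityMeasure_map (by fun_prop)

instance isProbabilityMeasure_sampleLaw (n : ℕ) (a : unitInterval)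
    (S : Matrix (Fin p) (Fin p) ℝ) : IsProbabilityMeasure (sampleLaw n a S) := by
  unfold sampleLaw; infer_instance

lemma integral_obsLaw (a : unitInterval) (S : Matrix (Fin p) (Fin p) ℝ) {f : (Fin p → ℝ) → ℝ}
    (hf : Measurable f) :
    ∫ y, f y ∂(obsLaw a S) =
      ∫ z, f (fun i => z.2 i * z.1 i) ∂((multivariateGaussian (0 : EuclideanSpace ℝ (Fin p)) S).prod
      (Measure.pi fun _ : Fin p => bernoulliMeasure (1 : ℝ) 0 a)) := by
  unfold obsLaw
  rw [integral_map (by fun_prop) hf.aestronglyMeasurable]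

lemma memLp_eval_obsLaw (a : unitInterval) (S : Matrix (Fin p) (Fin p) ℝ) (i : Fin p)
    (q : NNReal) : MemLp (fun y : Fin p → ℝ => y i) q (obsLaw a S) := by
  unfold obsLaw
  have hm : Measurable fun y : Fin p → ℝ => y i := measurable_pi_apply i
  rw [memLp_map_measure_iff hm.aestronglyMeasurable (by fun_prop)]
  have h := (memLp_eval_multivariateGaussian S i q).comp_fst
    (Measure.pi fun _ : Fin p => bernoulliMeasure (1 : ℝ) 0 a)
  refine h.mono (by fun_prop) ?_
  have h1 : ∀ᵐ e ∂(bernoulliMeasure (1 : ℝ) 0 a), |e| ≤ 1 := by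
    rw [bernoulliMeasure_def, ae_add_measure_iff]
    constructor <;> refine Measure.ae_smul_measure ?_ _ <;> rw [ae_dirac_eq] <;> simp
  have h2 : ∀ᵐ e ∂(Measure.pi fun _ : Fin p => bernoulliMeasure (1 : ℝ) 0 a), |e i| ≤ 1 :=
    (Measure.quasiMeasurePreserving_eval (fun _ : Fin p => bernoulliMeasure (1 : ℝ) 0 a) i).ae
      (p := fun x => |x| ≤ 1) h1
  have h3 := (Measure.quasiMeasurePreserving_snd (μ := multivariateGaussian
    (0 : EuclideanSpace ℝ (Fin p)) S)).ae h2
  filter_upwards [h3] with z hz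
  simp only [Function.comp, norm_mul, Real.norm_eq_abs]
  exact mul_le_of_le_one_left (abs_nonneg _) hz

lemma memLp_mul_eval_obsLaw (a : unitInterval) (S : Matrix (Fin p) (Fin p) ℝ) (i j : Fin p) :
    MemLp (fun y : Fin p → ℝ => y i * y j) 2 (obsLaw a S) := by
  have : ENNReal.HolderTriple ((4 : NNReal) : ℝ≥0∞) ((4 : NNReal) : ℝ≥0∞) 2 := by
    constructor
    rw [← two_mul]
    have : ((4 : NNReal) : ℝ≥0∞) = 2 * 2 := by norm_num
    rw [this, ENNReal.mul_inv (by simp) (by simp), ← mul_assoc,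
      ENNReal.mul_inv_cancel (by simp) (by simp), one_mul]
  exact (memLp_eval_obsLaw a S j 4).mul' (memLp_eval_obsLaw a S i 4)

/-- A product of Bernoulli variables depends only on the set of indices involved. -/
lemma integral_prod_bernoulli (a : unitInterval) {κ : Type*} [Fintype κ] (f : κ → Fin p) :
    ∫ e, ∏ r, e (f r) ∂(Measure.pi fun _ : Fin p => bernoulliMeasure (1 : ℝ) 0 a) =
      (a : ℝ) ^ (Finset.univ.image f).card := by
  classical
  have h1 : ∀ e : Fin p → ℝ, ∏ r, e (f r) =
      ∏ m, e m ^ (Finset.univ.filter fun r => f r = m).card := by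
    intro e
    rw [← Finset.prod_fiberwise' Finset.univ f e]
    simp
  simp_rw [h1]
  rw [integral_fintype_prod_eq_prod
    (f := fun m x => x ^ (Finset.univ.filter fun r => f r = m).card)]
  simp_rw [integral_bernoulliMeasure]
  rw [← Finset.prod_const, ← Finset.prod_subset (Finset.subset_univ (Finset.univ.image f))]
  · refine Finset.prod_congr rfl fun m hm => ?_
    have : (Finset.univ.filter fun r => f r = m).card ≠ 0 := by
      obtain ⟨r, -, hr⟩ := Finset.mem_image.1 hm
      exact Finset.card_ne_zero.2 ⟨r, by simp [hr]⟩
    simp [this]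
  · intro m _ hm
    have : (Finset.univ.filter fun r => f r = m).card = 0 := by
      rw [Finset.card_eq_zero, Finset.filter_eq_empty_iff]
      intro r _ hr
      exact hm (Finset.mem_image.2 ⟨r, Finset.mem_univ _, hr⟩)
    simp [this]

lemma integral_mul_obsLaw (a : unitInterval) {S : Matrix (Fin p) (Fin p) ℝ} (hS : S.PosSemidef)
    {i j : Fin p} (hij : i ≠ j) :
    ∫ y, y i * y j ∂(obsLaw a S) = (a : ℝ) ^ 2 * S i j := by
  rw [integral_obsLaw a S (by fun_prop)]
  have e : ∀ z : EuclideanSpace ℝ (Fin p) × (Fin p → ℝ), z.2 i * z.1 i * (z.2 j * z.1 j) =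
      (z.1 i * z.1 j) * ∏ r, z.2 (![i, j] r) := fun z => by simp [Fin.prod_univ_two]; ring
  simp_rw [e]
  rw [integral_prod_mul (fun x : EuclideanSpace ℝ (Fin p) => x i * x j)
    (fun e : Fin p → ℝ => ∏ r, e (![i, j] r)), integral_prod_bernoulli]
  have h := covariance_eq_sub (memLp_eval_multivariateGaussian S i 2)
    (memLp_eval_multivariateGaussian S j 2)
  have hm : ∀ i, ∫ x : EuclideanSpace ℝ (Fin p), x i ∂(multivariateGaussian 0 S) = 0 := by
    intro i
    have := (EuclideanSpace.proj (𝕜 := ℝ) i).integral_comp_id_comm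
      (IsGaussian.integrable_id (μ := multivariateGaussian (0 : EuclideanSpace ℝ (Fin p)) S))
    simpa using this
  rw [covariance_eval_multivariateGaussian hS, hm i, zero_mul, sub_zero] at h
  have hc : (Finset.univ.image ![i, j]).card = 2 := by
    rw [Finset.card_image_of_injective]
    · simp
    · intro r s; fin_cases r <;> fin_cases s <;> simp [hij, hij.symm]
  rw [hc, h]
  simp [mul_comm]

lemma integral_mul_four_obsLaw (a : unitInterval) {S : Matrix (Fin p) (Fin p) ℝ}
    (hS : S.PosSemidef) (i j k l : Fin p) :
    ∫ y, y i * y j * (y k * y l) ∂(obsLaw a S) =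
      (a : ℝ) ^ ({i, j, k, l} : Finset (Fin p)).card *
        (S i j * S k l + S i k * S j l + S i l * S j k) := by
  rw [integral_obsLaw a S (by fun_prop)]
  have e : ∀ z : EuclideanSpace ℝ (Fin p) × (Fin p → ℝ),
      z.2 i * z.1 i * (z.2 j * z.1 j) * (z.2 k * z.1 k * (z.2 l * z.1 l)) =
      (z.1 i * z.1 j * (z.1 k * z.1 l)) * ∏ r, z.2 (![i, j, k, l] r) :=
    fun z => by simp [Fin.prod_univ_four]; ring
  simp_rw [e]
  have hc : Finset.univ.image ![i, j, k, l] = {i, j, k, l} := by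
    ext m; simp [Fin.exists_fin_succ, eq_comm]
  rw [integral_prod_mul (fun x : EuclideanSpace ℝ (Fin p) => x i * x j * (x k * x l))
    (fun e : Fin p → ℝ => ∏ r, e (![i, j, k, l] r)), integral_prod_bernoulli,
    integral_mul_four_multivariateGaussian hS, hc, mul_comm]

end ObservationMoments

/-! ### U-statistics of order two -/

section UStatistic

variable {Ω B : Type*} [MeasurableSpace Ω] {μ : Measure Ω} [IsProbabilityMeasure μ]

lemma integrable_prod_pair_ite {n : ℕ} {V : B → Ω → ℝ} (hV : ∀ b, MemLp (V b) 2 μ)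
    (s t : Finset (Fin n)) (b c : B) :
    Integrable (fun ω : Fin n → Ω => (∏ m ∈ s, V b (ω m)) * ∏ m ∈ t, V c (ω m))
      (Measure.pi fun _ => μ) := by
  have hG : ∀ m, Integrable (fun x => (if m ∈ s then V b x else 1) *
      (if m ∈ t then V c x else 1)) μ := by
    intro m
    split_ifs
    · exact (hV b).integrable_mul (hV c)
    · simpa using (hV b).integrable (by norm_num)
    · simpa using (hV c).integrable (by norm_num)
    · simp
  refine (Integrable.fintype_prod hG).congr (ae_of_all _ fun ω => ?_)
  simp only [Finset.prod_mul_distrib, Finset.prod_ite_mem, Finset.univ_inter]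

/-- For centred square-integrable functions of independent variables, products over two different
index sets of the same size are orthogonal. -/
lemma integral_prod_pair {n : ℕ} {V : B → Ω → ℝ} (h0 : ∀ b, ∫ x, V b x ∂μ = 0)
    {s t : Finset (Fin n)} (hs : s.card = 2) (ht : t.card = 2) (b c : B) :
    ∫ ω : Fin n → Ω, (∏ m ∈ s, V b (ω m)) * ∏ m ∈ t, V c (ω m) ∂(Measure.pi fun _ => μ) =
      if s = t then (∫ x, V b x * V c x ∂μ) ^ 2 else 0 := by
  have e : ∀ ω : Fin n → Ω, (∏ m ∈ s, V b (ω m)) * ∏ m ∈ t, V c (ω m) =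
      ∏ m, (fun m x => (if m ∈ s then V b x else 1) * (if m ∈ t then V c x else 1)) m (ω m) := by
    intro ω; simp only [Finset.prod_mul_distrib, Finset.prod_ite_mem, Finset.univ_inter]
  simp_rw [e]
  rw [integral_fintype_prod_eq_prod
    (f := fun m x => (if m ∈ s then V b x else 1) * (if m ∈ t then V c x else 1))]
  split_ifs with hst
  · subst hst
    have : ∀ m, ∫ x, (if m ∈ s then V b x else 1) * (if m ∈ s then V c x else 1) ∂μ =
        if m ∈ s then ∫ x, V b x * V c x ∂μ else 1 := by
      intro m; split_ifs <;> simp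
    simp_rw [this]
    rw [Finset.prod_ite_mem, Finset.univ_inter, Finset.prod_const, hs]
  · obtain ⟨m, hm, hm'⟩ : ∃ m ∈ s, m ∉ t := by
      by_contra! h
      exact hst (Finset.eq_of_subset_of_card_le h (by omega))
    refine Finset.prod_eq_zero (Finset.mem_univ m) ?_
    simp [hm, hm', h0]

lemma filter_pair_eq {n : ℕ} {q : Fin n × Fin n} (hq : q.1 ≠ q.2) :
    (Finset.univ.offDiag.filter fun r : Fin n × Fin n =>
      ({q.1, q.2} : Finset (Fin n)) = {r.1, r.2}) = {q, q.swap} := by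
  ext r
  simp only [Finset.mem_filter, Finset.mem_offDiag, Finset.mem_univ, true_and, Finset.mem_insert,
    Finset.mem_singleton]
  constructor
  · rintro ⟨hr, h⟩
    have h1 : r.1 ∈ ({q.1, q.2} : Finset (Fin n)) := h ▸ by simp
    have h2 : r.2 ∈ ({q.1, q.2} : Finset (Fin n)) := h ▸ by simp
    simp only [Finset.mem_insert, Finset.mem_singleton] at h1 h2
    rcases h1 with h1 | h1 <;> rcases h2 with h2 | h2
    · exact absurd (h1.trans h2.symm) hr
    · left; ext1 <;> assumption
    · right; ext1 <;> assumption
    · exact absurd (h1.trans h2.symm) hr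
  · rintro (rfl | rfl)
    · exact ⟨hq, rfl⟩
    · exact ⟨hq.symm, Finset.pair_comm _ _⟩

variable [Fintype B]

lemma integrable_degenerate_sq (n : ℕ) {V : B → Ω → ℝ} (hV : ∀ b, MemLp (V b) 2 μ) :
    Integrable (fun ω : Fin n → Ω => (∑ q ∈ Finset.univ.offDiag,
      ∑ b, V b (ω q.1) * V b (ω q.2)) ^ 2) (Measure.pi fun _ => μ) := by
  simp_rw [pow_two, Finset.sum_mul_sum]
  refine integrable_finsetSum _ fun q hq => integrable_finsetSum _ fun r hr =>
    integrable_finsetSum _ fun b _ => integrable_finsetSum _ fun c _ => ?_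
  have := integrable_prod_pair_ite hV {q.1, q.2} {r.1, r.2} b c
  simp only [Finset.mem_offDiag] at hq hr
  simpa [Finset.prod_pair hq.2.2, Finset.prod_pair hr.2.2] using this

/-- Second moment of a completely degenerate `U`-statistic of order two. -/
lemma integral_degenerate_sq (n : ℕ) {V : B → Ω → ℝ} (hV : ∀ b, MemLp (V b) 2 μ)
    (h0 : ∀ b, ∫ x, V b x ∂μ = 0) :
    ∫ ω : Fin n → Ω, (∑ q ∈ Finset.univ.offDiag,
      ∑ b, V b (ω q.1) * V b (ω q.2)) ^ 2 ∂(Measure.pi fun _ => μ) =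
      2 * (n * (n - 1)) * ∑ b, ∑ c, (∫ x, V b x * V c x ∂μ) ^ 2 := by
  have hint : ∀ q ∈ (Finset.univ : Finset (Fin n)).offDiag,
      ∀ r ∈ (Finset.univ : Finset (Fin n)).offDiag, ∀ b c : B,
      Integrable (fun ω : Fin n → Ω =>
        V b (ω q.1) * V b (ω q.2) * (V c (ω r.1) * V c (ω r.2))) (Measure.pi fun _ => μ) := by
    intro q hq r hr b c
    have := integrable_prod_pair_ite hV {q.1, q.2} {r.1, r.2} b c
    simp only [Finset.mem_offDiag] at hq hr
    simpa [Finset.prod_pair hq.2.2, Finset.prod_pair hr.2.2] using this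
  simp_rw [pow_two, Finset.sum_mul_sum]
  rw [integral_finsetSum _ fun q hq => integrable_finsetSum _ fun r hr =>
    integrable_finsetSum _ fun b _ => integrable_finsetSum _ fun c _ => hint q hq r hr b c]
  have key : ∀ q ∈ (Finset.univ : Finset (Fin n)).offDiag,
      ∫ ω : Fin n → Ω, ∑ r ∈ Finset.univ.offDiag, ∑ b, ∑ c,
        V b (ω q.1) * V b (ω q.2) * (V c (ω r.1) * V c (ω r.2)) ∂(Measure.pi fun _ => μ) =
      2 * ∑ b, ∑ c, (∫ x, V b x * V c x ∂μ) ^ 2 := by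
    intro q hq
    rw [integral_finsetSum _ fun r hr =>
      integrable_finsetSum _ fun b _ => integrable_finsetSum _ fun c _ => hint q hq r hr b c]
    have hq' := (Finset.mem_offDiag.1 hq).2.2
    have h1 : ∀ r ∈ (Finset.univ : Finset (Fin n)).offDiag,
        ∫ ω : Fin n → Ω, ∑ b, ∑ c,
          V b (ω q.1) * V b (ω q.2) * (V c (ω r.1) * V c (ω r.2)) ∂(Measure.pi fun _ => μ) =
        if ({q.1, q.2} : Finset (Fin n)) = {r.1, r.2} then
          ∑ b, ∑ c, (∫ x, V b x * V c x ∂μ) ^ 2 else 0 := by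
      intro r hr
      have hr' := (Finset.mem_offDiag.1 hr).2.2
      rw [integral_finsetSum _ fun b _ => integrable_finsetSum _ fun c _ => hint q hq r hr b c]
      simp_rw [integral_finsetSum _ fun c _ => hint q hq r hr _ c]
      have h2 : ∀ b c, ∫ ω : Fin n → Ω, V b (ω q.1) * V b (ω q.2) *
          (V c (ω r.1) * V c (ω r.2)) ∂(Measure.pi fun _ => μ) =
          if ({q.1, q.2} : Finset (Fin n)) = {r.1, r.2} then
            (∫ x, V b x * V c x ∂μ) ^ 2 else 0 := by
        intro b c
        rw [← integral_prod_pair h0 (Finset.card_pair hq') (Finset.card_pair hr') b c]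
        simp [Finset.prod_pair hq', Finset.prod_pair hr']
      simp_rw [h2]
      split_ifs <;> simp
    rw [Finset.sum_congr rfl h1, ← Finset.sum_filter, filter_pair_eq hq', Finset.sum_const,
      Finset.card_pair]
    · simp
    · intro h
      exact hq' (congrArg Prod.fst h)
  rw [Finset.sum_congr rfl (by simpa only [pow_two] using key), Finset.sum_const,
    Finset.offDiag_card]
  have : (((Finset.univ : Finset (Fin n)).card * (Finset.univ : Finset (Fin n)).card -
      (Finset.univ : Finset (Fin n)).card : ℕ) : ℝ) = n * (n - 1) := by
    rw [Nat.cast_sub (by simp; exact Nat.le_mul_self n)]; simp; ring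
  rw [nsmul_eq_mul, this]
  ring

lemma integral_linear_sq (n : ℕ) {V : B → Ω → ℝ} (hV : ∀ b, MemLp (V b) 2 μ)
    (h0 : ∀ b, ∫ x, V b x ∂μ = 0) (θ : B → ℝ) :
    ∫ ω : Fin n → Ω, (∑ k, ∑ b, θ b * V b (ω k)) ^ 2 ∂(Measure.pi fun _ => μ) =
      n * ∑ b, ∑ c, θ b * θ c * ∫ x, V b x * V c x ∂μ := by
  have hh : MemLp (fun x => ∑ b, θ b * V b x) 2 μ :=
    memLp_finsetSum _ fun b _ => (hV b).const_mul _
  have hh0 : ∫ x, ∑ b, θ b * V b x ∂μ = 0 := by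
    rw [integral_finsetSum _ fun b _ => ((hV b).const_mul _).integrable (by norm_num)]
    simp [integral_const_mul, h0]
  have hv := variance_sum_pi (μ := fun _ : Fin n => μ)
    (X := fun _ : Fin n => fun x => ∑ b, θ b * V b x) (fun _ => hh)
  have hmeas : AEMeasurable (∑ i : Fin n, fun ω : Fin n → Ω => ∑ b, θ b * V b (ω i))
      (Measure.pi fun _ => μ) :=
    Finset.aemeasurable_sum _ fun i _ => (hh.aestronglyMeasurable.comp_quasiMeasurePreserving
      (Measure.quasiMeasurePreserving_eval (fun _ : Fin n => μ) i)).aemeasurable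
  have hz : (Measure.pi fun _ : Fin n => μ)[∑ i : Fin n,
      fun ω : Fin n → Ω => ∑ b, θ b * V b (ω i)] = 0 := by
    simp_rw [Finset.sum_apply]
    rw [integral_finsetSum]
    · refine Finset.sum_eq_zero fun k _ => ?_
      rw [integral_comp_eval (μ := fun _ : Fin n => μ) (f := fun x => ∑ b, θ b * V b x)
        hh.aestronglyMeasurable, hh0]
    · intro k _
      exact integrable_comp_eval (μ := fun _ : Fin n => μ) (f := fun x => ∑ b, θ b * V b x)
        (hh.integrable (by norm_num))
  rw [variance_of_integral_eq_zero hmeas hz] at hv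
  simp only [Finset.sum_apply] at hv
  rw [hv, Finset.sum_const, variance_of_integral_eq_zero hh.aestronglyMeasurable.aemeasurable hh0]
  simp only [Finset.card_univ, Fintype.card_fin, nsmul_eq_mul]
  congr 1
  have e : ∀ x, ((fun x => ∑ b, θ b * V b x) ^ 2) x =
      ∑ b, ∑ c, θ b * θ c * (V b x * V c x) := by
    intro x
    simp only [Pi.pow_apply, pow_two, Finset.sum_mul_sum]
    exact Finset.sum_congr rfl fun b _ => Finset.sum_congr rfl fun c _ => by ring
  simp only [Pi.pow_apply] at e
  simp_rw [e]
  have hi : ∀ b c, Integrable (fun x => θ b * θ c * (V b x * V c x)) μ :=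
    fun b c => ((hV b).integrable_mul (hV c)).const_mul _
  rw [integral_finsetSum _ fun b _ => integrable_finsetSum _ fun c _ => hi b c]
  simp_rw [integral_finsetSum _ fun c _ => hi _ c, integral_const_mul]

lemma sum_offDiag_fst {n : ℕ} (h : Fin n → ℝ) :
    ∑ q ∈ (Finset.univ : Finset (Fin n)).offDiag, h q.1 = (n - 1) * ∑ k, h k := by
  have h1 := Finset.sum_product (Finset.univ : Finset (Fin n)) Finset.univ
    (fun q : Fin n × Fin n => h q.1)
  rw [← Finset.diag_union_offDiag, Finset.sum_union (Finset.disjoint_diag_offDiag _)] at h1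
  simp only [Finset.sum_diag, Finset.sum_const, Finset.card_univ, Fintype.card_fin,
    nsmul_eq_mul, ← Finset.mul_sum] at h1
  linarith

lemma sum_offDiag_snd {n : ℕ} (h : Fin n → ℝ) :
    ∑ q ∈ (Finset.univ : Finset (Fin n)).offDiag, h q.2 = (n - 1) * ∑ k, h k := by
  rw [← sum_offDiag_fst h]
  refine Finset.sum_nbij' Prod.swap Prod.swap ?_ ?_ ?_ ?_ ?_ <;> simp [eq_comm]

/-- Mean square deviation of a `U`-statistic `∑_{k ≠ l} ⟨F(ω_k), F(ω_l)⟩` from its mean, in terms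
of the mean `θ` of `F` and of a bound `Γ` on the Frobenius norm of the covariance matrix of `F`.
The Hoeffding decomposition splits the deviation into a linear and a degenerate part. -/
lemma integral_uStat_sub_mean_sq_le (n : ℕ) {F : B → Ω → ℝ} (hF : ∀ b, MemLp (F b) 2 μ)
    {Γ : ℝ} (hΓ : 0 ≤ Γ)
    (hC : ∑ b, ∑ c, (∫ x, (F b x - ∫ x, F b x ∂μ) * (F c x - ∫ x, F c x ∂μ) ∂μ) ^ 2 ≤ Γ ^ 2) :
    Integrable (fun ω : Fin n → Ω => (∑ q ∈ Finset.univ.offDiag, ∑ b, F b (ω q.1) * F b (ω q.2)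
      - n * (n - 1) * ∑ b, (∫ x, F b x ∂μ) ^ 2) ^ 2) (Measure.pi fun _ => μ) ∧
    ∫ ω : Fin n → Ω, (∑ q ∈ Finset.univ.offDiag, ∑ b, F b (ω q.1) * F b (ω q.2)
      - n * (n - 1) * ∑ b, (∫ x, F b x ∂μ) ^ 2) ^ 2 ∂(Measure.pi fun _ => μ) ≤
      8 * n * (n - 1) ^ 2 * (∑ b, (∫ x, F b x ∂μ) ^ 2) * Γ + 4 * (n * (n - 1)) * Γ ^ 2 := by
  set θ : B → ℝ := fun b => ∫ x, F b x ∂μ with hθ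
  set V : B → Ω → ℝ := fun b x => F b x - θ b with hVdef
  have hV : ∀ b, MemLp (V b) 2 μ := fun b => (hF b).sub (memLp_const _)
  have h0 : ∀ b, ∫ x, V b x ∂μ = 0 := by
    intro b
    simp only [hVdef]
    rw [integral_sub ((hF b).integrable (by norm_num)) (integrable_const _)]
    simp [hθ]
  set H : (Fin n → Ω) → ℝ := fun ω => ∑ k, ∑ b, θ b * V b (ω k) with hH
  set D : (Fin n → Ω) → ℝ := fun ω => ∑ q ∈ Finset.univ.offDiag,
    ∑ b, V b (ω q.1) * V b (ω q.2) with hD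
  have hdec : ∀ ω : Fin n → Ω, ∑ q ∈ Finset.univ.offDiag, ∑ b, F b (ω q.1) * F b (ω q.2)
      - n * (n - 1) * ∑ b, θ b ^ 2 = 2 * (n - 1) * H ω + D ω := by
    intro ω
    have e : ∀ q : Fin n × Fin n, ∑ b, F b (ω q.1) * F b (ω q.2) =
        ∑ b, θ b ^ 2 + ∑ b, θ b * V b (ω q.1) + ∑ b, θ b * V b (ω q.2)
          + ∑ b, V b (ω q.1) * V b (ω q.2) := by
      intro q
      simp only [← Finset.sum_add_distrib, hVdef]
      exact Finset.sum_congr rfl fun b _ => by ring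
    simp_rw [e, Finset.sum_add_distrib]
    rw [sum_offDiag_fst (fun k => ∑ b, θ b * V b (ω k)),
      sum_offDiag_snd (fun k => ∑ b, θ b * V b (ω k)),
      sum_offDiag_fst (fun _ : Fin n => ∑ b, θ b ^ 2)]
    simp only [hH, hD, Finset.sum_const, Finset.card_univ, Fintype.card_fin, nsmul_eq_mul]
    ring
  have hHmem : MemLp H 2 (Measure.pi fun _ => μ) :=
    memLp_finsetSum _ fun k _ => memLp_finsetSum _ fun b _ =>
      ((hV b).comp_measurePreserving (measurePreserving_eval (fun _ : Fin n => μ) k)).const_mul _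
  have hDmeas : AEStronglyMeasurable D (Measure.pi fun _ => μ) := by
    have : ∀ b (k : Fin n), AEStronglyMeasurable (fun ω : Fin n → Ω => V b (ω k))
        (Measure.pi fun _ => μ) := fun b k =>
      (hV b).aestronglyMeasurable.comp_quasiMeasurePreserving
        (Measure.quasiMeasurePreserving_eval (fun _ : Fin n => μ) k)
    exact Finset.aestronglyMeasurable_fun_sum _ fun q _ =>
      Finset.aestronglyMeasurable_fun_sum _ fun b _ => (this b q.1).mul (this b q.2)
  have hDmem : MemLp D 2 (Measure.pi fun _ => μ) :=
    (memLp_two_iff_integrable_sq hDmeas).2 (integrable_degenerate_sq n hV)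
  have hHint := integral_linear_sq n hV h0 θ
  have hDint := integral_degenerate_sq n hV h0
  simp only [hθ] at hdec
  have hC' : ∑ b, ∑ c, (∫ x, V b x * V c x ∂μ) ^ 2 ≤ Γ ^ 2 := hC
  simp_rw [hdec]
  refine ⟨((hHmem.const_mul _).add hDmem).integrable_sq, ?_⟩
  have hCS : ∑ b, ∑ c, θ b * θ c * ∫ x, V b x * V c x ∂μ ≤ (∑ b, θ b ^ 2) * Γ := by
    have h1 := Finset.sum_mul_sq_le_sq_mul_sq (Finset.univ ×ˢ Finset.univ)
      (fun q : B × B => θ q.1 * θ q.2) (fun q : B × B => ∫ x, V q.1 x * V q.2 x ∂μ)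
    simp only [Finset.sum_product] at h1
    have h2 : ∑ b, ∑ c, (θ b * θ c) ^ 2 = (∑ b, θ b ^ 2) ^ 2 := by
      rw [pow_two (∑ b, θ b ^ 2), Finset.sum_mul_sum]
      simp_rw [mul_pow]
    rw [h2] at h1
    have h3 : 0 ≤ ∑ b, θ b ^ 2 := Finset.sum_nonneg fun b _ => sq_nonneg _
    refine abs_le_of_sq_le_sq' ?_ (mul_nonneg h3 hΓ) |>.2
    rw [mul_pow]
    exact h1.trans (mul_le_mul_of_nonneg_left hC (sq_nonneg _))
  have hn : (0 : ℝ) ≤ n * (n - 1) := by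
    rcases Nat.eq_zero_or_pos n with h | h
    · simp [h]
    · have : (1 : ℝ) ≤ n := by exact_mod_cast h
      exact mul_nonneg (by linarith) (by linarith)
  calc ∫ ω : Fin n → Ω, (2 * (n - 1) * H ω + D ω) ^ 2 ∂(Measure.pi fun _ => μ)
      ≤ ∫ ω : Fin n → Ω, (8 * (n - 1) ^ 2 * H ω ^ 2 + 2 * D ω ^ 2)
          ∂(Measure.pi fun _ => μ) := by
        refine integral_mono (((hHmem.const_mul _).add hDmem).integrable_sq)
          ((hHmem.integrable_sq.const_mul _).add (hDmem.integrable_sq.const_mul _)) fun ω => ?_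
        change (2 * (n - 1) * H ω + D ω) ^ 2 ≤ 8 * (n - 1) ^ 2 * H ω ^ 2 + 2 * D ω ^ 2
        nlinarith [sq_nonneg (2 * (n - 1) * H ω - D ω)]
    _ = 8 * (n - 1) ^ 2 * (n * ∑ b, ∑ c, θ b * θ c * ∫ x, V b x * V c x ∂μ) +
        2 * (2 * (n * (n - 1)) * ∑ b, ∑ c, (∫ x, V b x * V c x ∂μ) ^ 2) := by
        rw [integral_add (hHmem.integrable_sq.const_mul _) (hDmem.integrable_sq.const_mul _),
          integral_const_mul, integral_const_mul, hHint, hDint]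
    _ ≤ 8 * (n - 1) ^ 2 * (n * ((∑ b, θ b ^ 2) * Γ)) + 2 * (2 * (n * (n - 1)) * Γ ^ 2) := by
        gcongr
    _ = _ := by ring

end UStatistic

/-! ### The ellipsoid and the band above the diagonal -/

section Ellipsoid

variable {p : ℕ}

/-- The distance of the position `(i, j)` from the main diagonal. -/
def gap (i j : Fin p) : ℝ := |((i : ℕ) : ℝ) - ((j : ℕ) : ℝ)|

lemma gap_nonneg (i j : Fin p) : 0 ≤ gap i j := abs_nonneg _

lemma gap_comm (i j : Fin p) : gap i j = gap j i := abs_sub_comm _ _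

lemma gap_self (i : Fin p) : gap i i = 0 := by simp [gap]

lemma one_le_gap {i j : Fin p} (h : i < j) : 1 ≤ gap i j := by
  unfold gap
  rw [abs_sub_comm]
  refine le_trans ?_ (le_abs_self _)
  have : ((i : ℕ) : ℝ) + 1 ≤ ((j : ℕ) : ℝ) := by exact_mod_cast h
  linarith

lemma card_gap_le (i : Fin p) {r : ℝ} (hr : 0 ≤ r) :
    ∑ k : Fin p, (if gap k i ≤ r then (1 : ℝ) else 0) ≤ 2 * r + 1 := by
  rw [← Finset.sum_filter, Finset.sum_const, nsmul_eq_mul, mul_one]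
  have h1 : (Finset.univ.filter fun k : Fin p => gap k i ≤ r).card ≤
      (Finset.Icc (((i : ℕ) : ℤ) - ⌊r⌋) (((i : ℕ) : ℤ) + ⌊r⌋)).card := by
    refine Finset.card_le_card_of_injOn (fun k => ((k : ℕ) : ℤ)) ?_ ?_
    · intro k hk
      have hk' : gap k i ≤ r := by simpa using hk
      unfold gap at hk'
      have h2 : |((k : ℕ) : ℤ) - ((i : ℕ) : ℤ)| ≤ ⌊r⌋ := by
        rw [Int.le_floor]; push_cast; exact hk'
      rw [abs_le] at h2
      simp only [Finset.coe_Icc, Set.mem_Icc]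
      constructor <;> linarith [h2.1, h2.2]
    · intro k _ l _ h
      simp only [Nat.cast_inj] at h
      exact Fin.ext h
  have h3 : ((Finset.Icc (((i : ℕ) : ℤ) - ⌊r⌋) (((i : ℕ) : ℤ) + ⌊r⌋)).card : ℝ) =
      2 * ⌊r⌋ + 1 := by
    rw [Int.card_Icc]
    have h4 : 0 ≤ ⌊r⌋ := Int.floor_nonneg.2 hr
    have h5 : ((((i : ℕ) : ℤ) + ⌊r⌋ + 1 - (((i : ℕ) : ℤ) - ⌊r⌋)).toNat : ℤ) = 2 * ⌊r⌋ + 1 := by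
      rw [Int.toNat_of_nonneg (by linarith)]; ring
    exact_mod_cast h5
  calc ((Finset.univ.filter fun k : Fin p => gap k i ≤ r).card : ℝ)
      ≤ ((Finset.Icc (((i : ℕ) : ℤ) - ⌊r⌋) (((i : ℕ) : ℤ) + ⌊r⌋)).card : ℝ) := by
        exact_mod_cast h1
    _ = 2 * ⌊r⌋ + 1 := h3
    _ ≤ 2 * r + 1 := by linarith [Int.floor_le r]

lemma apply_comm_of_posSemidef {S : Matrix (Fin p) (Fin p) ℝ} (hS : S.PosSemidef) (i j : Fin p) :
    S i j = S j i := by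
  simpa using (hS.isHermitian.apply i j).symm

lemma sq_apply_le_one {S : Matrix (Fin p) (Fin p) ℝ} (hS : S.PosSemidef)
    (h1 : ∀ i, S i i = 1) (i j : Fin p) : S i j ^ 2 ≤ 1 := by
  have key : ∀ c : ℝ, 0 ≤ 1 + 2 * c * S i j + c ^ 2 := by
    intro c
    have h := hS.dotProduct_mulVec_nonneg (Pi.single i 1 + c • Pi.single j 1)
    have e : star (Pi.single i 1 + c • Pi.single j 1 : Fin p → ℝ) ⬝ᵥ
        S.mulVec (Pi.single i 1 + c • Pi.single j 1) = 1 + 2 * c * S i j + c ^ 2 := by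
      simp only [star_trivial, Matrix.mulVec_add, Matrix.mulVec_smul, add_dotProduct,
        dotProduct_add, smul_dotProduct, dotProduct_smul, single_dotProduct,
        Matrix.mulVec_single_one, Matrix.col_apply, h1, smul_eq_mul, one_mul, mul_one]
      rw [apply_comm_of_posSemidef hS j i]
      ring
    rwa [e] at h
  nlinarith [key (S i j), key (-S i j)]

lemma sum_sq_mul_gap_le {α : ℝ} (hα : 1 / 2 ≤ α) {S : Matrix (Fin p) (Fin p) ℝ}
    (hS : S ∈ ellipsoid p α) :
    ∑ i, ∑ j, (if i < j then S i j ^ 2 * gap i j else 0) ≤ p := by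
  obtain ⟨-, -, h⟩ := hS
  rcases Nat.eq_zero_or_pos p with rfl | hp
  · simp
  have hp' : (0 : ℝ) < p := by exact_mod_cast hp
  rw [one_div, inv_mul_le_iff₀ hp', mul_one] at h
  refine le_trans (Finset.sum_le_sum fun i _ => ?_) h
  rw [← Finset.sum_filter]
  have : (Finset.univ.filter fun j => i < j) = Finset.Ioi i := by ext; simp
  rw [this]
  refine Finset.sum_le_sum fun j hj => mul_le_mul_of_nonneg_left ?_ (sq_nonneg _)
  exact Real.self_le_rpow_of_one_le (one_le_gap (Finset.mem_Ioi.1 hj)) (by linarith)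

lemma sum_sq_mul_two_gap_add_one_le {α : ℝ} (hα : 1 / 2 ≤ α) {S : Matrix (Fin p) (Fin p) ℝ}
    (hS : S ∈ ellipsoid p α) :
    ∑ i, ∑ j, S i j ^ 2 * (2 * gap i j + 1) ≤ (7 * p : ℝ) := by
  have h := sum_sq_mul_gap_le hα hS
  have hsymm := apply_comm_of_posSemidef hS.1.posSemidef
  have hdiag := hS.2.1
  have hle : ∀ i j, S i j ^ 2 * (2 * gap i j + 1) ≤ (if i = j then (1 : ℝ) else 0) +
      3 * (if i < j then S i j ^ 2 * gap i j else 0) +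
      3 * (if j < i then S j i ^ 2 * gap j i else 0) := by
    intro i j
    rcases lt_trichotomy i j with h | h | h
    · have := one_le_gap h
      simp only [h, h.ne, h.not_gt, if_true, if_false]
      nlinarith [sq_nonneg (S i j)]
    · subst h; simp [hdiag, gap_self]
    · have := one_le_gap h
      simp only [h, h.ne', h.not_gt, if_true, if_false]
      rw [hsymm i j, gap_comm i j]
      nlinarith [sq_nonneg (S j i)]
  calc ∑ i, ∑ j, S i j ^ 2 * (2 * gap i j + 1)
      ≤ ∑ i : Fin p, ∑ j : Fin p, ((if i = j then (1 : ℝ) else 0) +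
      3 * (if i < j then S i j ^ 2 * gap i j else 0) +
      3 * (if j < i then S j i ^ 2 * gap j i else 0)) :=
        Finset.sum_le_sum fun i _ => Finset.sum_le_sum fun j _ => hle i j
    _ = p + 3 * (∑ i, ∑ j, (if i < j then S i j ^ 2 * gap i j else 0)) +
        3 * ∑ i, ∑ j, (if i < j then S i j ^ 2 * gap i j else 0) := by
        simp only [Finset.sum_add_distrib, ← Finset.mul_sum]
        rw [Finset.sum_comm (f := fun i j => if j < i then S j i ^ 2 * gap j i else 0)]
        simp
    _ ≤ 7 * p := by linarith

/-- The indicator of the band of width `m` above the diagonal. -/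
def band (m : ℕ) (i j : Fin p) : ℝ := if i < j ∧ (j : ℕ) - (i : ℕ) < m then 1 else 0

lemma band_nonneg (m : ℕ) (i j : Fin p) : 0 ≤ band m i j := by unfold band; split_ifs <;> simp

lemma band_sq (m : ℕ) (i j : Fin p) : band m i j * band m i j = band m i j := by
  unfold band; split_ifs <;> simp

lemma band_le_lt (m : ℕ) (i j : Fin p) : band m i j ≤ if i < j then 1 else 0 := by
  unfold band; split_ifs <;> simp_all

lemma band_le_gap (m : ℕ) (i j : Fin p) : band m i j ≤ if gap i j ≤ m then 1 else 0 := by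
  unfold band
  split_ifs with h1 h2
  · exact le_rfl
  · refine absurd ?_ h2
    obtain ⟨h3, h4⟩ := h1
    have h5 : (i : ℕ) < j := h3
    have h6 : (j : ℕ) ≤ i + m := by omega
    have h5' : ((i : ℕ) : ℝ) < (j : ℕ) := by exact_mod_cast h5
    have h6' : ((j : ℕ) : ℝ) ≤ (i : ℕ) + m := by exact_mod_cast h6
    unfold gap
    rw [abs_le]; constructor <;> linarith
  · simp
  · simp

/-- The main combinatorial estimate: of the two entries `S i k` and `S j l`, the one closer to the
diagonal is bounded by one, and the number of its positions is controlled by the gap of the other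
entry, which is then summed against the ellipsoid constraint. -/
lemma sum_band_mul_sq_mul_sq_le {α : ℝ} (hα : 1 / 2 ≤ α) {S : Matrix (Fin p) (Fin p) ℝ}
    (hS : S ∈ ellipsoid p α) {m : ℕ} (hm : 1 ≤ m) :
    ∑ i, ∑ j, ∑ k, ∑ l, (if gap i j ≤ m then (1 : ℝ) else 0) * (if gap k l ≤ m then 1 else 0) *
      (S i k ^ 2 * S j l ^ 2) ≤ (42 * m * p : ℝ) := by
  have h7 := sum_sq_mul_two_gap_add_one_le hα hS
  have hone := sq_apply_le_one hS.1.posSemidef hS.2.1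
  have hm' : (1 : ℝ) ≤ m := by exact_mod_cast hm
  have half : ∑ j, ∑ l, ∑ i, ∑ k, (if gap i j ≤ m then (1 : ℝ) else 0) *
      ((if gap k i ≤ gap j l then 1 else 0) * S j l ^ 2) ≤ (21 * m * p : ℝ) := by
    calc ∑ j, ∑ l, ∑ i, ∑ k, (if gap i j ≤ m then (1 : ℝ) else 0) *
          ((if gap k i ≤ gap j l then 1 else 0) * S j l ^ 2)
        ≤ ∑ j, ∑ l, 3 * (m : ℝ) * (S j l ^ 2 * (2 * gap j l + 1)) := by
          refine Finset.sum_le_sum fun j _ => Finset.sum_le_sum fun l _ => ?_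
          simp_rw [← Finset.mul_sum, ← Finset.sum_mul]
          calc ∑ i, (if gap i j ≤ m then (1 : ℝ) else 0) *
                ((∑ k, if gap k i ≤ gap j l then (1 : ℝ) else 0) * S j l ^ 2)
              ≤ ∑ i, (if gap i j ≤ m then (1 : ℝ) else 0) *
                ((2 * gap j l + 1) * S j l ^ 2) := by
                refine Finset.sum_le_sum fun i _ => ?_
                refine mul_le_mul_of_nonneg_left ?_ (by split_ifs <;> simp)
                exact mul_le_mul_of_nonneg_right (card_gap_le i (gap_nonneg j l)) (sq_nonneg _)
            _ ≤ (2 * (m : ℝ) + 1) * ((2 * gap j l + 1) * S j l ^ 2) := by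
                rw [← Finset.sum_mul]
                have := gap_nonneg j l
                exact mul_le_mul_of_nonneg_right (card_gap_le j (by positivity)) (by positivity)
            _ ≤ 3 * (m : ℝ) * (S j l ^ 2 * (2 * gap j l + 1)) := by
                have := gap_nonneg j l
                rw [mul_comm (S j l ^ 2)]
                exact mul_le_mul_of_nonneg_right (by linarith) (by positivity)
      _ = 3 * (m : ℝ) * ∑ j, ∑ l, S j l ^ 2 * (2 * gap j l + 1) := by simp_rw [Finset.mul_sum]
      _ ≤ 3 * (m : ℝ) * (7 * (p : ℝ)) := mul_le_mul_of_nonneg_left h7 (by positivity)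
      _ = 21 * (m : ℝ) * (p : ℝ) := by ring
  have hle : ∀ i j k l, (if gap i j ≤ m then (1 : ℝ) else 0) * (if gap k l ≤ m then 1 else 0) *
      (S i k ^ 2 * S j l ^ 2) ≤ (if gap i j ≤ m then (1 : ℝ) else 0) *
      ((if gap k i ≤ gap j l then 1 else 0) * S j l ^ 2) +
      (if gap j i ≤ m then (1 : ℝ) else 0) *
      ((if gap l j ≤ gap i k then 1 else 0) * S i k ^ 2) := by
    intro i j k l
    rw [gap_comm j i, ← mul_add]
    have h1 := hone i k
    have h2 := hone j l
    have h3 := sq_nonneg (S i k)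
    have h4 := sq_nonneg (S j l)
    have h5 : S i k ^ 2 * S j l ^ 2 ≤ (if gap k i ≤ gap j l then 1 else 0) * S j l ^ 2 +
        (if gap l j ≤ gap i k then 1 else 0) * S i k ^ 2 := by
      rw [gap_comm k i, gap_comm l j]
      rcases le_total (gap i k) (gap j l) with h | h
      · rw [if_pos h]
        have : (0 : ℝ) ≤ (if gap j l ≤ gap i k then 1 else 0) * S i k ^ 2 := by
          split_ifs <;> positivity
        nlinarith
      · rw [if_pos h]
        have : (0 : ℝ) ≤ (if gap i k ≤ gap j l then 1 else 0) * S j l ^ 2 := by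
          split_ifs <;> positivity
        nlinarith
    rw [mul_assoc]
    refine mul_le_mul_of_nonneg_left ?_ (by split_ifs <;> simp)
    refine le_trans ?_ h5
    exact mul_le_of_le_one_left (mul_nonneg h3 h4) (by split_ifs <;> simp)
  calc _ ≤ ∑ i, ∑ j, ∑ k, ∑ l, ((if gap i j ≤ m then (1 : ℝ) else 0) *
      ((if gap k i ≤ gap j l then 1 else 0) * S j l ^ 2) +
      (if gap j i ≤ m then (1 : ℝ) else 0) *
      ((if gap l j ≤ gap i k then 1 else 0) * S i k ^ 2)) :=
        Finset.sum_le_sum fun i _ => Finset.sum_le_sum fun j _ => Finset.sum_le_sum fun k _ =>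
          Finset.sum_le_sum fun l _ => hle i j k l
    _ = ∑ j, ∑ l, ∑ i, ∑ k, (if gap i j ≤ m then (1 : ℝ) else 0) *
          ((if gap k i ≤ gap j l then 1 else 0) * S j l ^ 2) +
        ∑ j, ∑ l, ∑ i, ∑ k, (if gap i j ≤ m then (1 : ℝ) else 0) *
          ((if gap k i ≤ gap j l then 1 else 0) * S j l ^ 2) := by
        simp only [Finset.sum_add_distrib]
        congr 1
        · rw [Finset.sum_comm]
          refine Finset.sum_congr rfl fun j _ => ?_
          rw [Finset.sum_congr rfl fun i _ => Finset.sum_comm, Finset.sum_comm]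
        · exact Finset.sum_congr rfl fun i _ => Finset.sum_comm
    _ ≤ 42 * (m : ℝ) * (p : ℝ) := by linarith

end Ellipsoid

/-! ### The covariance matrix of the products on the band -/

section BandCovariance

variable {p : ℕ}

/-- The products `y_i y_j` on the band of the `U`-statistic, extended by zero. -/
def bandProd (m : ℕ) (q : Fin p × Fin p) (y : Fin p → ℝ) : ℝ :=
  band m q.1 q.2 * (y q.1 * y q.2)

lemma memLp_bandProd (m : ℕ) (a : unitInterval) (S : Matrix (Fin p) (Fin p) ℝ)
    (q : Fin p × Fin p) : MemLp (bandProd m q) 2 (obsLaw a S) :=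
  (memLp_mul_eval_obsLaw a S q.1 q.2).const_mul _

lemma integral_bandProd (m : ℕ) (a : unitInterval) {S : Matrix (Fin p) (Fin p) ℝ}
    (hS : S.PosSemidef) (q : Fin p × Fin p) :
    ∫ y, bandProd m q y ∂(obsLaw a S) = band m q.1 q.2 * ((a : ℝ) ^ 2 * S q.1 q.2) := by
  unfold bandProd
  rw [integral_const_mul]
  by_cases h : q.1 = q.2
  · simp [band, h]
  · rw [integral_mul_obsLaw a hS h]

lemma covariance_bandProd (m : ℕ) (a : unitInterval) {S : Matrix (Fin p) (Fin p) ℝ}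
    (hS : S.PosSemidef) (q r : Fin p × Fin p) :
    ∫ y, (bandProd m q y - ∫ y, bandProd m q y ∂(obsLaw a S)) *
      (bandProd m r y - ∫ y, bandProd m r y ∂(obsLaw a S)) ∂(obsLaw a S) =
    band m q.1 q.2 * band m r.1 r.2 *
      ((a : ℝ) ^ ({q.1, q.2, r.1, r.2} : Finset (Fin p)).card *
        (S q.1 q.2 * S r.1 r.2 + S q.1 r.1 * S q.2 r.2 + S q.1 r.2 * S q.2 r.1) -
        (a : ℝ) ^ 4 * (S q.1 q.2 * S r.1 r.2)) := by
  have h := covariance_eq_sub (memLp_bandProd m a S q) (memLp_bandProd m a S r)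
  rw [covariance] at h
  rw [h, integral_bandProd m a hS, integral_bandProd m a hS]
  have e : ∀ y, (bandProd m q * bandProd m r) y =
      band m q.1 q.2 * band m r.1 r.2 * (y q.1 * y q.2 * (y r.1 * y r.2)) := by
    intro y; simp only [Pi.mul_apply, bandProd]; ring
  simp_rw [e]
  rw [integral_const_mul, integral_mul_four_obsLaw a hS]
  ring

/-- The covariance of the products `y_i y_j` and `y_k y_l`, where `z`, `x` and `y` are the three
pairings of Isserlis' formula. Without a common index, the pairing `z` cancels against the product
of the means. -/
lemma sq_covariance_entry_le {a : ℝ} (ha0 : 0 ≤ a) (ha1 : a ≤ 1) {i j k l : Fin p} (hij : i ≠ j)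
    (hkl : k ≠ l) (x y z : ℝ) :
    (a ^ ({i, j, k, l} : Finset (Fin p)).card * (z + x + y) - a ^ 4 * z) ^ 2 ≤
      3 * a ^ 4 * (x ^ 2 + y ^ 2 + ((if i = k then 1 else 0) + (if i = l then 1 else 0) +
        (if j = k then 1 else 0) + (if j = l then 1 else 0)) * z ^ 2) := by
  have hN4 : ({i, j, k, l} : Finset (Fin p)).card ≤ 4 := Finset.card_le_four
  have hN2 : 2 ≤ ({i, j, k, l} : Finset (Fin p)).card := by
    rw [← Finset.card_pair hij]
    exact Finset.card_le_card (by intro m; simp; tauto)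
  set N := ({i, j, k, l} : Finset (Fin p)).card with hN
  have h2 : a ^ N ≤ a ^ 2 := pow_le_pow_of_le_one ha0 ha1 hN2
  have h4 : a ^ 4 ≤ a ^ N := pow_le_pow_of_le_one ha0 ha1 hN4
  have h40 : 0 ≤ a ^ 4 := by positivity
  have hsq : ∀ u : ℝ, 0 ≤ u → u ≤ a ^ 2 → u ^ 2 ≤ a ^ 4 := fun u h0 h => by
    calc u ^ 2 ≤ (a ^ 2) ^ 2 := pow_le_pow_left₀ h0 h 2
      _ = a ^ 4 := by ring
  have hA := hsq (a ^ N) (by linarith) h2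
  have hB := hsq (a ^ N - a ^ 4) (by linarith) (by linarith)
  by_cases hov : i = k ∨ i = l ∨ j = k ∨ j = l
  · have hone : (1 : ℝ) ≤ (if i = k then 1 else 0) + (if i = l then 1 else 0) +
        (if j = k then 1 else 0) + (if j = l then 1 else 0) := by
      rcases hov with h | h | h | h <;> rw [if_pos h] <;> split_ifs <;> norm_num
    set o : ℝ := (if i = k then 1 else 0) + (if i = l then 1 else 0) +
        (if j = k then 1 else 0) + (if j = l then 1 else 0)
    have e : a ^ N * (z + x + y) - a ^ 4 * z = a ^ N * x + a ^ N * y + (a ^ N - a ^ 4) * z := by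
      ring
    rw [e]
    have h3 : ∀ u v w : ℝ, (u + v + w) ^ 2 ≤ 3 * (u ^ 2 + v ^ 2 + w ^ 2) := fun u v w => by
      nlinarith [sq_nonneg (u - v), sq_nonneg (u - w), sq_nonneg (v - w)]
    calc _ ≤ 3 * ((a ^ N * x) ^ 2 + (a ^ N * y) ^ 2 + ((a ^ N - a ^ 4) * z) ^ 2) := h3 _ _ _
      _ = 3 * ((a ^ N) ^ 2 * x ^ 2 + (a ^ N) ^ 2 * y ^ 2 + (a ^ N - a ^ 4) ^ 2 * z ^ 2) := by
          ring
      _ ≤ 3 * (a ^ 4 * x ^ 2 + a ^ 4 * y ^ 2 + a ^ 4 * (o * z ^ 2)) := by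
          gcongr
          nlinarith [sq_nonneg z]
      _ = _ := by ring
  · push Not at hov
    obtain ⟨h1, h2', h3, h4'⟩ := hov
    have hNe : N = 4 := by
      rw [hN, Finset.card_insert_of_notMem (by simp [hij, h1, h2']),
        Finset.card_insert_of_notMem (by simp [h3, h4']), Finset.card_pair hkl]
    rw [hNe] at hA ⊢
    simp only [h1, h2', h3, h4', if_false]
    have e : a ^ 4 * (z + x + y) - a ^ 4 * z = a ^ 4 * (x + y) := by ring
    rw [e, mul_pow]
    calc (a ^ 4) ^ 2 * (x + y) ^ 2 ≤ a ^ 4 * (3 * (x ^ 2 + y ^ 2)) := by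
          gcongr
          nlinarith [sq_nonneg (x - y), sq_nonneg x, sq_nonneg y]
      _ = _ := by ring

lemma sum_band_le (m : ℕ) (i : Fin p) : ∑ l, band m i l ≤ 2 * m + 1 := by
  refine le_trans (Finset.sum_le_sum fun l _ => ?_) (card_gap_le i (Nat.cast_nonneg m))
  rw [gap_comm]; exact band_le_gap m i l

lemma sum_band_le' (m : ℕ) (i : Fin p) : ∑ l, band m l i ≤ 2 * m + 1 :=
  le_trans (Finset.sum_le_sum fun l _ => band_le_gap m l i) (card_gap_le i (Nat.cast_nonneg m))

/-- The contribution of the pairs of positions on the band with a common index. -/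
lemma sum_overlap_le {α : ℝ} (hα : 1 / 2 ≤ α) {S : Matrix (Fin p) (Fin p) ℝ}
    (hS : S ∈ ellipsoid p α) {m : ℕ} (hm : 1 ≤ m) :
    ∑ i, ∑ j, ∑ k, ∑ l, band m i j * band m k l *
      (((if i = k then 1 else 0) + (if i = l then 1 else 0) +
        (if j = k then 1 else 0) + (if j = l then 1 else 0)) * (S i j * S k l) ^ 2) ≤
      12 * (m : ℝ) * (p : ℝ) := by
  have hone := sq_apply_le_one hS.1.posSemidef hS.2.1
  have hm' : (1 : ℝ) ≤ m := by exact_mod_cast hm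
  have h1 : ∀ i j : Fin p, ∑ k, ∑ l, band m i j * band m k l *
      (((if i = k then 1 else 0) + (if i = l then 1 else 0) +
        (if j = k then 1 else 0) + (if j = l then 1 else 0)) * (S i j * S k l) ^ 2) ≤
      12 * (m : ℝ) * (if i < j then S i j ^ 2 * gap i j else 0) := by
    intro i j
    have h2 : ∑ k, ∑ l, band m k l * ((if i = k then 1 else 0) + (if i = l then 1 else 0) +
        (if j = k then 1 else 0) + (if j = l then 1 else 0)) ≤ 12 * (m : ℝ) := by
      simp only [mul_add, Finset.sum_add_distrib, mul_ite, mul_one, mul_zero]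
      have e1 : ∀ i : Fin p, ∑ k, ∑ l, (if i = k then band m k l else 0) = ∑ l, band m i l := by
        intro i
        rw [Finset.sum_comm]; simp
      have e2 : ∀ i : Fin p, ∑ k, ∑ l, (if i = l then band m k l else 0) = ∑ k, band m k i := by
        intro i; simp
      rw [e1, e1, e2, e2]
      have := sum_band_le m i
      have := sum_band_le m j
      have := sum_band_le' m i
      have := sum_band_le' m j
      linarith
    calc _ ≤ ∑ k, ∑ l, band m i j * S i j ^ 2 * (band m k l *
          ((if i = k then 1 else 0) + (if i = l then 1 else 0) +
          (if j = k then 1 else 0) + (if j = l then 1 else 0))) := by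
          refine Finset.sum_le_sum fun k _ => Finset.sum_le_sum fun l _ => ?_
          have ho : (0 : ℝ) ≤ (if i = k then 1 else 0) + (if i = l then 1 else 0) +
            (if j = k then 1 else 0) + (if j = l then 1 else 0) := by
            split_ifs <;> norm_num
          set o : ℝ := (if i = k then 1 else 0) + (if i = l then 1 else 0) +
            (if j = k then 1 else 0) + (if j = l then 1 else 0)
          have hb := mul_nonneg (mul_nonneg (mul_nonneg (band_nonneg m i j) (band_nonneg m k l)) ho)
            (sq_nonneg (S i j))
          have := mul_le_mul_of_nonneg_left (hone k l) hb
          rw [mul_pow]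
          linarith
      _ = band m i j * S i j ^ 2 * ∑ k, ∑ l, band m k l *
          ((if i = k then 1 else 0) + (if i = l then 1 else 0) +
          (if j = k then 1 else 0) + (if j = l then 1 else 0)) := by
          simp_rw [Finset.mul_sum]
      _ ≤ band m i j * S i j ^ 2 * (12 * m) :=
          mul_le_mul_of_nonneg_left h2 (mul_nonneg (band_nonneg m i j) (sq_nonneg _))
      _ ≤ (if i < j then S i j ^ 2 * gap i j else 0) * (12 * m) := by
          refine mul_le_mul_of_nonneg_right ?_ (by positivity)
          have hb := band_le_lt m i j
          split_ifs with h
          · rw [if_pos h] at hb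
            rw [mul_comm]
            exact mul_le_mul_of_nonneg_left (hb.trans (one_le_gap h)) (sq_nonneg _)
          · rw [if_neg h] at hb
            exact mul_nonpos_of_nonpos_of_nonneg hb (sq_nonneg _)
      _ = _ := by ring
  calc _ ≤ ∑ i, ∑ j, 12 * (m : ℝ) * (if i < j then S i j ^ 2 * gap i j else 0) :=
        Finset.sum_le_sum fun i _ => Finset.sum_le_sum fun j _ => h1 i j
    _ = 12 * (m : ℝ) * ∑ i, ∑ j, (if i < j then S i j ^ 2 * gap i j else 0) := by
        simp_rw [Finset.mul_sum]
    _ ≤ _ := mul_le_mul_of_nonneg_left (sum_sq_mul_gap_le hα hS) (by positivity)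

lemma sum_four_le {f : Fin p → Fin p → Fin p → Fin p → ℝ}
    (A O : Fin p → Fin p → Fin p → Fin p → ℝ) (c : ℝ)
    (h : ∀ i j k l, f i j k l ≤ c * (A i j k l + A i j l k + O i j k l)) :
    ∑ i, ∑ j, ∑ k, ∑ l, f i j k l ≤ c * (∑ i, ∑ j, ∑ k, ∑ l, A i j k l +
      ∑ i, ∑ j, ∑ k, ∑ l, A i j k l + ∑ i, ∑ j, ∑ k, ∑ l, O i j k l) := by
  refine (Finset.sum_le_sum fun i _ => Finset.sum_le_sum fun j _ => Finset.sum_le_sum fun k _ =>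
    Finset.sum_le_sum fun l _ => h i j k l).trans (le_of_eq ?_)
  simp_rw [← Finset.mul_sum, Finset.sum_add_distrib]
  congr 3
  exact Finset.sum_congr rfl fun i _ => Finset.sum_congr rfl fun j _ => Finset.sum_comm

/-- The squared Frobenius norm of the covariance matrix of the products on the band is of the same
order `a⁴ m p` over the whole ellipsoid as under the null hypothesis. -/
lemma sum_sq_covariance_bandProd_le {α : ℝ} (hα : 1 / 2 ≤ α) {S : Matrix (Fin p) (Fin p) ℝ}
    (hS : S ∈ ellipsoid p α) {m : ℕ} (hm : 1 ≤ m) (a : unitInterval) :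
    ∑ q, ∑ r, (∫ y, (bandProd m q y - ∫ y, bandProd m q y ∂(obsLaw a S)) *
      (bandProd m r y - ∫ y, bandProd m r y ∂(obsLaw a S)) ∂(obsLaw a S)) ^ 2 ≤
      288 * (a : ℝ) ^ 4 * m * p := by
  have hpsd := hS.1.posSemidef
  simp_rw [covariance_bandProd m a hpsd, Fintype.sum_prod_type]
  have ha0 : (0 : ℝ) ≤ a := a.2.1
  have ha1 : (a : ℝ) ≤ 1 := a.2.2
  have hle : ∀ i j k l : Fin p, (band m i j * band m k l *
      ((a : ℝ) ^ ({i, j, k, l} : Finset (Fin p)).card *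
        (S i j * S k l + S i k * S j l + S i l * S j k) - (a : ℝ) ^ 4 * (S i j * S k l))) ^ 2 ≤
      3 * (a : ℝ) ^ 4 * ((if gap i j ≤ m then (1 : ℝ) else 0) * (if gap k l ≤ m then 1 else 0) *
        (S i k ^ 2 * S j l ^ 2) + (if gap i j ≤ m then (1 : ℝ) else 0) *
        (if gap l k ≤ m then 1 else 0) * (S i l ^ 2 * S j k ^ 2) + band m i j * band m k l *
      (((if i = k then 1 else 0) + (if i = l then 1 else 0) +
        (if j = k then 1 else 0) + (if j = l then 1 else 0)) * (S i j * S k l) ^ 2)) := by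
    intro i j k l
    have hb0 := mul_nonneg (band_nonneg m i j) (band_nonneg m k l)
    have hbsq : (band m i j * band m k l) ^ 2 = band m i j * band m k l := by
      rw [mul_pow, pow_two, pow_two, band_sq, band_sq]
    have hbg : band m i j * band m k l ≤
        (if gap i j ≤ m then (1 : ℝ) else 0) * (if gap k l ≤ m then 1 else 0) :=
      mul_le_mul (band_le_gap m i j) (band_le_gap m k l) (band_nonneg m k l)
        (by split_ifs <;> simp)
    rw [gap_comm l k, mul_pow, hbsq]
    by_cases h : i ≠ j ∧ k ≠ l
    · have h1 := sq_covariance_entry_le ha0 ha1 h.1 h.2 (S i k * S j l) (S i l * S j k)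
        (S i j * S k l)
      refine (mul_le_mul_of_nonneg_left h1 hb0).trans ?_
      have h2 := mul_le_mul_of_nonneg_right hbg (sq_nonneg (S i k * S j l))
      have h3 := mul_le_mul_of_nonneg_right hbg (sq_nonneg (S i l * S j k))
      rw [← mul_pow, ← mul_pow]
      rw [← mul_assoc, mul_comm (band m i j * band m k l) (3 * (a : ℝ) ^ 4), mul_assoc]
      refine mul_le_mul_of_nonneg_left ?_ (by positivity)
      rw [mul_add, mul_add]
      linarith
    · have : band m i j * band m k l = 0 := by
        by_contra hne
        refine h ⟨?_, ?_⟩ <;> rintro rfl <;> simp [band] at hne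
      rw [this, zero_mul, zero_mul, add_zero]
      have e : ∀ P : Prop, ∀ [Decidable P], (0 : ℝ) ≤ if P then 1 else 0 := fun P _ => by
        split_ifs <;> simp
      exact mul_nonneg (by positivity) (add_nonneg
        (mul_nonneg (mul_nonneg (e _) (e _)) (by positivity))
        (mul_nonneg (mul_nonneg (e _) (e _)) (by positivity)))
  have hA := sum_band_mul_sq_mul_sq_le hα hS hm
  have hO := sum_overlap_le hα hS hm
  refine (sum_four_le (fun i j k l => (if gap i j ≤ m then (1 : ℝ) else 0) *
    (if gap k l ≤ m then 1 else 0) * (S i k ^ 2 * S j l ^ 2)) _ _ hle).trans ?_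
  calc _ ≤ 3 * (a : ℝ) ^ 4 * (42 * (m : ℝ) * (p : ℝ) + 42 * (m : ℝ) * (p : ℝ) +
          12 * (m : ℝ) * (p : ℝ)) :=
        mul_le_mul_of_nonneg_left (add_le_add (add_le_add hA hA) hO) (by positivity)
    _ = _ := by ring

end BandCovariance

/-! ### Error probabilities of the U-statistic test -/

section UpperBound

variable {n p : ℕ}

/-- The unnormalized statistic of the test `Δ_m(t)`. -/
def rawStat (m : ℕ) (y : Sample n p) : ℝ :=
  ∑ q ∈ (Finset.univ : Finset (Fin n)).offDiag,
    ∑ b : Fin p × Fin p, bandProd m b (y q.1) * bandProd m b (y q.2)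

/-- The energy of `S` on the band, which determines the mean of the test statistic. -/
def bandEnergy (m : ℕ) (S : Matrix (Fin p) (Fin p) ℝ) : ℝ := ∑ i, ∑ j, band m i j * S i j ^ 2

lemma uStat_eq (m : ℕ) (y : Sample n p) :
    uStat m y = 1 / ((n : ℝ) * ((n : ℝ) - 1) * (p : ℝ)) * (1 / √(2 * (m : ℝ))) * rawStat m y := by
  unfold uStat rawStat
  congr 1
  have hoff : (Finset.univ : Finset (Fin n)).offDiag =
      (Finset.univ ×ˢ Finset.univ).filter fun q : Fin n × Fin n => q.1 ≠ q.2 := by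
    ext q; simp
  rw [hoff, Finset.sum_filter, Finset.sum_product]
  refine Finset.sum_congr rfl fun k _ => ?_
  rw [Finset.sum_filter]
  refine Finset.sum_congr rfl fun l _ => ?_
  refine if_congr Iff.rfl ?_ rfl
  rw [Fintype.sum_prod_type]
  refine Finset.sum_congr rfl fun i _ => ?_
  have hI : (Finset.Ioi i).filter (fun j : Fin p => (j : ℕ) - (i : ℕ) < m) =
      Finset.univ.filter fun j => i < j ∧ (j : ℕ) - (i : ℕ) < m := by
    ext j; simp
  rw [hI, Finset.sum_filter]
  refine Finset.sum_congr rfl fun j _ => ?_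
  unfold bandProd band
  split_ifs <;> simp [mul_assoc]

/-- Chebyshev's inequality for the unnormalized statistic, uniformly over the ellipsoid. -/
lemma sampleLaw_deviation_le {α : ℝ} (hα : 1 / 2 ≤ α) {S : Matrix (Fin p) (Fin p) ℝ}
    (hS : S ∈ ellipsoid p α) {m : ℕ} (hm : 1 ≤ m) (a : unitInterval) {δ : ℝ} (hδ : 0 < δ) :
    sampleLaw n a S {y | δ ≤ |rawStat m y - n * (n - 1) * ((a : ℝ) ^ 4 * bandEnergy m S)|} ≤
      ENNReal.ofReal ((8 * n * (n - 1) ^ 2 * ((a : ℝ) ^ 4 * bandEnergy m S) *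
        (17 * (a : ℝ) ^ 2 * √(m * p)) + 4 * (n * (n - 1)) *
        (17 * (a : ℝ) ^ 2 * √(m * p)) ^ 2) / δ ^ 2) := by
  have hmp : (0 : ℝ) ≤ m * p := by positivity
  have hC := sum_sq_covariance_bandProd_le hα hS hm a
  obtain ⟨hint, hle⟩ := integral_uStat_sub_mean_sq_le (μ := obsLaw a S) n
    (F := fun q : Fin p × Fin p => bandProd m q) (memLp_bandProd m a S)
    (Γ := 17 * (a : ℝ) ^ 2 * √(m * p)) (by positivity) (hC.trans (by
      rw [mul_pow, mul_pow, Real.sq_sqrt hmp, ← pow_mul]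
      have : (0 : ℝ) ≤ (a : ℝ) ^ 4 * (m * p) := by positivity
      norm_num
      linarith))
  have hmean : ∑ b : Fin p × Fin p, (∫ y, bandProd m b y ∂(obsLaw a S)) ^ 2 =
      (a : ℝ) ^ 4 * bandEnergy m S := by
    simp_rw [integral_bandProd m a hS.1.posSemidef]
    rw [bandEnergy, Fintype.sum_prod_type, Finset.mul_sum]
    refine Finset.sum_congr rfl fun i _ => ?_
    rw [Finset.mul_sum]
    refine Finset.sum_congr rfl fun j _ => ?_
    rw [mul_pow, pow_two (band m i j), band_sq]; ring
  rw [hmean] at hint hle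
  have hmk := mul_meas_ge_le_integral_of_nonneg (μ := Measure.pi fun _ : Fin n => obsLaw a S)
    (ae_of_all _ fun ω => sq_nonneg _) hint (δ ^ 2)
  have hset : {y : Sample n p |
      δ ≤ |rawStat m y - n * (n - 1) * ((a : ℝ) ^ 4 * bandEnergy m S)|} =
      {y : Sample n p | δ ^ 2 ≤
        (rawStat m y - n * (n - 1) * ((a : ℝ) ^ 4 * bandEnergy m S)) ^ 2} := by
    ext y
    show δ ≤ |_| ↔ δ ^ 2 ≤ _
    rw [← sq_abs (rawStat m y - _)]
    exact (pow_le_pow_iff_left₀ hδ.le (abs_nonneg _) two_ne_zero).symm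
  rw [hset]
  refine ENNReal.le_ofReal_iff_toReal_le (measure_ne_top _ _) ?_ |>.2 ?_
  · refine div_nonneg (le_trans ?_ hle) (sq_nonneg _)
    exact integral_nonneg fun _ => sq_nonneg _
  · rw [le_div_iff₀ (by positivity), mul_comm]
    exact le_trans hmk hle

lemma typeIError_uTest_le {m : ℕ} (hn : 2 ≤ n) (hp : 1 ≤ p) (hm : 1 ≤ m) (a : unitInterval)
    (ha : 0 < (a : ℝ)) {t : ℝ} (ht : 0 < t) :
    typeIError a (uTest m t : Sample n p → Bool) ≤
      ENNReal.ofReal (1156 / (n * √p * t / (a : ℝ) ^ 2) ^ 2) := by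
  have hn' : (2 : ℝ) ≤ n := by exact_mod_cast hn
  have hp' : (0 : ℝ) < p := by exact_mod_cast hp
  have hm' : (0 : ℝ) < m := by exact_mod_cast hm
  have hI : (1 : Matrix (Fin p) (Fin p) ℝ) ∈ ellipsoid p 1 := by
    refine ⟨Matrix.PosDef.one, fun i => by simp, ?_⟩
    have : ∑ i : Fin p, ∑ j ∈ Finset.Ioi i, (1 : Matrix (Fin p) (Fin p) ℝ) i j ^ 2 *
        |((i : ℕ) : ℝ) - ((j : ℕ) : ℝ)| ^ (2 * (1 : ℝ)) = 0 :=
      Finset.sum_eq_zero fun i _ => Finset.sum_eq_zero fun j hj => by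
        simp [(Finset.mem_Ioi.1 hj).ne]
    rw [this]; norm_num
  have hE : bandEnergy m (1 : Matrix (Fin p) (Fin p) ℝ) = 0 :=
    Finset.sum_eq_zero fun i _ => Finset.sum_eq_zero fun j _ => by
      by_cases h : i = j <;> simp [band, Matrix.one_apply, h]
  have hc : 0 < (n : ℝ) * ((n : ℝ) - 1) * p * √(2 * m) := by
    have : (0 : ℝ) < n - 1 := by linarith
    positivity
  have hdev := sampleLaw_deviation_le (n := n) (by norm_num) hI hm a (mul_pos hc ht)
  rw [hE] at hdev
  unfold typeIError
  refine (measure_mono ?_).trans (hdev.trans (ENNReal.ofReal_le_ofReal ?_))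
  · intro y hy
    have h1 : t < uStat m y := by simpa [uTest] using hy
    rw [uStat_eq] at h1
    change (_ : ℝ) ≤ |(_ : ℝ)|
    refine le_trans ?_ (le_abs_self _)
    have e : 1 / ((n : ℝ) * ((n : ℝ) - 1) * (p : ℝ)) * (1 / √(2 * (m : ℝ))) * rawStat m y =
      rawStat m y / ((n : ℝ) * ((n : ℝ) - 1) * p * √(2 * m)) := by field_simp
    rw [e, lt_div_iff₀ hc] at h1
    linarith
  · have hs : √(p : ℝ) ^ 2 = p := Real.sq_sqrt hp'.le
    rw [mul_zero, mul_zero, zero_mul, zero_add, mul_pow, mul_pow, mul_pow _ t, mul_pow _ (√(2 * _)),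
      Real.sq_sqrt (by positivity), Real.sq_sqrt (by positivity), div_pow, mul_pow _ t,
      mul_pow _ (√_), hs]
    have hn1 : (0 : ℝ) < n - 1 := by linarith
    have h2 : 1156 / ((n : ℝ) ^ 2 * p * t ^ 2 / ((a : ℝ) ^ 2) ^ 2) -
        4 * (n * (n - 1)) * (17 ^ 2 * ((a : ℝ) ^ 2) ^ 2 * (m * p)) /
        ((n * (n - 1) * p) ^ 2 * (2 * m) * t ^ 2) =
        1156 * (a : ℝ) ^ 4 / (n ^ 2 * p * t ^ 2) * (1 - n / (2 * (n - 1))) := by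
      field_simp
      ring
    have h3 : 0 ≤ 1 - n / (2 * ((n : ℝ) - 1)) := by
      rw [sub_nonneg, div_le_one (by positivity)]; linarith
    have : 0 ≤ 1156 * (a : ℝ) ^ 4 / (n ^ 2 * p * t ^ 2) * (1 - n / (2 * ((n : ℝ) - 1))) :=
      mul_nonneg (by positivity) h3
    linarith

/-- Truncating the alternative to a band of width `m` costs at most a fraction `D⁻²` of its energy
if `D ≤ m ^ α φ`. -/
lemma le_bandEnergy {α φ D : ℝ} (hα : 1 / 2 ≤ α) (hD : 1 < D) {m : ℕ}
    (hm : 1 ≤ m) (hp : 1 ≤ p) (hmφ : D ≤ (m : ℝ) ^ α * φ) {S : Matrix (Fin p) (Fin p) ℝ}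
    (hS : S ∈ alternative p α φ) : p * (φ ^ 2 * (1 - (D ^ 2)⁻¹)) ≤ bandEnergy m S := by
  obtain ⟨⟨-, -, h1⟩, h2⟩ := hS
  have hp' : (0 : ℝ) < p := by exact_mod_cast hp
  have hm' : (0 : ℝ) < m := by exact_mod_cast hm
  rw [one_div, inv_mul_le_iff₀ hp', mul_one] at h1
  rw [one_div, le_inv_mul_iff₀ hp'] at h2
  set M : ℝ := (m : ℝ) ^ (2 * α) with hM
  have hMpos : 0 < M := by positivity
  have hM2 : D ^ 2 ≤ M * φ ^ 2 := by
    have : M = ((m : ℝ) ^ α) ^ 2 := by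
      rw [hM, mul_comm, Real.rpow_mul hm'.le]; norm_cast
    rw [this, ← mul_pow]
    exact pow_le_pow_left₀ (by linarith) hmφ 2
  have hterm : ∀ i : Fin p, ∀ j ∈ Finset.Ioi i, S i j ^ 2 ≤ band m i j * S i j ^ 2 +
      M⁻¹ * (S i j ^ 2 * |((i : ℕ) : ℝ) - ((j : ℕ) : ℝ)| ^ (2 * α)) := by
    intro i j hj
    have hij := Finset.mem_Ioi.1 hj
    by_cases hb : (j : ℕ) - (i : ℕ) < m
    · have : band m i j = 1 := by simp [band, hij, hb]
      rw [this, one_mul, le_add_iff_nonneg_right]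
      positivity
    · have : band m i j = 0 := by simp [band, hb]
      rw [this, zero_mul, zero_add, ← mul_assoc, mul_comm M⁻¹, mul_assoc]
      refine le_mul_of_one_le_right (sq_nonneg _) ?_
      rw [le_inv_mul_iff₀ hMpos, mul_one, hM]
      refine Real.rpow_le_rpow hm'.le ?_ (by linarith)
      rw [abs_sub_comm]
      refine le_trans ?_ (le_abs_self _)
      have h5 : (i : ℕ) < j := hij
      have h6 : (i : ℕ) + m ≤ j := by omega
      have h6' : ((i : ℕ) : ℝ) + m ≤ (j : ℕ) := by exact_mod_cast h6
      linarith
  have hsum : ∑ i, ∑ j ∈ Finset.Ioi i, S i j ^ 2 ≤ bandEnergy m S + M⁻¹ * p := by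
    calc ∑ i, ∑ j ∈ Finset.Ioi i, S i j ^ 2
        ≤ ∑ i, ∑ j ∈ Finset.Ioi i, (band m i j * S i j ^ 2 +
          M⁻¹ * (S i j ^ 2 * |((i : ℕ) : ℝ) - ((j : ℕ) : ℝ)| ^ (2 * α))) :=
          Finset.sum_le_sum fun i _ => Finset.sum_le_sum fun j hj => hterm i j hj
      _ = ∑ i, ∑ j ∈ Finset.Ioi i, band m i j * S i j ^ 2 + M⁻¹ * ∑ i, ∑ j ∈ Finset.Ioi i,
          S i j ^ 2 * |((i : ℕ) : ℝ) - ((j : ℕ) : ℝ)| ^ (2 * α) := by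
          simp_rw [Finset.sum_add_distrib, Finset.mul_sum]
      _ ≤ bandEnergy m S + M⁻¹ * p := by
          gcongr
          unfold bandEnergy
          refine Finset.sum_le_sum fun i _ => ?_
          exact Finset.sum_le_sum_of_subset_of_nonneg (Finset.subset_univ _)
            fun j _ _ => mul_nonneg (band_nonneg m i j) (sq_nonneg _)
  have hMinv : M⁻¹ ≤ φ ^ 2 * (D ^ 2)⁻¹ := by
    rw [← div_eq_mul_inv, le_div_iff₀ (by positivity), inv_mul_le_iff₀ hMpos]
    exact hM2
  nlinarith [mul_le_mul_of_nonneg_right hMinv hp'.le]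

lemma typeIIError_uTest_le {α φ D K c t : ℝ} (hα : 1 / 2 < α) (hφ : 0 < φ) (hD : 1 < D)
    (hK : 0 < K) (hc0 : 0 ≤ c) (hc : c < K * (1 - (D ^ 2)⁻¹) / √2) {m : ℕ} (hn : 2 ≤ n)
    (hp : 1 ≤ p) (hm : 1 ≤ m) (a : unitInterval) (ha : 0 < (a : ℝ))
    (hmφ : D ≤ (m : ℝ) ^ α * φ) (hmK : (m : ℝ) ^ α * φ ≤ K ^ (-(2 * α)))
    (ht : t ≤ c * (a : ℝ) ^ 4 * φ ^ (2 + 1 / (2 * α))) :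
    typeIIError a (uTest m t : Sample n p → Bool) (alternative p α φ) ≤
      ENNReal.ofReal ((8 * (17 / (K * (1 - (D ^ 2)⁻¹)) / signal α n p a φ) +
        8 * (17 / (K * (1 - (D ^ 2)⁻¹)) / signal α n p a φ) ^ 2) /
        (1 - √2 * c / (K * (1 - (D ^ 2)⁻¹))) ^ 2) := by
  have hn' : (2 : ℝ) ≤ n := by exact_mod_cast hn
  have hn1 : (0 : ℝ) < n - 1 := by linarith
  have hn0 : (0 : ℝ) < n := by linarith
  have hp' : (0 : ℝ) < p := by exact_mod_cast hp
  have hm' : (0 : ℝ) < m := by exact_mod_cast hm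
  set d : ℝ := 1 - (D ^ 2)⁻¹ with hd
  have hd0 : 0 < d := by
    rw [hd, sub_pos]; exact inv_lt_one_of_one_lt₀ (one_lt_pow₀ hD two_ne_zero)
  set ε : ℝ := 1 - √2 * c / (K * d) with hε
  have hs2 : 0 < √(2 : ℝ) := by positivity
  have hε0 : 0 < ε := by
    rw [hε, sub_pos, div_lt_one (by positivity)]
    rw [lt_div_iff₀ hs2] at hc; linarith
  set ψ : ℝ := φ ^ (1 / (2 * α)) with hψ
  have hψ0 : 0 < ψ := by positivity
  have hsplit : φ ^ (2 + 1 / (2 * α)) = φ ^ 2 * ψ := by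
    rw [Real.rpow_add hφ]; norm_cast
  -- the bandwidth condition bounds `√m` by `K⁻¹ φ^{-1/(2α)}`
  have hsqm : √(m : ℝ) * (K * ψ) ≤ 1 := by
    have h1 : ((m : ℝ) ^ α * φ) ^ (1 / (2 * α)) ≤ (K ^ (-(2 * α))) ^ (1 / (2 * α)) :=
      Real.rpow_le_rpow (by positivity) hmK (by positivity)
    rw [Real.mul_rpow (by positivity) hφ.le, ← Real.rpow_mul hm'.le, ← Real.rpow_mul hK.le] at h1
    have e1 : α * (1 / (2 * α)) = 1 / 2 := by field_simp
    have e2 : -(2 * α) * (1 / (2 * α)) = -1 := by field_simp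
    rw [e1, e2, ← Real.sqrt_eq_rpow, Real.rpow_neg_one] at h1
    calc √(m : ℝ) * (K * ψ) = √(m : ℝ) * ψ * K := by ring
      _ ≤ K⁻¹ * K := mul_le_mul_of_nonneg_right h1 hK.le
      _ = 1 := inv_mul_cancel₀ hK.ne'
  unfold typeIIError
  refine iSup₂_le fun S hS => ?_
  set q : ℝ := (a : ℝ) ^ 4 * bandEnergy m S with hq
  have hE := le_bandEnergy hα.le hD hm hp hmφ hS
  have hqle : (a : ℝ) ^ 4 * (p * (φ ^ 2 * d)) ≤ q :=
    mul_le_mul_of_nonneg_left hE (by positivity)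
  have hq0 : 0 < q := lt_of_lt_of_le (by positivity) hqle
  have hδ : 0 < ε * (n * (n - 1) * q) := by positivity
  refine (measure_mono ?_).trans ((sampleLaw_deviation_le hα.le hS.1 hm a hδ).trans
    (ENNReal.ofReal_le_ofReal ?_))
  · intro y hy
    have h1 : uStat m y ≤ t := by simpa [uTest] using hy
    rw [uStat_eq] at h1
    change (_ : ℝ) ≤ |(_ : ℝ)|
    refine le_trans ?_ (neg_le_abs _)
    have hcc : 0 < (n : ℝ) * ((n : ℝ) - 1) * p * √(2 * m) := by positivity
    have e : 1 / ((n : ℝ) * ((n : ℝ) - 1) * (p : ℝ)) * (1 / √(2 * (m : ℝ))) * rawStat m y =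
      rawStat m y / ((n : ℝ) * ((n : ℝ) - 1) * p * √(2 * m)) := by field_simp
    rw [e, div_le_iff₀ hcc] at h1
    have h2 : p * √(2 * m) * t ≤ (1 - ε) * q := by
      calc p * √(2 * m) * t ≤ p * √(2 * m) * (c * (a : ℝ) ^ 4 * (φ ^ 2 * ψ)) := by
            rw [hsplit] at ht; gcongr
        _ = (√2 * c / K * (a : ℝ) ^ 4 * p * φ ^ 2) * (√(m : ℝ) * (K * ψ)) := by
            rw [Real.sqrt_mul (by norm_num)]; field_simp
        _ ≤ (√2 * c / K * (a : ℝ) ^ 4 * p * φ ^ 2) * 1 :=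
            mul_le_mul_of_nonneg_left hsqm (by positivity)
        _ = (1 - ε) * ((a : ℝ) ^ 4 * (p * (φ ^ 2 * d))) := by
            rw [hε]; field_simp; ring
        _ ≤ (1 - ε) * q := by
            refine mul_le_mul_of_nonneg_left hqle ?_
            rw [hε, sub_sub_cancel]; positivity
    have h3 : n * (n - 1) * (p * √(2 * m) * t) ≤ n * (n - 1) * ((1 - ε) * q) :=
      mul_le_mul_of_nonneg_left h2 (by positivity)
    rw [← hq]
    nlinarith
  · rw [← hq]
    set Γ : ℝ := 17 * (a : ℝ) ^ 2 * √(m * p) with hΓ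
    set r : ℝ := Γ / (n * q) with hr
    have hr0 : 0 ≤ r := by positivity
    have hsig : signal α n p a φ = (a : ℝ) ^ 2 * n * √p * (φ ^ 2 * ψ) := by
      rw [signal, hsplit]
    have hsp : √(p : ℝ) * √p = p := Real.mul_self_sqrt hp'.le
    have hrle : r ≤ 17 / (K * d) / signal α n p a φ := by
      rw [hr, hsig, div_le_iff₀ (by positivity)]
      calc Γ = 17 * (a : ℝ) ^ 2 * √p * (√(m : ℝ) * (K * ψ)) / (K * ψ) := by
            rw [hΓ, Real.sqrt_mul hm'.le]; field_simp
        _ ≤ 17 * (a : ℝ) ^ 2 * √p * 1 / (K * ψ) := by gcongr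
        _ = 17 / (K * d) / ((a : ℝ) ^ 2 * n * √p * (φ ^ 2 * ψ)) *
            (n * ((a : ℝ) ^ 4 * (√p * √p * (φ ^ 2 * d)))) := by
            field_simp
        _ ≤ _ := by rw [hsp]; gcongr
    have hΓr : Γ = r * (n * q) := by rw [hr]; field_simp
    have e : (8 * n * (n - 1) ^ 2 * q * Γ + 4 * (n * (n - 1)) * Γ ^ 2) /
        (ε * (n * (n - 1) * q)) ^ 2 = (8 * r + 4 * (n / (n - 1)) * r ^ 2) / ε ^ 2 := by
      rw [hΓr]; field_simp
    rw [e]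
    have h5 : (n : ℝ) / (n - 1) ≤ 2 := by rw [div_le_iff₀ hn1]; linarith
    gcongr
    calc 4 * ((n : ℝ) / (n - 1)) ≤ 4 * 2 := by gcongr
      _ = 8 := by norm_num

end UpperBound

/-! ### Consistency of the tuned test -/

section UpperBoundAsymptotics

variable {α : ℝ} {n p : ℕ → ℕ} {a : ℕ → unitInterval} {φ : ℕ → ℝ}

theorem tendsto_totalError_uTest (hα : 1 / 2 < α) (hn : Tendsto n atTop atTop)
    (hp : Tendsto p atTop atTop) (ha : ∀ ν, 0 < (a ν : ℝ)) (hφ : ∀ ν, 0 < φ ν)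
    (hsig : Tendsto (fun ν => signal α (n ν) (p ν) (a ν) (φ ν)) atTop atTop)
    {m : ℕ → ℕ} {t : ℕ → ℝ} (hT : IsTuned α n p a φ m t) :
    Tendsto (fun ν => totalError (n := n ν) (a ν) (uTest (m ν) (t ν))
      (alternative (p ν) α (φ ν))) atTop (𝓝 0) := by
  obtain ⟨hm, -, ⟨D, K, c, hD, hK, hDK, hc, htc⟩, hx⟩ := hT
  set c' := max c 0 with hc'
  have hd0 : 0 < 1 - (D ^ 2)⁻¹ := by
    rw [sub_pos]; exact inv_lt_one_of_one_lt₀ (one_lt_pow₀ hD two_ne_zero)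
  have hc'lt : c' < K * (1 - (D ^ 2)⁻¹) / √2 := max_lt hc (by positivity)
  have hI : Tendsto (fun ν => ENNReal.ofReal
      (1156 / (n ν * √(p ν : ℝ) * t ν / (a ν : ℝ) ^ 2) ^ 2)) atTop (𝓝 0) := by
    rw [← ENNReal.ofReal_zero]
    refine ENNReal.tendsto_ofReal ?_
    exact tendsto_const_nhds.div_atTop ((tendsto_pow_atTop two_ne_zero).comp hx)
  have hr : Tendsto (fun ν => 17 / (K * (1 - (D ^ 2)⁻¹)) / signal α (n ν) (p ν) (a ν) (φ ν))
      atTop (𝓝 0) := tendsto_const_nhds.div_atTop hsig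
  have hII : Tendsto (fun ν => ENNReal.ofReal
      ((8 * (17 / (K * (1 - (D ^ 2)⁻¹)) / signal α (n ν) (p ν) (a ν) (φ ν)) +
        8 * (17 / (K * (1 - (D ^ 2)⁻¹)) / signal α (n ν) (p ν) (a ν) (φ ν)) ^ 2) /
        (1 - √2 * c' / (K * (1 - (D ^ 2)⁻¹))) ^ 2)) atTop (𝓝 0) := by
    rw [← ENNReal.ofReal_zero]
    refine ENNReal.tendsto_ofReal ?_
    have := ((hr.const_mul 8).add ((hr.pow 2).const_mul 8)).div_const
      ((1 - √2 * c' / (K * (1 - (D ^ 2)⁻¹))) ^ 2)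
    simpa using this
  have hsum := hI.add hII
  rw [add_zero] at hsum
  refine tendsto_of_tendsto_of_tendsto_of_le_of_le' tendsto_const_nhds hsum
    (Eventually.of_forall fun _ => zero_le) ?_
  filter_upwards [hn.eventually_ge_atTop 2, hp.eventually_ge_atTop 1, hm.eventually_ge_atTop 1,
    hDK, htc, hx.eventually_gt_atTop 0] with ν hn2 hp1 hm1 hDKν htcν hxν
  have ht : 0 < t ν := by
    by_contra h
    push Not at h
    have : (n ν : ℝ) * √(p ν : ℝ) * t ν / (a ν : ℝ) ^ 2 ≤ 0 :=
      div_nonpos_of_nonpos_of_nonneg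
        (mul_nonpos_of_nonneg_of_nonpos (by positivity) h) (by positivity)
    linarith
  refine add_le_add (typeIError_uTest_le hn2 hp1 hm1 (a ν) (ha ν) ht) ?_
  refine typeIIError_uTest_le hα (hφ ν) hD hK (le_max_right _ _) hc'lt hn2 hp1 hm1 (a ν) (ha ν)
    hDKν.1 hDKν.2 (htcν.trans ?_)
  have h1 : 0 ≤ φ ν ^ (2 + 1 / (2 * α)) := Real.rpow_nonneg (hφ ν).le _
  have h2 : 0 ≤ (a ν : ℝ) ^ 4 := by positivity
  exact mul_le_mul_of_nonneg_right (mul_le_mul_of_nonneg_right (le_max_left _ _) h2) h1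

theorem exists_isTuned (hα : 1 / 2 < α) (ha : ∀ ν, 0 < (a ν : ℝ)) (hφ : ∀ ν, 0 < φ ν)
    (hφ0 : Tendsto φ atTop (𝓝 0))
    (hsig : Tendsto (fun ν => signal α (n ν) (p ν) (a ν) (φ ν)) atTop atTop)
    (hpφ : Tendsto (fun ν => (p ν : ℝ) * φ ν ^ (1 / α)) atTop atTop) :
    ∃ (m : ℕ → ℕ) (t : ℕ → ℝ), IsTuned α n p a φ m t := by
  have hα0 : 0 < α := by linarith
  -- the bandwidth is of the order `φ^{-1/α}`, rounded up
  set x : ℕ → ℝ := fun ν => (2 / φ ν) ^ (1 / α) with hx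
  have hx0 : ∀ ν, 0 < x ν := fun ν => by have := hφ ν; positivity
  have hxα : ∀ ν, x ν ^ α = 2 / φ ν := fun ν => by
    have := hφ ν
    rw [hx, ← Real.rpow_mul (by positivity)]
    rw [one_div_mul_cancel hα0.ne', Real.rpow_one]
  have hxt : Tendsto x atTop atTop := by
    refine (tendsto_rpow_atTop (by positivity)).comp ?_
    refine Tendsto.const_mul_atTop two_pos ?_
    exact tendsto_inv_nhdsGT_zero.comp (tendsto_nhdsWithin_iff.2
      ⟨hφ0, Eventually.of_forall fun ν => hφ ν⟩)
  have hmle : ∀ᶠ ν in atTop, (⌈x ν⌉₊ : ℝ) ≤ 2 * x ν := by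
    filter_upwards [hxt.eventually_ge_atTop 1] with ν hν
    linarith [Nat.ceil_lt_add_one (hx0 ν).le]
  set K : ℝ := (2 ^ α * 2) ^ (-(1 / (2 * α))) with hK
  have hK0 : 0 < K := by positivity
  have hKα : K ^ (-(2 * α)) = 2 ^ α * 2 := by
    rw [hK, ← Real.rpow_mul (by positivity)]
    have : -(1 / (2 * α)) * -(2 * α) = 1 := by field_simp
    rw [this, Real.rpow_one]
  set c : ℝ := K * (1 - (2 ^ 2)⁻¹) / √2 / 2 with hc
  have hc0 : 0 < c := by rw [hc]; norm_num; positivity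
  refine ⟨fun ν => ⌈x ν⌉₊, fun ν => c * (a ν : ℝ) ^ 4 * φ ν ^ (2 + 1 / (2 * α)),
    tendsto_nat_ceil_atTop.comp hxt, ?_, ⟨2, K, c, one_lt_two, hK0, ?_, ?_, ?_⟩, ?_⟩
  · have h1 : Tendsto (fun ν => 2 * 2 ^ (1 / α) / ((p ν : ℝ) * φ ν ^ (1 / α))) atTop (𝓝 0) :=
      tendsto_const_nhds.div_atTop hpφ
    refine squeeze_zero' (Eventually.of_forall fun ν => by positivity) ?_ h1
    filter_upwards [hmle] with ν hν
    calc (⌈x ν⌉₊ : ℝ) / p ν ≤ 2 * x ν / p ν := by gcongr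
      _ = 2 * 2 ^ (1 / α) / ((p ν : ℝ) * φ ν ^ (1 / α)) := by
        rw [hx]
        simp only
        rw [Real.div_rpow zero_le_two (hφ ν).le]
        have : φ ν ^ (1 / α) ≠ 0 := (Real.rpow_pos_of_pos (hφ ν) _).ne'
        field_simp
  · filter_upwards [hmle] with ν hν
    have h1 := hφ ν
    constructor
    · calc (2 : ℝ) = x ν ^ α * φ ν := by rw [hxα]; field_simp
        _ ≤ (⌈x ν⌉₊ : ℝ) ^ α * φ ν := by
          have := (hx0 ν).le
          gcongr; exact Nat.le_ceil _
    · rw [hKα]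
      calc (⌈x ν⌉₊ : ℝ) ^ α * φ ν ≤ (2 * x ν) ^ α * φ ν := by gcongr
        _ = 2 ^ α * 2 := by
          rw [Real.mul_rpow zero_le_two (hx0 ν).le, hxα]; field_simp
  · rw [hc]
    refine half_lt_self ?_
    norm_num; positivity
  · exact Eventually.of_forall fun ν => le_rfl
  · refine (hsig.const_mul_atTop hc0).congr fun ν => ?_
    have h1 := ha ν
    rw [signal]
    field_simp

end UpperBoundAsymptotics

/-! ### Densities and Gaussian integrals -/

section ProductDensities

variable {ι : Type*} [Fintype ι] {X : ι → Type*} [∀ i, MeasurableSpace (X i)]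

lemma lintegral_pi_prod (μ : ∀ i, Measure (X i)) [∀ i, IsProbabilityMeasure (μ i)]
    {f : ∀ i, X i → ℝ≥0∞} (hf : ∀ i, Measurable (f i)) :
    ∫⁻ x, ∏ i, f i (x i) ∂(Measure.pi μ) = ∏ i, ∫⁻ x, f i x ∂(μ i) := by
  have hind : iIndepFun (fun i (x : ∀ i, X i) => f i (x i)) (Measure.pi μ) :=
    iIndepFun_pi fun i => (hf i).aemeasurable
  rw [lintegral_prod_eq_prod_lintegral_of_indepFun Finset.univ _ hind
    fun i => (hf i).comp (measurable_pi_apply i)]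
  refine Finset.prod_congr rfl fun i _ => ?_
  exact (measurePreserving_eval μ i).lintegral_comp (hf i)

lemma pi_eq_withDensity_prod (μ ν : ∀ i, Measure (X i)) [∀ i, IsProbabilityMeasure (μ i)]
    [∀ i, IsProbabilityMeasure (ν i)] {f : ∀ i, X i → ℝ≥0∞} (hf : ∀ i, Measurable (f i))
    (h : ∀ i, ν i = (μ i).withDensity (f i)) :
    Measure.pi ν = (Measure.pi μ).withDensity fun x => ∏ i, f i (x i) := by
  classical
  refine Measure.pi_eq fun s hs => ?_
  rw [withDensity_apply _ (MeasurableSet.univ_pi hs), ← lintegral_indicator (.univ_pi hs)]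
  have e : ∀ x : ∀ i, X i, (Set.univ.pi s).indicator (fun x => ∏ i, f i (x i)) x =
      ∏ i, (s i).indicator (f i) (x i) := by
    intro x
    by_cases hx : x ∈ Set.univ.pi s
    · rw [Set.indicator_of_mem hx]
      exact Finset.prod_congr rfl fun i _ => (Set.indicator_of_mem (hx i trivial) _).symm
    · rw [Set.indicator_of_notMem hx]
      obtain ⟨i, hi⟩ : ∃ i, x i ∉ s i := by
        by_contra! hc; exact hx fun i _ => hc i
      exact (Finset.prod_eq_zero (Finset.mem_univ i) (Set.indicator_of_notMem hi _)).symm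
  simp_rw [e]
  rw [lintegral_pi_prod μ fun i => (hf i).indicator (hs i)]
  refine Finset.prod_congr rfl fun i _ => ?_
  rw [lintegral_indicator (hs i), h i, withDensity_apply _ (hs i)]

end ProductDensities

section GaussianIntegrals

/-- The Gaussian integral that carries all the explicit computations of the lower bound. -/
lemma lintegral_exp_quadratic (b c : ℝ) (hc : 0 < 1 + 2 * c) :
    ∫⁻ x, ENNReal.ofReal (Real.exp (b * x - c * x ^ 2)) ∂(gaussianReal 0 1) =
      ENNReal.ofReal ((√(1 + 2 * c))⁻¹ * Real.exp (b ^ 2 / (2 * (1 + 2 * c)))) := by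
  set w := 1 + 2 * c with hw
  have hv : (0 : ℝ) ≤ w⁻¹ := by positivity
  set v : NNReal := ⟨w⁻¹, hv⟩ with hvdef
  have hv0 : v ≠ 0 := by
    intro h
    have : (v : ℝ) = 0 := by rw [h]; rfl
    have h2 : (v : ℝ) = w⁻¹ := rfl
    rw [h2] at this
    exact hc.ne' (inv_eq_zero.1 this)
  have hvc : (v : ℝ) = w⁻¹ := rfl
  rw [gaussianReal_of_var_ne_zero 0 one_ne_zero,
    lintegral_withDensity_eq_lintegral_mul _ (measurable_gaussianPDF 0 1) (by fun_prop)]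
  have e : ∀ x, (gaussianPDF 0 1 * fun x => ENNReal.ofReal (Real.exp (b * x - c * x ^ 2))) x =
      ENNReal.ofReal ((√w)⁻¹ * Real.exp (b ^ 2 / (2 * w))) * gaussianPDF (b / w) v x := by
    intro x
    simp only [Pi.mul_apply, gaussianPDF]
    rw [← ENNReal.ofReal_mul (gaussianPDFReal_nonneg _ _ _), ← ENNReal.ofReal_mul (by positivity)]
    congr 1
    simp only [gaussianPDFReal, hvc]
    have h1 : (√(2 * Real.pi * w⁻¹))⁻¹ = (√(2 * Real.pi))⁻¹ * √w := by
      rw [Real.sqrt_mul (by positivity), Real.sqrt_inv, mul_inv, inv_inv]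
    have h2 : √w ≠ 0 := by positivity
    rw [h1]
    calc _ = (√(2 * Real.pi))⁻¹ * Real.exp (b ^ 2 / (2 * w) + -(x - b / w) ^ 2 / (2 * w⁻¹)) := by
          simp only [NNReal.coe_one, mul_one, sub_zero]
          rw [mul_assoc, ← Real.exp_add]
          congr 2
          field_simp
          rw [hw]; ring
      _ = _ := by rw [Real.exp_add]; field_simp
  simp_rw [e]
  rw [lintegral_const_mul _ (measurable_gaussianPDF _ _), lintegral_gaussianPDF_eq_one _ hv0,
    mul_one]

/-- The density of `N(m, 1 - s)` with respect to `N(0, 1)`. -/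
noncomputable def shiftDensity (s m x : ℝ) : ℝ :=
  (√(1 - s))⁻¹ * Real.exp (-(x - m) ^ 2 / (2 * (1 - s)) + x ^ 2 / 2)

lemma shiftDensity_nonneg (s m x : ℝ) : 0 ≤ shiftDensity s m x := by
  unfold shiftDensity; positivity

lemma measurable_shiftDensity (s : ℝ) :
    Measurable fun q : ℝ × ℝ => shiftDensity s q.1 q.2 := by
  unfold shiftDensity; fun_prop

lemma map_affine_gaussianReal {s : ℝ} (hs : s < 1) (m : ℝ) :
    (gaussianReal 0 1).map (fun z => √(1 - s) * z + m) =
      (gaussianReal 0 1).withDensity fun x => ENNReal.ofReal (shiftDensity s m x) := by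
  have hs' : 0 < 1 - s := by linarith
  set v : NNReal := ⟨1 - s, hs'.le⟩ with hvdef
  have hvc : (v : ℝ) = 1 - s := rfl
  have hv0 : v ≠ 0 := by
    intro h
    have : (v : ℝ) = 0 := by rw [h]; rfl
    linarith
  have h1 : (gaussianReal 0 1).map (fun z => √(1 - s) * z + m) = gaussianReal m v := by
    have h := gaussianReal_map_const_mul (μ := 0) (v := 1) (√(1 - s))
    have e : (NNReal.mk (√(1 - s) ^ 2) (sq_nonneg _) * 1 : NNReal) = v := by
      ext; simp [hvc, Real.sq_sqrt hs'.le]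
    rw [e, mul_zero] at h
    have h' := gaussianReal_map_add_const (μ := 0) (v := v) m
    rw [← h, Measure.map_map (by fun_prop) (by fun_prop), zero_add] at h'
    exact h'
  rw [h1, gaussianReal_of_var_ne_zero m hv0, gaussianReal_of_var_ne_zero 0 one_ne_zero,
    ← withDensity_mul _ (measurable_gaussianPDF 0 1) (by unfold shiftDensity; fun_prop)]
  congr 1
  funext x
  simp only [Pi.mul_apply, gaussianPDF]
  rw [← ENNReal.ofReal_mul (gaussianPDFReal_nonneg _ _ _)]
  congr 1
  simp only [gaussianPDFReal, shiftDensity, hvc, NNReal.coe_one, mul_one, sub_zero]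
  have h2 : (√(2 * Real.pi * (1 - s)))⁻¹ = (√(2 * Real.pi))⁻¹ * (√(1 - s))⁻¹ := by
    rw [Real.sqrt_mul (by positivity), mul_inv]
  rw [h2, Real.exp_add, neg_div (2 : ℝ), Real.exp_neg (x ^ 2 / 2)]
  field_simp

/-- The Mehler kernel: the inner product of two shifted densities. -/
lemma lintegral_shiftDensity_mul {s : ℝ} (hs0 : 0 ≤ s) (hs : s < 1) (m k : ℝ) :
    ∫⁻ x, ENNReal.ofReal (shiftDensity s m x) * ENNReal.ofReal (shiftDensity s k x)
      ∂(gaussianReal 0 1) = ENNReal.ofReal ((√(1 - s ^ 2))⁻¹ *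
        Real.exp ((m * k - s * (m ^ 2 + k ^ 2) / 2) / (1 - s ^ 2))) := by
  have hs' : 0 < 1 - s := by linarith
  have hs'' : 0 < 1 + s := by linarith
  have hw : 0 < 1 + 2 * (s / (1 - s)) := by positivity
  have hw' : 1 + 2 * (s / (1 - s)) = (1 + s) / (1 - s) := by field_simp; ring
  have e : ∀ x, ENNReal.ofReal (shiftDensity s m x) * ENNReal.ofReal (shiftDensity s k x) =
      ENNReal.ofReal ((1 - s)⁻¹ * Real.exp (-(m ^ 2 + k ^ 2) / (2 * (1 - s)))) *
        ENNReal.ofReal (Real.exp (((m + k) / (1 - s)) * x - (s / (1 - s)) * x ^ 2)) := by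
    intro x
    rw [← ENNReal.ofReal_mul (shiftDensity_nonneg _ _ _), ← ENNReal.ofReal_mul (by positivity)]
    congr 1
    unfold shiftDensity
    have h1 : (1 - s)⁻¹ = (√(1 - s))⁻¹ * (√(1 - s))⁻¹ := by
      rw [← mul_inv, Real.mul_self_sqrt hs'.le]
    rw [h1, mul_mul_mul_comm, ← Real.exp_add, mul_assoc _ (Real.exp _) (Real.exp _),
      ← Real.exp_add]
    congr 2
    field_simp
    ring
  simp_rw [e]
  rw [lintegral_const_mul _ (by fun_prop), lintegral_exp_quadratic _ _ hw,
    ← ENNReal.ofReal_mul (by positivity), hw']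
  congr 1
  have h2 : 1 - s ^ 2 = (1 - s) * (1 + s) := by ring
  have h3 : (1 - s)⁻¹ * (√((1 + s) / (1 - s)))⁻¹ = (√(1 - s ^ 2))⁻¹ := by
    rw [h2, Real.sqrt_div hs''.le, Real.sqrt_mul hs'.le]
    have h4 : (1 - s)⁻¹ = (√(1 - s))⁻¹ * (√(1 - s))⁻¹ := by
      rw [← mul_inv, Real.mul_self_sqrt hs'.le]
    have : √(1 - s) ≠ 0 := by positivity
    have : √(1 + s) ≠ 0 := by positivity
    rw [h4]; field_simp
  rw [← h3, mul_mul_mul_comm, ← Real.exp_add]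
  congr 2
  rw [h2]
  field_simp
  ring

end GaussianIntegrals

/-! ### The prior and its factor representation -/

section FactorModel

variable {p : ℕ}

/-- A sign, as a real number. -/
def sgn (u : ℤˣ) : ℝ := ((u : ℤ) : ℝ)

lemma sgn_mul_self (u : ℤˣ) : sgn u * sgn u = 1 := by
  rcases Int.units_eq_one_or u with h | h <;> simp [sgn, h]

lemma sgn_mul (u v : ℤˣ) : sgn (u * v) = sgn u * sgn v := by simp [sgn]

/-- The loadings of the one-factor model within each block: the factor of the block `b i` enters
the coordinate `i` with the sign `u i`. -/
def loading (b : Fin p → Fin p) (u : Fin p → ℤˣ) : Matrix (Fin p) (Fin p) ℝ :=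
  Matrix.of fun i c => if b i = c then sgn (u i) else 0

/-- The covariance matrices of the prior: within the blocks of `b`, the correlations are
`s u_i u_j`; all other correlations vanish. -/
def priorCov (s : ℝ) (b : Fin p → Fin p) (u : Fin p → ℤˣ) : Matrix (Fin p) (Fin p) ℝ :=
  (1 - s) • (1 : Matrix (Fin p) (Fin p) ℝ) + s • (loading b u * (loading b u).transpose)

lemma loading_mul_transpose_apply (b : Fin p → Fin p) (u : Fin p → ℤˣ) (i j : Fin p) :
    (loading b u * (loading b u).transpose) i j =
      if b i = b j then sgn (u i) * sgn (u j) else 0 := by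
  simp only [Matrix.mul_apply, Matrix.transpose_apply, loading, Matrix.of_apply, ite_mul, zero_mul]
  rw [Finset.sum_ite_eq]
  simp [eq_comm]

lemma priorCov_diag (s : ℝ) (b : Fin p → Fin p) (u : Fin p → ℤˣ) (i : Fin p) :
    priorCov s b u i i = 1 := by
  simp [priorCov, loading_mul_transpose_apply, sgn_mul_self]

lemma priorCov_sq_of_ne (s : ℝ) (b : Fin p → Fin p) (u : Fin p → ℤˣ) {i j : Fin p} (h : i ≠ j) :
    priorCov s b u i j ^ 2 = if b i = b j then s ^ 2 else 0 := by
  simp only [priorCov, Matrix.add_apply, Matrix.smul_apply, Matrix.one_apply_ne h,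
    loading_mul_transpose_apply, smul_eq_mul, mul_zero, zero_add]
  split_ifs
  · have e : (s * (sgn (u i) * sgn (u j))) ^ 2 =
        s ^ 2 * (sgn (u i) * sgn (u i)) * (sgn (u j) * sgn (u j)) := by ring
    rw [e, sgn_mul_self, sgn_mul_self]; ring
  · simp

lemma posDef_priorCov {s : ℝ} (hs0 : 0 ≤ s) (hs : s < 1) (b : Fin p → Fin p) (u : Fin p → ℤˣ) :
    (priorCov s b u).PosDef := by
  have h1 : ((1 - s) • (1 : Matrix (Fin p) (Fin p) ℝ)).PosDef :=
    Matrix.PosDef.one.smul (by linarith)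
  have h2 : (s • (loading b u * (loading b u).transpose)).PosSemidef := by
    have := Matrix.posSemidef_self_mul_conjTranspose (loading b u)
    rw [Matrix.conjTranspose_eq_transpose_of_trivial] at this
    exact this.smul hs0
  exact h1.add_posSemidef h2

lemma integral_cexp_sum_gaussian {ι : Type*} [Fintype ι] (t : ι → ℝ) :
    ∫ z : ι → ℝ, Complex.exp (((∑ i, t i * z i : ℝ) : ℂ) * Complex.I)
      ∂(Measure.pi fun _ => gaussianReal 0 1) = Complex.exp (-((∑ i, t i ^ 2 : ℝ) : ℂ) / 2) := by
  have e : ∀ z : ι → ℝ, Complex.exp (((∑ i, t i * z i : ℝ) : ℂ) * Complex.I) =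
      ∏ i, (fun i x => Complex.exp ((t i : ℂ) * (x : ℝ) * Complex.I)) i (z i) := by
    intro z
    rw [← Complex.exp_sum, ← Finset.sum_mul]
    push_cast; rfl
  simp_rw [e]
  rw [integral_fintype_prod_eq_prod
    (f := fun i (x : ℝ) => Complex.exp ((t i : ℂ) * (x : ℝ) * Complex.I))]
  simp_rw [← charFun_apply_real, charFun_gaussianReal]
  rw [← Complex.exp_sum]
  congr 1
  push_cast
  rw [← Finset.sum_neg_distrib, Finset.sum_div]
  exact Finset.sum_congr rfl fun i _ => by simp; ring

/-- The factor representation of the Gaussian law with covariance matrix `priorCov s b u`. -/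
lemma multivariateGaussian_priorCov {s : ℝ} (hs0 : 0 ≤ s) (hs : s < 1) (b : Fin p → Fin p)
    (u : Fin p → ℤˣ) :
    multivariateGaussian 0 (priorCov s b u) =
      ((Measure.pi fun _ : Fin p => gaussianReal 0 1).prod
        (Measure.pi fun _ : Fin p => gaussianReal 0 1)).map
      fun q => WithLp.toLp 2 fun i => √(1 - s) * q.1 i + √s * sgn (u i) * q.2 (b i) := by
  have : IsProbabilityMeasure (((Measure.pi fun _ : Fin p => gaussianReal 0 1).prod
        (Measure.pi fun _ : Fin p => gaussianReal 0 1)).map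
      fun q => WithLp.toLp 2 fun i => √(1 - s) * q.1 i + √s * sgn (u i) * q.2 (b i)) :=
    Measure.isProbabilityMeasure_map (by fun_prop)
  apply Measure.ext_of_charFun (E := EuclideanSpace ℝ (Fin p))
  funext x
  rw [charFun_multivariateGaussian (posDef_priorCov hs0 hs b u).posSemidef, charFun_apply,
    integral_map (by fun_prop) (by fun_prop)]
  have hload : ∀ g : Fin p → ℝ, ∀ i, sgn (u i) * g (b i) = (loading b u).mulVec g i := by
    intro g i
    simp [Matrix.mulVec, dotProduct, loading]
  have e : ∀ q : (Fin p → ℝ) × (Fin p → ℝ),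
      Complex.exp ((inner ℝ (WithLp.toLp 2 fun i => √(1 - s) * q.1 i +
        √s * sgn (u i) * q.2 (b i) : EuclideanSpace ℝ (Fin p)) x : ℝ) * Complex.I) =
      Complex.exp (((∑ i, (√(1 - s) * x i) * q.1 i : ℝ) : ℂ) * Complex.I) *
      Complex.exp (((∑ c, (√s * (loading b u).transpose.mulVec x c) * q.2 c : ℝ) : ℂ) *
        Complex.I) := by
    intro q
    rw [← Complex.exp_add, ← add_mul, ← Complex.ofReal_add]
    congr 3
    rw [PiLp.inner_apply]
    simp only [mul_assoc, hload]
    have h1 : ∑ c, √s * ((loading b u).transpose.mulVec x c * q.2 c) =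
        ∑ i, √s * ((loading b u).mulVec q.2 i * x i) := by
      rw [← Finset.mul_sum, ← Finset.mul_sum]
      congr 1
      change (loading b u).transpose.mulVec x ⬝ᵥ q.2 = (loading b u).mulVec q.2 ⬝ᵥ x.ofLp
      rw [Matrix.mulVec_transpose, ← Matrix.dotProduct_mulVec, dotProduct_comm]
    rw [h1, ← Finset.sum_add_distrib]
    refine Finset.sum_congr rfl fun i _ => ?_
    simp
    ring
  simp_rw [e]
  rw [integral_prod_mul (μ := Measure.pi fun _ : Fin p => gaussianReal 0 1)
    (ν := Measure.pi fun _ : Fin p => gaussianReal 0 1)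
    (f := fun z : Fin p → ℝ =>
      Complex.exp (((∑ i, (√(1 - s) * x i) * z i : ℝ) : ℂ) * Complex.I))
    (g := fun g : Fin p → ℝ => Complex.exp (((∑ c, (√s *
      (loading b u).transpose.mulVec x c) * g c : ℝ) : ℂ) * Complex.I)),
    integral_cexp_sum_gaussian, integral_cexp_sum_gaussian, ← Complex.exp_add]
  congr 1
  have h2 : x.ofLp ⬝ᵥ (priorCov s b u).mulVec x.ofLp = ∑ i, (√(1 - s) * x i) ^ 2 +
      ∑ c, (√s * (loading b u).transpose.mulVec x c) ^ 2 := by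
    simp only [priorCov, Matrix.add_mulVec, Matrix.smul_mulVec, Matrix.one_mulVec, dotProduct_add,
      dotProduct_smul, smul_eq_mul, mul_pow, ← Finset.mul_sum]
    rw [Real.sq_sqrt (by linarith), Real.sq_sqrt hs0]
    congr 2
    · simp [dotProduct, pow_two]
    · rw [← Matrix.mulVec_mulVec, Matrix.dotProduct_mulVec, ← Matrix.mulVec_transpose]
      simp [dotProduct, pow_two]
  rw [h2]
  push_cast
  simp
  ring

end FactorModel

/-! ### Likelihood ratios of the prior -/

section ObservationDensity

variable {p : ℕ}

/-- The law of one coordinate of an observation under the null hypothesis. -/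
noncomputable def nullCoord (a : unitInterval) : Measure ℝ :=
  ((gaussianReal 0 1).prod (bernoulliMeasure (1 : ℝ) 0 a)).map fun q => q.2 * q.1

/-- The law of one coordinate of an observation, given that the factor contributes `m` to it. -/
noncomputable def shiftCoord (a : unitInterval) (s m : ℝ) : Measure ℝ :=
  ((gaussianReal 0 1).prod (bernoulliMeasure (1 : ℝ) 0 a)).map
    fun q => q.2 * (√(1 - s) * q.1 + m)

instance (a : unitInterval) : IsProbabilityMeasure (nullCoord a) :=
  Measure.isProbabilityMeasure_map (by fun_prop)

instance (a : unitInterval) (s m : ℝ) : IsProbabilityMeasure (shiftCoord a s m) :=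
  Measure.isProbabilityMeasure_map (by fun_prop)

lemma lintegral_bernoulliMeasure (a : unitInterval) (f : ℝ → ℝ≥0∞) :
    ∫⁻ e, f e ∂(bernoulliMeasure (1 : ℝ) 0 a) =
      ENNReal.ofReal a * f 1 + ENNReal.ofReal (1 - a) * f 0 := by
  rw [bernoulliMeasure_def, lintegral_add_measure, lintegral_smul_measure, lintegral_smul_measure,
    lintegral_dirac, lintegral_dirac]
  have h1 : ENNReal.ofReal (a : ℝ) = ((unitInterval.toNNReal a : NNReal) : ℝ≥0∞) := by
    rw [ENNReal.ofReal]; congr 1; ext; simp [a.2.1]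
  have h2 : ENNReal.ofReal (1 - a : ℝ) =
      ((unitInterval.toNNReal (unitInterval.symm a) : NNReal) : ℝ≥0∞) := by
    rw [ENNReal.ofReal]; congr 1; ext; simp [a.2.2]
  rw [h1, h2]; rfl

lemma lintegral_nullCoord (a : unitInterval) {f : ℝ → ℝ≥0∞} (hf : Measurable f) :
    ∫⁻ y, f y ∂(nullCoord a) =
      ENNReal.ofReal a * ∫⁻ z, f z ∂(gaussianReal 0 1) + ENNReal.ofReal (1 - a) * f 0 := by
  unfold nullCoord
  rw [lintegral_map hf (by fun_prop), lintegral_prod _ (by fun_prop)]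
  simp_rw [lintegral_bernoulliMeasure, one_mul, zero_mul]
  rw [lintegral_add_right _ measurable_const, lintegral_const_mul _ hf]
  simp

lemma lintegral_shiftCoord (a : unitInterval) (s m : ℝ) {f : ℝ → ℝ≥0∞} (hf : Measurable f) :
    ∫⁻ y, f y ∂(shiftCoord a s m) = ENNReal.ofReal a *
      ∫⁻ z, f (√(1 - s) * z + m) ∂(gaussianReal 0 1) + ENNReal.ofReal (1 - a) * f 0 := by
  unfold shiftCoord
  rw [lintegral_map hf (by fun_prop), lintegral_prod _ (by fun_prop)]
  simp_rw [lintegral_bernoulliMeasure, one_mul, zero_mul]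
  rw [lintegral_add_right _ measurable_const, lintegral_const_mul _ (by fun_prop)]
  simp

/-- The density of `shiftCoord a s m` with respect to `nullCoord a`. A missing coordinate is
observed as `0`, which carries no information. -/
noncomputable def coordDensity (s m y : ℝ) : ℝ≥0∞ :=
  if y = 0 then 1 else ENNReal.ofReal (shiftDensity s m y)

lemma measurable_coordDensity (s : ℝ) :
    Measurable fun q : ℝ × ℝ => coordDensity s q.1 q.2 := by
  unfold coordDensity
  refine Measurable.ite ?_ measurable_const (measurable_shiftDensity s).ennreal_ofReal
  exact measurable_snd (measurableSet_singleton 0)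

lemma coordDensity_ae_eq (s m : ℝ) : (fun y => coordDensity s m y) =ᵐ[gaussianReal 0 1]
    fun y => ENNReal.ofReal (shiftDensity s m y) := by
  have : NullSingletonClass (gaussianReal 0 1) := nullSingletonClass_gaussianReal one_ne_zero
  have h : ∀ᵐ y ∂(gaussianReal 0 1), y ≠ 0 := by
    rw [ae_iff]; simp
  filter_upwards [h] with y hy
  simp [coordDensity, hy]

lemma shiftCoord_eq_withDensity (a : unitInterval) {s : ℝ} (hs : s < 1) (m : ℝ) :
    shiftCoord a s m = (nullCoord a).withDensity (coordDensity s m) := by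
  have hd : Measurable (coordDensity s m) :=
    (measurable_coordDensity s).comp measurable_prodMk_left
  have hsd : Measurable fun z => ENNReal.ofReal (shiftDensity s m z) :=
    ((measurable_shiftDensity s).comp (measurable_prodMk_left (x := m))).ennreal_ofReal
  refine Measure.ext_of_lintegral _ fun f hf => ?_
  rw [lintegral_withDensity_eq_lintegral_mul _ hd hf, lintegral_nullCoord a (hd.mul hf),
    lintegral_shiftCoord a s m hf]
  congr 2
  · rw [← lintegral_map hf (by fun_prop), map_affine_gaussianReal hs m,
      lintegral_withDensity_eq_lintegral_mul _ hsd hf]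
    refine lintegral_congr_ae ?_
    filter_upwards [coordDensity_ae_eq s m] with y hy
    simp [hy]
  · simp [coordDensity]

/-- Independent pairs of coordinates, combined coordinatewise. -/
lemma lintegral_lintegral_pi (μ ν : Measure ℝ) [IsProbabilityMeasure μ] [IsProbabilityMeasure ν]
    {k : Fin p → ℝ × ℝ → ℝ} (hk : ∀ i, Measurable (k i)) {f : (Fin p → ℝ) → ℝ≥0∞}
    (hf : Measurable f) :
    ∫⁻ z, ∫⁻ e, f (fun i => k i (z i, e i)) ∂(Measure.pi fun _ => ν) ∂(Measure.pi fun _ => μ) =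
      ∫⁻ y, f y ∂(Measure.pi fun i => (μ.prod ν).map (k i)) := by
  have hprob : ∀ i, IsProbabilityMeasure ((μ.prod ν).map (k i)) := fun i =>
    Measure.isProbabilityMeasure_map (hk i).aemeasurable
  rw [← Measure.pi_map_pi (μ := fun _ : Fin p => μ.prod ν) (f := k) fun i => (hk i).aemeasurable,
    lintegral_map hf (by fun_prop)]
  have hmp := measurePreserving_arrowProdEquivProdArrow ℝ ℝ (Fin p) (fun _ => μ) (fun _ => ν)
  have hm : Measurable fun q : (Fin p → ℝ) × (Fin p → ℝ) => f (fun i => k i (q.1 i, q.2 i)) := by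
    fun_prop
  rw [← lintegral_prod (fun q : (Fin p → ℝ) × (Fin p → ℝ) => f (fun i => k i (q.1 i, q.2 i)))
    hm.aemeasurable, ← hmp.map_eq, lintegral_map hm hmp.measurable]
  rfl

lemma obsLaw_one (a : unitInterval) :
    obsLaw a (1 : Matrix (Fin p) (Fin p) ℝ) = Measure.pi fun _ => nullCoord a := by
  refine Measure.ext_of_lintegral _ fun f hf => ?_
  unfold obsLaw nullCoord
  rw [lintegral_map hf (by fun_prop), lintegral_prod _ (by fun_prop), multivariateGaussian_zero_one,
    ← map_pi_eq_stdGaussian, lintegral_map (by fun_prop) (by fun_prop)]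
  exact lintegral_lintegral_pi (gaussianReal 0 1) (bernoulliMeasure (1 : ℝ) 0 a)
    (k := fun _ q => q.2 * q.1) (fun _ => by fun_prop) hf

/-- The likelihood ratio of one observation under `priorCov s b u`, an average over the factors. -/
noncomputable def obsDensity (s : ℝ) (b : Fin p → Fin p) (u : Fin p → ℤˣ) (y : Fin p → ℝ) :
    ℝ≥0∞ :=
  ∫⁻ g : Fin p → ℝ, ∏ i, coordDensity s (√s * sgn (u i) * g (b i)) (y i)
    ∂(Measure.pi fun _ => gaussianReal 0 1)

lemma measurable_prod_coordDensity (s : ℝ) (b : Fin p → Fin p) (u : Fin p → ℤˣ) :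
    Measurable fun q : (Fin p → ℝ) × (Fin p → ℝ) =>
      ∏ i, coordDensity s (√s * sgn (u i) * q.2 (b i)) (q.1 i) := by
  refine Finset.measurable_prod _ fun i _ => ?_
  exact (measurable_coordDensity s).comp (by fun_prop :
    Measurable fun q : (Fin p → ℝ) × (Fin p → ℝ) => (√s * sgn (u i) * q.2 (b i), q.1 i))

lemma measurable_obsDensity (s : ℝ) (b : Fin p → Fin p) (u : Fin p → ℤˣ) :
    Measurable (obsDensity s b u) :=
  (measurable_prod_coordDensity s b u).lintegral_prod_right'

lemma obsLaw_priorCov (a : unitInterval) {s : ℝ} (hs0 : 0 ≤ s) (hs : s < 1) (b : Fin p → Fin p)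
    (u : Fin p → ℤˣ) :
    obsLaw a (priorCov s b u) =
      (obsLaw a (1 : Matrix (Fin p) (Fin p) ℝ)).withDensity (obsDensity s b u) := by
  refine Measure.ext_of_lintegral _ fun f hf => ?_
  rw [lintegral_withDensity_eq_lintegral_mul _ (measurable_obsDensity s b u) hf, obsLaw_one]
  unfold obsLaw
  rw [lintegral_map hf (by fun_prop), lintegral_prod _ (by fun_prop),
    multivariateGaussian_priorCov hs0 hs b u, lintegral_map (by fun_prop) (by fun_prop),
    lintegral_prod_symm _ (by fun_prop)]
  have h1 : ∀ g : Fin p → ℝ, ∫⁻ z : Fin p → ℝ, ∫⁻ e : Fin p → ℝ,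
      f (fun i => e i * (√(1 - s) * z i + √s * sgn (u i) * g (b i)))
        ∂(Measure.pi fun _ => bernoulliMeasure (1 : ℝ) 0 a)
        ∂(Measure.pi fun _ => gaussianReal 0 1) =
      ∫⁻ y, (∏ i, coordDensity s (√s * sgn (u i) * g (b i)) (y i)) * f y
        ∂(Measure.pi fun _ => nullCoord a) := by
    intro g
    have hd : ∀ i, Measurable (coordDensity s (√s * sgn (u i) * g (b i))) := fun i =>
      (measurable_coordDensity s).comp measurable_prodMk_left
    have h2 := lintegral_lintegral_pi (gaussianReal 0 1) (bernoulliMeasure (1 : ℝ) 0 a)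
      (k := fun i q => q.2 * (√(1 - s) * q.1 + √s * sgn (u i) * g (b i)))
      (fun _ => by fun_prop) hf
    have h3 := pi_eq_withDensity_prod (fun _ : Fin p => nullCoord a)
      (fun i => shiftCoord a s (√s * sgn (u i) * g (b i))) hd
      (fun i => shiftCoord_eq_withDensity a hs _)
    refine h2.trans ?_
    change ∫⁻ y, f y ∂(Measure.pi fun i => shiftCoord a s (√s * sgn (u i) * g (b i))) = _
    have hprod : Measurable fun y : Fin p → ℝ =>
        ∏ i, coordDensity s (√s * sgn (u i) * g (b i)) (y i) :=
      Finset.measurable_prod _ fun i _ => (hd i).comp (measurable_pi_apply i)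
    rw [h3, lintegral_withDensity_eq_lintegral_mul _ hprod hf]
    rfl
  calc _ = ∫⁻ g : Fin p → ℝ, ∫⁻ y, (∏ i, coordDensity s (√s * sgn (u i) * g (b i)) (y i)) * f y
        ∂(Measure.pi fun _ => nullCoord a) ∂(Measure.pi fun _ => gaussianReal 0 1) :=
        lintegral_congr fun g => h1 g
    _ = ∫⁻ y, ∫⁻ g : Fin p → ℝ, (∏ i, coordDensity s (√s * sgn (u i) * g (b i)) (y i)) * f y
        ∂(Measure.pi fun _ => gaussianReal 0 1) ∂(Measure.pi fun _ => nullCoord a) := by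
        rw [lintegral_lintegral_swap]
        have := measurable_prod_coordDensity s b u
        exact ((this.comp measurable_swap).mul (hf.comp measurable_snd)).aemeasurable
    _ = _ := by
        refine lintegral_congr fun y => ?_
        simp only [Pi.mul_apply, obsDensity]
        rw [lintegral_mul_const]
        exact (measurable_prod_coordDensity s b u).comp measurable_prodMk_left

/-- The likelihood ratio of the sample under `priorCov s b u`. -/
noncomputable def sampleDensity {n : ℕ} (s : ℝ) (b : Fin p → Fin p) (u : Fin p → ℤˣ)
    (y : Sample n p) : ℝ≥0∞ :=
  ∏ k, obsDensity s b u (y k)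

lemma measurable_sampleDensity {n : ℕ} (s : ℝ) (b : Fin p → Fin p) (u : Fin p → ℤˣ) :
    Measurable (sampleDensity s b u : Sample n p → ℝ≥0∞) :=
  Finset.measurable_prod _ fun k _ => (measurable_obsDensity s b u).comp (measurable_pi_apply k)

lemma sampleLaw_priorCov (n : ℕ) (a : unitInterval) {s : ℝ} (hs0 : 0 ≤ s) (hs : s < 1)
    (b : Fin p → Fin p) (u : Fin p → ℤˣ) :
    sampleLaw n a (priorCov s b u) =
      (sampleLaw n a (1 : Matrix (Fin p) (Fin p) ℝ)).withDensity (sampleDensity s b u) :=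
  pi_eq_withDensity_prod (fun _ : Fin n => obsLaw a (1 : Matrix (Fin p) (Fin p) ℝ))
    (fun _ => obsLaw a (priorCov s b u)) (fun _ => measurable_obsDensity s b u)
    (fun _ => obsLaw_priorCov a hs0 hs b u)

/-- The Mehler kernel of parameter `s w`, for `w = ±1`. -/
noncomputable def mehler (s w x y : ℝ) : ℝ :=
  (√(1 - s ^ 2))⁻¹ * Real.exp ((s * w * (x * y) - s ^ 2 * (x ^ 2 + y ^ 2) / 2) / (1 - s ^ 2))

lemma mehler_nonneg (s w x y : ℝ) : 0 ≤ mehler s w x y := by unfold mehler; positivity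

lemma lintegral_coordDensity_mul (a : unitInterval) {s : ℝ} (hs0 : 0 ≤ s) (hs : s < 1) (u v : ℤˣ)
    (x y : ℝ) :
    ∫⁻ t, coordDensity s (√s * sgn u * x) t * coordDensity s (√s * sgn v * y) t ∂(nullCoord a) =
      ENNReal.ofReal (a * mehler s (sgn (u * v)) x y + (1 - a)) := by
  have hd : ∀ m, Measurable (coordDensity s m) := fun m =>
    (measurable_coordDensity s).comp measurable_prodMk_left
  refine (lintegral_nullCoord a ((hd _).mul (hd _))).trans ?_
  have h1 : ∫⁻ t, (coordDensity s (√s * sgn u * x) * coordDensity s (√s * sgn v * y)) t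
      ∂(gaussianReal 0 1) = ENNReal.ofReal (mehler s (sgn (u * v)) x y) := by
    calc _ = ∫⁻ t, ENNReal.ofReal (shiftDensity s (√s * sgn u * x) t) *
          ENNReal.ofReal (shiftDensity s (√s * sgn v * y) t) ∂(gaussianReal 0 1) := by
          refine lintegral_congr_ae ?_
          filter_upwards [coordDensity_ae_eq s (√s * sgn u * x),
            coordDensity_ae_eq s (√s * sgn v * y)] with t h1 h2
          simp only [Pi.mul_apply, h1, h2]
      _ = _ := by
          rw [lintegral_shiftDensity_mul hs0 hs]
          congr 1
          unfold mehler
          congr 3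
          have h3 := Real.mul_self_sqrt hs0
          rw [sgn_mul]
          have e1 : √s * sgn u * x * (√s * sgn v * y) = (√s * √s) * (sgn u * sgn v) * (x * y) := by
            ring
          have e2 : (√s * sgn u * x) ^ 2 + (√s * sgn v * y) ^ 2 = (√s * √s) *
              ((sgn u * sgn u) * x ^ 2 + (sgn v * sgn v) * y ^ 2) := by ring
          rw [e1, e2, h3, sgn_mul_self, sgn_mul_self]
          ring
  have ha0 := a.2.1
  have ha1 := a.2.2
  rw [h1, Pi.mul_apply]
  have h0 : ∀ m, coordDensity s m 0 = 1 := fun m => by simp [coordDensity]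
  rw [h0, h0, mul_one, mul_one, ENNReal.ofReal_add (mul_nonneg ha0 (mehler_nonneg _ _ _ _))
    (by linarith), ENNReal.ofReal_mul ha0]

lemma lintegral_obsDensity_mul (a : unitInterval) {s : ℝ} (hs0 : 0 ≤ s) (hs : s < 1)
    (b : Fin p → Fin p) (u v : Fin p → ℤˣ) :
    ∫⁻ y, obsDensity s b u y * obsDensity s b v y ∂(obsLaw a (1 : Matrix (Fin p) (Fin p) ℝ)) =
      ∫⁻ x : Fin p → ℝ, ∫⁻ x' : Fin p → ℝ,
        ∏ i, ENNReal.ofReal (a * mehler s (sgn (u i * v i)) (x (b i)) (x' (b i)) + (1 - a))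
        ∂(Measure.pi fun _ => gaussianReal 0 1) ∂(Measure.pi fun _ => gaussianReal 0 1) := by
  rw [obsLaw_one]
  have hu := measurable_prod_coordDensity s b u
  have hv := measurable_prod_coordDensity s b v
  have h1 : ∀ y : Fin p → ℝ, obsDensity s b u y * obsDensity s b v y =
      ∫⁻ x : Fin p → ℝ, ∫⁻ x' : Fin p → ℝ,
        (∏ i, coordDensity s (√s * sgn (u i) * x (b i)) (y i)) *
        (∏ i, coordDensity s (√s * sgn (v i) * x' (b i)) (y i))
        ∂(Measure.pi fun _ => gaussianReal 0 1) ∂(Measure.pi fun _ => gaussianReal 0 1) := by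
    intro y
    rw [lintegral_lintegral_mul]
    · rfl
    · exact (hu.comp measurable_prodMk_left).aemeasurable
    · exact (hv.comp measurable_prodMk_left).aemeasurable
  simp_rw [h1]
  rw [lintegral_lintegral_swap]
  · refine lintegral_congr fun x => ?_
    rw [lintegral_lintegral_swap]
    · refine lintegral_congr fun x' => ?_
      simp_rw [← Finset.prod_mul_distrib]
      rw [lintegral_pi_prod (fun _ : Fin p => nullCoord a) (f := fun i t =>
        coordDensity s (√s * sgn (u i) * x (b i)) t * coordDensity s (√s * sgn (v i) * x' (b i)) t)]
      · exact Finset.prod_congr rfl fun i _ => lintegral_coordDensity_mul a hs0 hs _ _ _ _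
      · intro i
        exact ((measurable_coordDensity s).comp measurable_prodMk_left).mul
          ((measurable_coordDensity s).comp measurable_prodMk_left)
    · refine Measurable.aemeasurable ?_
      exact (hu.comp (by fun_prop : Measurable fun q : (Fin p → ℝ) × (Fin p → ℝ) => (q.1, x))).mul
        hv
  · refine Measurable.aemeasurable ?_
    have : Measurable fun q : ((Fin p → ℝ) × (Fin p → ℝ)) × (Fin p → ℝ) =>
        (∏ i, coordDensity s (√s * sgn (u i) * q.1.2 (b i)) (q.1.1 i)) *
        (∏ i, coordDensity s (√s * sgn (v i) * q.2 (b i)) (q.1.1 i)) :=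
      (hu.comp (measurable_fst)).mul (hv.comp (by fun_prop :
        Measurable fun q : ((Fin p → ℝ) × (Fin p → ℝ)) × (Fin p → ℝ) => (q.1.1, q.2)))
    exact this.lintegral_prod_right'

end ObservationDensity

/-! ### The chi-square integral over a block of complete observations -/

section BlockIntegral

lemma inv_sqrt_one_sub_le {y : ℝ} (h1 : y ≤ 1 / 2) :
    (√(1 - y))⁻¹ ≤ 1 + y / 2 + y ^ 2 := by
  have h0 : 0 < 1 - y := by linarith
  have hpos : 0 ≤ 1 + y / 2 + y ^ 2 := by nlinarith [sq_nonneg (y + 1 / 4)]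
  rw [inv_le_iff_one_le_mul₀ (Real.sqrt_pos.2 h0)]
  have h2 : 1 ≤ (1 + y / 2 + y ^ 2) ^ 2 * (1 - y) := by
    have e : (1 + y / 2 + y ^ 2) ^ 2 * (1 - y) = 1 + y ^ 2 * (5 / 4 - 5 / 4 * y - y ^ 3) := by ring
    have h3 : y ^ 3 ≤ 1 / 8 := by
      calc y ^ 3 ≤ (1 / 2) ^ 3 := by
            exact (Odd.strictMono_pow (by decide : Odd 3)).monotone h1
        _ = 1 / 8 := by norm_num
    rw [e]
    have : 0 ≤ 5 / 4 - 5 / 4 * y - y ^ 3 := by linarith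
    nlinarith [mul_nonneg (sq_nonneg y) this]
  calc (1 : ℝ) ≤ √((1 + y / 2 + y ^ 2) ^ 2 * (1 - y)) := Real.one_le_sqrt.2 h2
    _ = (1 + y / 2 + y ^ 2) * √(1 - y) := by
        rw [Real.sqrt_mul (sq_nonneg _), Real.sqrt_sq hpos]

/-- Second-order expansion of the inverse square root of the determinant of the Gaussian integral
over a block with `N` observed coordinates and sign sum `σ`; the linear term vanishes for a single
coordinate. -/
lemma inv_sqrt_det_le {x σ : ℝ} {N : ℕ} (hx : 0 ≤ x) (hxN : x * (N : ℝ) ^ 2 ≤ 1 / 16)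
    (hN : 2 ≤ N) (hσ : σ ^ 2 ≤ (N : ℝ) ^ 2) :
    (√((1 - x) ^ (N - 2) * ((1 + x * (N - 1)) ^ 2 - x * σ ^ 2)))⁻¹ ≤
      1 + x * (σ ^ 2 - N) / 2 + 8 * x ^ 2 * (N * (N - 1) + (σ ^ 2 - N) ^ 2) := by
  have hN' : (2 : ℝ) ≤ N := by exact_mod_cast hN
  set q := σ ^ 2 - N with hq
  have hx1 : x ≤ 1 / 64 := by
    have : x * 4 ≤ x * (N : ℝ) ^ 2 := mul_le_mul_of_nonneg_left (by nlinarith) hx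
    linarith
  have hqabs : |q| ≤ (N : ℝ) ^ 2 := by
    rw [abs_le]; constructor <;> nlinarith [sq_nonneg σ]
  have hbr : 0 ≤ (1 + x * (N - 1)) ^ 2 - x * σ ^ 2 := by
    have : x * σ ^ 2 ≤ 1 / 16 := (mul_le_mul_of_nonneg_left hσ hx).trans hxN
    have : 0 ≤ x * (N - 1) := mul_nonneg hx (by linarith)
    nlinarith
  have hbern : 1 - (N - 2) * x ≤ (1 - x) ^ (N - 2) := by
    have := one_add_mul_le_pow (a := -x) (by linarith) (N - 2)
    rw [Nat.cast_sub hN] at this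
    push_cast at this
    calc 1 - ((N : ℝ) - 2) * x = 1 + ((N : ℝ) - 2) * -x := by ring
      _ ≤ (1 + -x) ^ (N - 2) := this
      _ = (1 - x) ^ (N - 2) := by ring
  set E := x ^ 2 * (3 * (N * (N - 1)) + q ^ 2) with hE
  have hE0 : 0 ≤ E := by
    have : (0 : ℝ) ≤ N * (N - 1) := by nlinarith
    positivity
  have hNq : N * |q| ≤ ((N : ℝ) ^ 2 + q ^ 2) / 2 := by
    rw [← sq_abs q]; nlinarith [sq_nonneg ((N : ℝ) - |q|)]
  have hZ : 1 - (x * q + E) ≤ (1 - x) ^ (N - 2) * ((1 + x * (N - 1)) ^ 2 - x * σ ^ 2) := by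
    refine le_trans ?_ (mul_le_mul_of_nonneg_right hbern hbr)
    have e : (1 - ((N : ℝ) - 2) * x) * ((1 + x * (N - 1)) ^ 2 - x * σ ^ 2) =
        1 - x * q - ((N : ℝ) - 2) ^ 2 * x ^ 2 + (1 - ((N : ℝ) - 2) * x) * (x ^ 2 * (N - 1) ^ 2)
        + ((N : ℝ) - 2) * x ^ 2 * q := by rw [hq]; ring
    rw [e]
    have h1 : 0 ≤ (1 - ((N : ℝ) - 2) * x) * (x ^ 2 * (N - 1) ^ 2) := by
      refine mul_nonneg ?_ (by positivity)
      nlinarith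
    have h2 : -(x ^ 2 * (N * |q|)) ≤ ((N : ℝ) - 2) * x ^ 2 * q := by
      have h3 : -|q| ≤ q := neg_abs_le q
      have h4 : 0 ≤ ((N : ℝ) - 2) * x ^ 2 := mul_nonneg (by linarith) (sq_nonneg x)
      have h5 := mul_le_mul_of_nonneg_left h3 h4
      have h6 : 0 ≤ x ^ 2 * |q| := by positivity
      nlinarith
    have h7 := mul_le_mul_of_nonneg_left hNq (sq_nonneg x)
    have h8 : ((N : ℝ) - 2) ^ 2 * x ^ 2 ≤ x ^ 2 * (N : ℝ) ^ 2 := by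
      rw [mul_comm]
      refine mul_le_mul_of_nonneg_left ?_ (sq_nonneg x)
      nlinarith
    have h9 : x ^ 2 * (3 / 2 * (N : ℝ) ^ 2) ≤ x ^ 2 * (3 * (N * (N - 1))) := by
      refine mul_le_mul_of_nonneg_left ?_ (sq_nonneg x)
      nlinarith
    have h10 := mul_nonneg (sq_nonneg x) (sq_nonneg q)
    have h11 : x ^ 2 * (N * |q|) ≤ x ^ 2 * (N : ℝ) ^ 2 / 2 + x ^ 2 * q ^ 2 / 2 := by linarith
    have h12 : E = x ^ 2 * (3 * (N * (N - 1))) + x ^ 2 * q ^ 2 := by rw [hE]; ring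
    linarith
  have hxq : |x * q| ≤ 1 / 16 := by
    rw [abs_mul, abs_of_nonneg hx]
    exact (mul_le_mul_of_nonneg_left hqabs hx).trans hxN
  have hE1 : E ≤ 1 / 8 := by
    have h1 : (x * q) ^ 2 ≤ (1 / 16) ^ 2 := by
      rw [← sq_abs]; exact pow_le_pow_left₀ (abs_nonneg _) hxq 2
    have h2 : x ^ 2 * (3 * (N * (N - 1))) ≤ 3 * x * (x * (N : ℝ) ^ 2) := by
      have h4 : 0 ≤ x ^ 2 * N := by positivity
      have e1 : x ^ 2 * (3 * (N * (N - 1))) = 3 * x * (x * (N : ℝ) ^ 2) - 3 * (x ^ 2 * N) := by ring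
      linarith
    have h3 : 3 * x * (x * (N : ℝ) ^ 2) ≤ 3 * (1 / 64) * (1 / 16) := by gcongr
    have h12 : E = x ^ 2 * (3 * (N * (N - 1))) + (x * q) ^ 2 := by rw [hE]; ring
    rw [h12]
    norm_num at h1 h3 ⊢
    linarith
  have hy : x * q + E ≤ 1 / 2 := by linarith [le_abs_self (x * q)]
  have hpos : 0 < 1 - (x * q + E) := by linarith
  calc (√((1 - x) ^ (N - 2) * ((1 + x * (N - 1)) ^ 2 - x * σ ^ 2)))⁻¹
      ≤ (√(1 - (x * q + E)))⁻¹ :=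
        inv_anti₀ (Real.sqrt_pos.2 hpos) (Real.sqrt_le_sqrt hZ)
    _ ≤ 1 + (x * q + E) / 2 + (x * q + E) ^ 2 := inv_sqrt_one_sub_le hy
    _ ≤ 1 + (x * q + E) / 2 + (2 * (x * q) ^ 2 + 2 * E) := by
        have h1 : E ^ 2 ≤ E := by
          rw [pow_two]; exact mul_le_of_le_one_left hE0 (by linarith)
        have h2 : (x * q + E) ^ 2 = 2 * (x * q) ^ 2 + 2 * E ^ 2 - (x * q - E) ^ 2 := by ring
        linarith [sq_nonneg (x * q - E)]
    _ ≤ _ := by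
        have h1 : 0 ≤ x ^ 2 * (N * (N - 1)) := by
          have : (0 : ℝ) ≤ N * (N - 1) := by nlinarith
          positivity
        have h2 : 0 ≤ x ^ 2 * q ^ 2 := by positivity
        have e1 : 1 + (x * q + E) / 2 + (2 * (x * q) ^ 2 + 2 * E) = 1 + x * q / 2 +
            15 / 2 * (x ^ 2 * (N * (N - 1))) + 9 / 2 * (x ^ 2 * q ^ 2) := by rw [hE]; ring
        have e2 : 8 * x ^ 2 * (N * (N - 1) + q ^ 2) =
          8 * (x ^ 2 * (N * (N - 1))) + 8 * (x ^ 2 * q ^ 2) := by ring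
        rw [e1, e2]
        linarith

lemma prod_mehler {ι : Type*} (s : ℝ) (w : ι → ℝ) (A : Finset ι) (x y : ℝ) :
    ∏ i ∈ A, mehler s (w i) x y = ((√(1 - s ^ 2))⁻¹) ^ A.card *
      Real.exp ((s * (∑ i ∈ A, w i) * (x * y) - A.card * s ^ 2 * (x ^ 2 + y ^ 2) / 2) /
        (1 - s ^ 2)) := by
  unfold mehler
  rw [Finset.prod_mul_distrib, Finset.prod_const, ← Real.exp_sum]
  congr 2
  rw [← Finset.sum_div, Finset.sum_sub_distrib, Finset.sum_const, nsmul_eq_mul]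
  congr 2
  · rw [Finset.mul_sum, Finset.sum_mul]
  · ring

/-- The integral of a product of Mehler kernels over a block is an inverse square root of a
determinant, which is expanded to second order. -/
lemma lintegral_prod_mehler_le {ι : Type*} {s : ℝ} {w : ι → ℝ} (hw : ∀ i, w i ^ 2 = 1)
    (A : Finset ι) (hs : s ^ 2 * (A.card : ℝ) ^ 2 ≤ 1 / 16) (hs1 : s ^ 2 < 1) :
    ∫⁻ x, ∫⁻ y, ENNReal.ofReal (∏ i ∈ A, mehler s (w i) x y) ∂(gaussianReal 0 1)
      ∂(gaussianReal 0 1) ≤ ENNReal.ofReal (1 + s ^ 2 * ((∑ i ∈ A, w i) ^ 2 - A.card) / 2 +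
        8 * (s ^ 2) ^ 2 * (A.card * (A.card - 1) + ((∑ i ∈ A, w i) ^ 2 - A.card) ^ 2)) := by
  set N := A.card with hN
  set σ := ∑ i ∈ A, w i with hσ
  have hσN : σ ^ 2 ≤ (N : ℝ) ^ 2 := by
    have := Finset.sum_mul_sq_le_sq_mul_sq A (fun _ => (1 : ℝ)) w
    simp only [one_mul, one_pow, hw, Finset.sum_const, nsmul_eq_mul, mul_one, ← hN] at this
    rw [hσ]; linarith
  set z := 1 - s ^ 2 with hz
  have hz0 : 0 < z := by rw [hz]; linarith
  set κ := s ^ 2 / z with hκ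
  have hκ0 : 0 ≤ κ := by positivity
  have hP : 0 < 1 + κ * N := by positivity
  -- the determinant of the two-dimensional Gaussian integral
  have hdet : 0 < 1 + κ * N - s ^ 2 * σ ^ 2 / (z ^ 2 * (1 + κ * N)) := by
    rw [sub_pos, div_lt_iff₀ (by positivity)]
    have h1 : s ^ 2 * σ ^ 2 ≤ 1 / 16 :=
      (mul_le_mul_of_nonneg_left hσN (sq_nonneg s)).trans hs
    rcases Nat.eq_zero_or_pos N with h0 | hpos
    · have : σ ^ 2 ≤ 0 := by simpa [h0] using hσN
      have h2 : s ^ 2 * σ ^ 2 ≤ 0 := mul_nonpos_of_nonneg_of_nonpos (sq_nonneg s) this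
      exact lt_of_le_of_lt h2 (by positivity)
    · have hN1 : (1 : ℝ) ≤ N := by exact_mod_cast hpos
      have h3 : s ^ 2 ≤ 1 / 16 :=
        (le_mul_of_one_le_right (sq_nonneg s) (one_le_pow₀ hN1)).trans hs
      have h4 : 15 / 16 ≤ z := by rw [hz]; linarith
      have h5 : (1 : ℝ) ≤ 1 + κ * N := by
        have : 0 ≤ κ * N := by positivity
        linarith
      have h6 : (15 / 16 : ℝ) ^ 2 ≤ z ^ 2 := pow_le_pow_left₀ (by norm_num) h4 2
      have h7 : z ^ 2 * 1 ≤ (1 + κ * N) * (z ^ 2 * (1 + κ * N)) := by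
        calc z ^ 2 * 1 ≤ z ^ 2 * ((1 + κ * N) * (1 + κ * N)) :=
              mul_le_mul_of_nonneg_left (one_le_mul_of_one_le_of_one_le h5 h5) (sq_nonneg z)
          _ = _ := by ring
      norm_num at h6
      linarith
  have hinner : ∀ x, ∫⁻ y, ENNReal.ofReal (∏ i ∈ A, mehler s (w i) x y) ∂(gaussianReal 0 1) =
      ENNReal.ofReal (((√z)⁻¹) ^ N * (√(1 + κ * N))⁻¹) * ENNReal.ofReal (Real.exp
        (0 * x - ((κ * N - s ^ 2 * σ ^ 2 / (z ^ 2 * (1 + κ * N))) / 2) * x ^ 2)) := by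
    intro x
    have e : ∀ y, ENNReal.ofReal (∏ i ∈ A, mehler s (w i) x y) =
        ENNReal.ofReal (((√z)⁻¹) ^ N * Real.exp (-(κ * N / 2 * x ^ 2))) *
        ENNReal.ofReal (Real.exp ((s * σ * x / z) * y - (κ * N / 2) * y ^ 2)) := by
      intro y
      rw [← ENNReal.ofReal_mul (by positivity), mul_assoc, ← Real.exp_add, prod_mehler, ← hσ, ← hN,
        ← hz]
      congr 3
      rw [hκ]
      field_simp
      ring
    simp_rw [e]
    rw [lintegral_const_mul _ (by fun_prop), lintegral_exp_quadratic _ _ (by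
      rw [show 1 + 2 * (κ * N / 2) = 1 + κ * N by ring]; exact hP),
      ← ENNReal.ofReal_mul (by positivity), ← ENNReal.ofReal_mul (by positivity),
      show 1 + 2 * (κ * N / 2) = 1 + κ * N by ring]
    congr 1
    rw [mul_mul_mul_comm, ← Real.exp_add]
    congr 2
    field_simp
    ring
  simp_rw [hinner]
  have hw' : 1 + 2 * ((κ * N - s ^ 2 * σ ^ 2 / (z ^ 2 * (1 + κ * N))) / 2) =
      1 + κ * N - s ^ 2 * σ ^ 2 / (z ^ 2 * (1 + κ * N)) := by ring
  rw [lintegral_const_mul _ (by fun_prop), lintegral_exp_quadratic _ _ (by rw [hw']; exact hdet),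
    hw', ← ENNReal.ofReal_mul (by positivity)]
  refine ENNReal.ofReal_le_ofReal ?_
  rw [zero_pow two_ne_zero, zero_div, Real.exp_zero, mul_one]
  have hcomb : ((√z)⁻¹) ^ N * (√(1 + κ * N))⁻¹ *
      (√(1 + κ * N - s ^ 2 * σ ^ 2 / (z ^ 2 * (1 + κ * N))))⁻¹ =
      (√(z ^ N * ((1 + κ * N) * (1 + κ * N - s ^ 2 * σ ^ 2 / (z ^ 2 * (1 + κ * N))))))⁻¹ := by
    rw [Real.sqrt_mul (by positivity), Real.sqrt_mul hP.le, mul_inv, mul_inv, inv_pow, mul_assoc]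
    congr 2
    rw [Real.sqrt_eq_rpow, Real.sqrt_eq_rpow, ← Real.rpow_natCast, ← Real.rpow_natCast,
      ← Real.rpow_mul hz0.le, ← Real.rpow_mul hz0.le, mul_comm]
  rw [hcomb]
  have hprod : (1 + κ * N) * (1 + κ * N - s ^ 2 * σ ^ 2 / (z ^ 2 * (1 + κ * N))) =
      (1 + κ * N) ^ 2 - s ^ 2 * σ ^ 2 / z ^ 2 := by field_simp
  rw [hprod]
  rcases Nat.lt_or_ge N 2 with hlt | hge
  · have hσ2 : σ ^ 2 = N ∧ (N : ℝ) * (N - 1) = 0 := by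
      interval_cases h : N
      · have hA : A = ∅ := Finset.card_eq_zero.1 h
        simp [hσ, hA]
      · obtain ⟨i, hi⟩ := Finset.card_eq_one.1 h
        simp [hσ, hi, hw]
    rw [hσ2.1, hσ2.2]
    have : z ^ N * ((1 + κ * N) ^ 2 - s ^ 2 * N / z ^ 2) = 1 := by
      have hs2 : s ^ 2 = 1 - z := by rw [hz]; ring
      interval_cases h : N
      · simp
      · rw [hκ, hs2]; field_simp; push_cast; ring
    rw [this]; simp
  · have h2 : z ^ N * ((1 + κ * N) ^ 2 - s ^ 2 * σ ^ 2 / z ^ 2) =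
        (1 - s ^ 2) ^ (N - 2) * ((1 + s ^ 2 * (N - 1)) ^ 2 - s ^ 2 * σ ^ 2) := by
      have h3 : z ^ N = z ^ (N - 2) * z ^ 2 := by rw [← pow_add]; congr 1; omega
      have h4 : 1 + s ^ 2 * (N - 1) = z + s ^ 2 * N := by rw [hz]; ring
      rw [h3, h4, hκ]
      field_simp
      ring
    rw [h2]
    exact inv_sqrt_det_le (sq_nonneg s) hs hge hσN

end BlockIntegral

/-! ### Averaging over the missing coordinates -/

section RandomSubset

variable {ι : Type*} [DecidableEq ι]

/-- The expectation of `f A`, for a random subset `A` of `B` that contains every element of `B`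
with probability `a`, independently of the others. -/
def thin (a : ℝ) (B : Finset ι) (f : Finset ι → ℝ) : ℝ :=
  ∑ A ∈ B.powerset, a ^ A.card * (1 - a) ^ (B \ A).card * f A

lemma thin_subset (a : ℝ) {B I : Finset ι} (hI : I ⊆ B) :
    thin a B (fun A => if I ⊆ A then 1 else 0) = a ^ I.card := by
  have h := Finset.prod_add (fun _ : ι => a) (fun i => if i ∈ I then 0 else 1 - a) B
  have h1 : ∏ i ∈ B, (a + if i ∈ I then 0 else 1 - a) = a ^ I.card := by
    have : ∀ i ∈ B, (a + if i ∈ I then 0 else 1 - a) = if i ∈ I then a else 1 := by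
      intro i _; split_ifs <;> ring
    rw [Finset.prod_congr rfl this, Finset.prod_ite_mem, Finset.inter_eq_right.2 hI,
      Finset.prod_const]
  rw [← h1, h, thin]
  refine Finset.sum_congr rfl fun A _ => ?_
  rw [Finset.prod_const, mul_assoc]
  congr 1
  by_cases hIA : I ⊆ A
  · rw [if_pos hIA, mul_one, ← Finset.prod_const]
    refine Finset.prod_congr rfl fun i hi => ?_
    rw [if_neg fun hiI => (Finset.mem_sdiff.1 hi).2 (hIA hiI)]
  · rw [if_neg hIA, mul_zero]
    obtain ⟨i, hiI, hiA⟩ := Finset.not_subset.1 hIA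
    exact (Finset.prod_eq_zero (Finset.mem_sdiff.2 ⟨hI hiI, hiA⟩) (by simp [hiI])).symm

lemma thin_one (a : ℝ) (B : Finset ι) : thin a B (fun _ => 1) = 1 := by
  simpa using thin_subset a (Finset.empty_subset B)

lemma thin_add (a : ℝ) (B : Finset ι) (f g : Finset ι → ℝ) :
    thin a B (fun A => f A + g A) = thin a B f + thin a B g := by
  simp [thin, mul_add, Finset.sum_add_distrib]

lemma thin_const_mul (a c : ℝ) (B : Finset ι) (f : Finset ι → ℝ) :
    thin a B (fun A => c * f A) = c * thin a B f := by
  simp only [thin, Finset.mul_sum]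
  exact Finset.sum_congr rfl fun A _ => by ring

lemma thin_sum {κ : Type*} (a : ℝ) (B : Finset ι) (s : Finset κ) (f : κ → Finset ι → ℝ) :
    thin a B (fun A => ∑ x ∈ s, f x A) = ∑ x ∈ s, thin a B (f x) := by
  simp only [thin, Finset.mul_sum]
  exact Finset.sum_comm

lemma thin_congr (a : ℝ) {B : Finset ι} {f g : Finset ι → ℝ} (h : ∀ A ⊆ B, f A = g A) :
    thin a B f = thin a B g :=
  Finset.sum_congr rfl fun A hA => by rw [h A (Finset.mem_powerset.1 hA)]

lemma offDiag_eq_filter {A B : Finset ι} (h : A ⊆ B) :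
    A.offDiag = B.offDiag.filter fun x => {x.1, x.2} ⊆ A := by
  ext x
  simp only [Finset.mem_offDiag, Finset.mem_filter, Finset.insert_subset_iff,
    Finset.singleton_subset_iff]
  constructor
  · rintro ⟨h1, h2, h3⟩; exact ⟨⟨h h1, h h2, h3⟩, h1, h2⟩
  · rintro ⟨⟨_, _, h3⟩, h1, h2⟩; exact ⟨h1, h2, h3⟩

lemma pair_subset_of_mem_offDiag {B : Finset ι} {x : ι × ι} (hx : x ∈ B.offDiag) :
    {x.1, x.2} ⊆ B := by
  rw [Finset.mem_offDiag] at hx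
  simp [Finset.insert_subset_iff, hx.1, hx.2.1]

lemma thin_sum_offDiag (a : ℝ) (B : Finset ι) (g : ι × ι → ℝ) :
    thin a B (fun A => ∑ x ∈ A.offDiag, g x) = a ^ 2 * ∑ x ∈ B.offDiag, g x := by
  have h : ∀ A ⊆ B, ∑ x ∈ A.offDiag, g x =
      ∑ x ∈ B.offDiag, g x * if {x.1, x.2} ⊆ A then 1 else 0 := by
    intro A hA
    rw [offDiag_eq_filter hA, Finset.sum_filter]
    simp
  rw [thin_congr a h, thin_sum, Finset.mul_sum]
  refine Finset.sum_congr rfl fun x hx => ?_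
  rw [thin_const_mul, thin_subset a (pair_subset_of_mem_offDiag hx),
    Finset.card_pair (Finset.mem_offDiag.1 hx).2.2, mul_comm]

lemma thin_sum_offDiag_sq (a : ℝ) (B : Finset ι) (g : ι × ι → ℝ) :
    thin a B (fun A => (∑ x ∈ A.offDiag, g x) ^ 2) =
      ∑ x ∈ B.offDiag, ∑ y ∈ B.offDiag,
        g x * g y * a ^ (({x.1, x.2} ∪ {y.1, y.2} : Finset ι)).card := by
  have h : ∀ A ⊆ B, (∑ x ∈ A.offDiag, g x) ^ 2 = ∑ x ∈ B.offDiag, ∑ y ∈ B.offDiag,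
      g x * g y * if ({x.1, x.2} ∪ {y.1, y.2} : Finset ι) ⊆ A then 1 else 0 := by
    intro A hA
    rw [offDiag_eq_filter hA, Finset.sum_filter, pow_two, Finset.sum_mul_sum]
    refine Finset.sum_congr rfl fun x _ => Finset.sum_congr rfl fun y _ => ?_
    by_cases h1 : {x.1, x.2} ⊆ A <;> by_cases h2 : {y.1, y.2} ⊆ A <;>
      simp only [Finset.union_subset_iff, h1, h2] <;> simp
  rw [thin_congr a h, thin_sum]
  refine Finset.sum_congr rfl fun x hx => ?_
  rw [thin_sum]
  refine Finset.sum_congr rfl fun y hy => ?_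
  rw [thin_const_mul, thin_subset a (Finset.union_subset (pair_subset_of_mem_offDiag hx)
    (pair_subset_of_mem_offDiag hy))]

/-- The overlap of two pairs decides the size of their union. -/
lemma pow_card_union_le {a : ℝ} (ha0 : 0 ≤ a) {x y : ι × ι} (hx : x.1 ≠ x.2)
    (hy : y.1 ≠ y.2) :
    a ^ (({x.1, x.2} ∪ {y.1, y.2} : Finset ι)).card ≤ a ^ 4 +
      (a ^ 2 * ((if y = x then 1 else 0) + (if y = x.swap then 1 else 0)) +
      a ^ 3 * ((if y.1 = x.1 then 1 else 0) + (if y.1 = x.2 then 1 else 0) +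
        (if y.2 = x.1 then 1 else 0) + (if y.2 = x.2 then 1 else 0))) := by
  obtain ⟨i, j⟩ := x
  obtain ⟨k, l⟩ := y
  simp only [ne_eq, Prod.swap_prod_mk, Prod.mk.injEq] at *
  have h2 := pow_nonneg ha0 2
  have h3 := pow_nonneg ha0 3
  have h4 := pow_nonneg ha0 4
  have hc : ({i, j} ∪ {k, l} : Finset ι) = {i, j, k, l} := by ext; simp; tauto
  rw [hc]
  by_cases e1 : k = i
  · subst e1
    by_cases e2 : l = j
    · subst e2
      have : ({k, l, k, l} : Finset ι) = {k, l} := by ext; simp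
      rw [this, Finset.card_pair hx]
      simp [hx, Ne.symm hx]; nlinarith
    · have : ({k, j, k, l} : Finset ι) = {k, j, l} := by ext; simp; tauto
      rw [this, Finset.card_eq_three.2 ⟨k, j, l, hx, hy, Ne.symm e2, rfl⟩]
      simp [hx, e2, Ne.symm hy]; nlinarith
  · by_cases e2 : k = j
    · subst e2
      by_cases e3 : l = i
      · subst e3
        have : ({l, k, k, l} : Finset ι) = {l, k} := by ext; simp; tauto
        rw [this, Finset.card_pair hx]
        simp [hx, hy]; nlinarith
      · have : ({i, k, k, l} : Finset ι) = {i, k, l} := by ext; simp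
        rw [this, Finset.card_eq_three.2 ⟨i, k, l, hx, Ne.symm e3, hy, rfl⟩]
        simp [e1, e3, Ne.symm hy]; nlinarith
    · by_cases e3 : l = i
      · subst e3
        have : ({l, j, k, l} : Finset ι) = {l, j, k} := by ext; simp; tauto
        rw [this, Finset.card_eq_three.2 ⟨l, j, k, hx, Ne.symm e1, Ne.symm e2, rfl⟩]
        simp [hx, e1, e2]; nlinarith
      · by_cases e4 : l = j
        · subst e4
          have : ({i, l, k, l} : Finset ι) = {i, l, k} := by ext; simp; tauto
          rw [this, Finset.card_eq_three.2 ⟨i, l, k, hx, Ne.symm e1, Ne.symm e2, rfl⟩]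
          simp [e1, e2, e3]; nlinarith
        · have : ({i, j, k, l} : Finset ι).card = 4 := by
            rw [Finset.card_insert_of_notMem (by simp [hx, Ne.symm e1, Ne.symm e3]),
              Finset.card_eq_three.2 ⟨j, k, l, Ne.symm e2, Ne.symm e4, hy, rfl⟩]
          rw [this]; simp [e1, e2, e3, e4]

lemma card_filter_fst_le (B : Finset ι) (c : ι) :
    (B.offDiag.filter fun y => y.1 = c).card ≤ B.card := by
  refine Finset.card_le_card_of_injOn Prod.snd (fun y hy => ?_) fun y hy z hz h => ?_
  · exact (Finset.mem_offDiag.1 (Finset.mem_filter.1 hy).1).2.1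
  · exact Prod.ext ((Finset.mem_filter.1 hy).2.trans (Finset.mem_filter.1 hz).2.symm) h

lemma card_filter_snd_le (B : Finset ι) (c : ι) :
    (B.offDiag.filter fun y => y.2 = c).card ≤ B.card := by
  refine Finset.card_le_card_of_injOn Prod.fst (fun y hy => ?_) fun y hy z hz h => ?_
  · exact (Finset.mem_offDiag.1 (Finset.mem_filter.1 hy).1).1
  · exact Prod.ext h ((Finset.mem_filter.1 hy).2.trans (Finset.mem_filter.1 hz).2.symm)

lemma thin_sum_offDiag_sq_le {a : ℝ} (ha0 : 0 ≤ a) (ha1 : a ≤ 1) (B : Finset ι) {g : ι × ι → ℝ}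
    (hg : ∀ x, |g x| = 1) :
    thin a B (fun A => (∑ x ∈ A.offDiag, g x) ^ 2) ≤ a ^ 4 * (∑ x ∈ B.offDiag, g x) ^ 2 +
      (2 * a ^ 2 * (B.card : ℝ) ^ 2 + 4 * a ^ 3 * (B.card : ℝ) ^ 3) := by
  rw [thin_sum_offDiag_sq, pow_two (∑ x ∈ B.offDiag, g x), Finset.sum_mul_sum, Finset.mul_sum]
  have hcard : ((B.offDiag).card : ℝ) ≤ (B.card : ℝ) ^ 2 := by
    rw [Finset.offDiag_card, pow_two]
    exact_mod_cast Nat.sub_le _ _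
  have key : ∀ x ∈ B.offDiag, ∑ y ∈ B.offDiag,
      g x * g y * a ^ (({x.1, x.2} ∪ {y.1, y.2} : Finset ι)).card ≤
      a ^ 4 * ∑ y ∈ B.offDiag, g x * g y + (2 * a ^ 2 + 4 * a ^ 3 * B.card) := by
    intro x hx
    have h1 : ∀ y ∈ B.offDiag, g x * g y * a ^ (({x.1, x.2} ∪ {y.1, y.2} : Finset ι)).card ≤
        a ^ 4 * (g x * g y) +
        (a ^ 2 * ((if y = x then 1 else 0) + (if y = x.swap then 1 else 0)) +
        a ^ 3 * ((if y.1 = x.1 then 1 else 0) + (if y.1 = x.2 then 1 else 0) +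
        (if y.2 = x.1 then 1 else 0) + (if y.2 = x.2 then 1 else 0))) := by
      intro y hy
      have h2 := pow_card_union_le ha0 (Finset.mem_offDiag.1 hx).2.2
        (Finset.mem_offDiag.1 hy).2.2
      have h3 : a ^ 4 ≤ a ^ (({x.1, x.2} ∪ {y.1, y.2} : Finset ι)).card := by
        refine pow_le_pow_of_le_one ha0 ha1 ((Finset.card_union_le _ _).trans ?_)
        have := Finset.card_le_two (a := x.1) (b := x.2)
        have := Finset.card_le_two (a := y.1) (b := y.2)
        omega
      have h4 : g x * g y ≤ 1 := by
        calc g x * g y ≤ |g x * g y| := le_abs_self _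
          _ = 1 := by rw [abs_mul, hg, hg, one_mul]
      have h5 := mul_le_mul_of_nonneg_right h4 (sub_nonneg.2 h3)
      linarith
    refine (Finset.sum_le_sum h1).trans ?_
    rw [Finset.sum_add_distrib, ← Finset.mul_sum, Finset.sum_add_distrib, ← Finset.mul_sum,
      ← Finset.mul_sum]
    rw [Finset.sum_add_distrib, ← Finset.mul_sum, Finset.sum_add_distrib, Finset.sum_add_distrib,
      Finset.sum_add_distrib]
    have hx' : ∀ z : ι × ι, ∑ y ∈ B.offDiag, (if y = z then (1 : ℝ) else 0) ≤ 1 := by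
      intro z; rw [Finset.sum_ite_eq']; split_ifs <;> norm_num
    have hf : ∀ c, ∑ y ∈ B.offDiag, (if y.1 = c then (1 : ℝ) else 0) ≤ B.card := by
      intro c; rw [Finset.sum_boole]; exact_mod_cast card_filter_fst_le B c
    have hs : ∀ c, ∑ y ∈ B.offDiag, (if y.2 = c then (1 : ℝ) else 0) ≤ B.card := by
      intro c; rw [Finset.sum_boole]; exact_mod_cast card_filter_snd_le B c
    have h6 := mul_le_mul_of_nonneg_left (add_le_add (hx' x) (hx' x.swap)) (pow_nonneg ha0 2)
    have h7 := mul_le_mul_of_nonneg_left (add_le_add (add_le_add (add_le_add (hf x.1) (hf x.2))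
      (hs x.1)) (hs x.2)) (pow_nonneg ha0 3)
    linarith
  refine (Finset.sum_le_sum key).trans ?_
  rw [Finset.sum_add_distrib, ← Finset.mul_sum, Finset.sum_const, nsmul_eq_mul]
  have h8 : ((B.offDiag).card : ℝ) * (2 * a ^ 2 + 4 * a ^ 3 * B.card) ≤
      (B.card : ℝ) ^ 2 * (2 * a ^ 2 + 4 * a ^ 3 * B.card) :=
    mul_le_mul_of_nonneg_right hcard (by positivity)
  linarith

lemma sq_sum_sub_card {w : ι → ℝ} (hw : ∀ i, w i ^ 2 = 1) (A : Finset ι) :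
    (∑ i ∈ A, w i) ^ 2 - A.card = ∑ x ∈ A.offDiag, w x.1 * w x.2 := by
  rw [pow_two, Finset.sum_mul_sum, ← Finset.sum_product', ← Finset.diag_union_offDiag A,
    Finset.sum_union (Finset.disjoint_diag_offDiag A), Finset.sum_diag]
  simp_rw [← pow_two, hw]
  simp

lemma measurable_mehler (s w : ℝ) : Measurable fun q : ℝ × ℝ => mehler s w q.1 q.2 := by
  unfold mehler
  fun_prop

lemma lintegral_prod_thinned_eq {μ : Measure ℝ} [SFinite μ] {a : ℝ} (ha0 : 0 ≤ a) (ha1 : a ≤ 1)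
    {K : ι → ℝ → ℝ → ℝ} (hK : ∀ i x y, 0 ≤ K i x y)
    (hKm : ∀ i, Measurable fun q : ℝ × ℝ => K i q.1 q.2) (B : Finset ι) :
    ∫⁻ x, ∫⁻ y, ∏ i ∈ B, ENNReal.ofReal (a * K i x y + (1 - a)) ∂μ ∂μ =
      ∑ A ∈ B.powerset, ENNReal.ofReal (a ^ A.card * (1 - a) ^ (B \ A).card) *
        ∫⁻ x, ∫⁻ y, ENNReal.ofReal (∏ i ∈ A, K i x y) ∂μ ∂μ := by
  have hmeas : ∀ A : Finset ι, Measurable fun q : ℝ × ℝ =>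
      ENNReal.ofReal (∏ i ∈ A, K i q.1 q.2) := fun A =>
    (Finset.measurable_prod A fun i _ => hKm i).ennreal_ofReal
  have hexp : ∀ x y, ∏ i ∈ B, ENNReal.ofReal (a * K i x y + (1 - a)) =
      ∑ A ∈ B.powerset, ENNReal.ofReal (a ^ A.card * (1 - a) ^ (B \ A).card) *
        ENNReal.ofReal (∏ i ∈ A, K i x y) := by
    intro x y
    have h0 : ∀ i, 0 ≤ a * K i x y := fun i => mul_nonneg ha0 (hK i x y)
    rw [← ENNReal.ofReal_prod_of_nonneg fun i _ => add_nonneg (h0 i) (by linarith),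
      Finset.prod_add, ENNReal.ofReal_sum_of_nonneg fun A _ =>
        mul_nonneg (Finset.prod_nonneg fun i _ => h0 i) (Finset.prod_nonneg fun i _ => by linarith)]
    refine Finset.sum_congr rfl fun A _ => ?_
    have h1 : 0 ≤ 1 - a := by linarith
    rw [← ENNReal.ofReal_mul (by positivity), Finset.prod_mul_distrib, Finset.prod_const,
      Finset.prod_const]
    congr 1
    ring
  simp_rw [hexp]
  have h1 : ∀ x, ∫⁻ y, ∑ A ∈ B.powerset,
      ENNReal.ofReal (a ^ A.card * (1 - a) ^ (B \ A).card) *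
      ENNReal.ofReal (∏ i ∈ A, K i x y) ∂μ =
      ∑ A ∈ B.powerset, ENNReal.ofReal (a ^ A.card * (1 - a) ^ (B \ A).card) *
      ∫⁻ y, ENNReal.ofReal (∏ i ∈ A, K i x y) ∂μ := by
    intro x
    have hm : ∀ A, Measurable fun y => ENNReal.ofReal (∏ i ∈ A, K i x y) :=
      fun A => (hmeas A).comp measurable_prodMk_left
    rw [lintegral_finsetSum _ fun A _ => (hm A).const_mul _]
    exact Finset.sum_congr rfl fun A _ => lintegral_const_mul _ (hm A)
  simp_rw [h1]
  have hm : ∀ A, Measurable fun x => ∫⁻ y, ENNReal.ofReal (∏ i ∈ A, K i x y) ∂μ :=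
    fun A => (hmeas A).lintegral_prod_right'
  rw [lintegral_finsetSum _ fun A _ => (hm A).const_mul _]
  exact Finset.sum_congr rfl fun A _ => lintegral_const_mul _ (hm A)

/-- The second-order expansion of a block, averaged over its observed coordinates. -/
lemma thin_expansion_le {a x : ℝ} (ha0 : 0 ≤ a) (ha1 : a ≤ 1) {w : ι → ℝ}
    (hw : ∀ i, w i ^ 2 = 1) (B : Finset ι) :
    thin a B (fun A => 1 + x * ((∑ i ∈ A, w i) ^ 2 - A.card) / 2 +
        8 * x ^ 2 * (A.card * (A.card - 1) + ((∑ i ∈ A, w i) ^ 2 - A.card) ^ 2)) ≤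
      1 + (x * a ^ 2 / 2 * ((∑ i ∈ B, w i) ^ 2 - B.card) +
        8 * x ^ 2 * (4 * a ^ 2 * (B.card : ℝ) ^ 2 + 4 * a ^ 3 * (B.card : ℝ) ^ 3 +
          a ^ 4 * (B.card : ℝ) ^ 2 * (∑ i ∈ B, w i) ^ 2)) := by
  have habs : ∀ i, |w i| = 1 := fun i => by
    rw [← abs_one]; exact (sq_eq_sq_iff_abs_eq_abs _ _).1 (by rw [hw, one_pow])
  have hq : ∀ x : ι × ι, |w x.1 * w x.2| = 1 := fun x => by rw [abs_mul, habs, habs, one_mul]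
  have hone : ∀ A : Finset ι, (A.card : ℝ) * (A.card - 1) = ∑ x ∈ A.offDiag, 1 := by
    intro A
    have := sq_sum_sub_card (w := fun _ : ι => (1 : ℝ)) (fun _ => one_pow 2) A
    simp only [Finset.sum_const, nsmul_eq_mul, mul_one] at this ⊢
    linarith
  have hN : (0 : ℝ) ≤ B.card := Nat.cast_nonneg _
  have h1 : (fun A : Finset ι => 1 + x * ((∑ i ∈ A, w i) ^ 2 - A.card) / 2 +
        8 * x ^ 2 * (A.card * (A.card - 1) + ((∑ i ∈ A, w i) ^ 2 - A.card) ^ 2)) =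
      fun A => 1 + (x / 2 * (∑ y ∈ A.offDiag, w y.1 * w y.2) + (8 * x ^ 2 * (∑ y ∈ A.offDiag, 1) +
        8 * x ^ 2 * (∑ y ∈ A.offDiag, w y.1 * w y.2) ^ 2)) := by
    funext A
    rw [hone, sq_sum_sub_card hw]; ring
  have h2 := thin_sum_offDiag_sq_le ha0 ha1 B (g := fun y => w y.1 * w y.2) hq
  rw [h1, thin_add a B (fun _ => 1), thin_one, thin_add a B (fun A => x / 2 * _), thin_const_mul,
    thin_sum_offDiag, thin_add a B (fun A => 8 * x ^ 2 * ∑ y ∈ A.offDiag, 1), thin_const_mul,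
    thin_sum_offDiag, thin_const_mul, ← hone]
  rw [← sq_sum_sub_card hw] at h2 ⊢
  set N : ℝ := (B.card : ℝ)
  set S := (∑ i ∈ B, w i) ^ 2 with hS
  have hSN : S ≤ N ^ 2 := by
    have := Finset.sum_mul_sq_le_sq_mul_sq B (fun _ => (1 : ℝ)) w
    simp only [one_mul, one_pow, hw, Finset.sum_const, nsmul_eq_mul, mul_one] at this
    rw [hS, pow_two N]; exact this.trans_eq rfl
  have hS0 : 0 ≤ S := sq_nonneg _
  have ha4 : a ^ 4 ≤ a ^ 2 := pow_le_pow_of_le_one ha0 ha1 (by norm_num)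
  have h3 : a ^ 4 * (S - N) ^ 2 ≤ a ^ 4 * N ^ 2 * S + a ^ 2 * N ^ 2 := by
    have e1 : (S - N) ^ 2 ≤ N ^ 2 * S + N ^ 2 := by nlinarith
    calc a ^ 4 * (S - N) ^ 2 ≤ a ^ 4 * (N ^ 2 * S + N ^ 2) :=
          mul_le_mul_of_nonneg_left e1 (by positivity)
      _ = a ^ 4 * N ^ 2 * S + a ^ 4 * N ^ 2 := by ring
      _ ≤ _ := by gcongr
  have h4 : a ^ 2 * (N * (N - 1)) ≤ a ^ 2 * N ^ 2 :=
    mul_le_mul_of_nonneg_left (by nlinarith) (sq_nonneg a)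
  have h5 := mul_le_mul_of_nonneg_left (add_le_add h4 h2) (by positivity : 0 ≤ 8 * x ^ 2)
  have h6 := mul_le_mul_of_nonneg_left h3 (by positivity : 0 ≤ 8 * x ^ 2)
  linarith

/-- The chi-square contribution of one block. -/
lemma lintegral_prod_thinned_mehler_le {a s : ℝ} (ha0 : 0 ≤ a) (ha1 : a ≤ 1) {w : ι → ℝ}
    (hw : ∀ i, w i ^ 2 = 1) (B : Finset ι) (hs : s ^ 2 * (B.card : ℝ) ^ 2 ≤ 1 / 16)
    (hs1 : s ^ 2 < 1) :
    ∫⁻ x, ∫⁻ y, ∏ i ∈ B, ENNReal.ofReal (a * mehler s (w i) x y + (1 - a)) ∂(gaussianReal 0 1)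
      ∂(gaussianReal 0 1) ≤
      ENNReal.ofReal (Real.exp (s ^ 2 * a ^ 2 / 2 * ((∑ i ∈ B, w i) ^ 2 - B.card) +
        8 * (s ^ 2) ^ 2 * (4 * a ^ 2 * (B.card : ℝ) ^ 2 + 4 * a ^ 3 * (B.card : ℝ) ^ 3 +
          a ^ 4 * (B.card : ℝ) ^ 2 * (∑ i ∈ B, w i) ^ 2))) := by
  rw [lintegral_prod_thinned_eq ha0 ha1 (fun i => mehler_nonneg s (w i))
    (fun i => measurable_mehler s (w i)) B]
  set F : Finset ι → ℝ := fun A => 1 + s ^ 2 * ((∑ i ∈ A, w i) ^ 2 - A.card) / 2 +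
        8 * (s ^ 2) ^ 2 * (A.card * (A.card - 1) + ((∑ i ∈ A, w i) ^ 2 - A.card) ^ 2) with hF
  have h1a : 0 ≤ 1 - a := by linarith
  have hA : ∀ A ∈ B.powerset, s ^ 2 * (A.card : ℝ) ^ 2 ≤ 1 / 16 := by
    intro A hA
    have hc : (A.card : ℝ) ≤ B.card := by
      exact_mod_cast Finset.card_le_card (Finset.mem_powerset.1 hA)
    exact le_trans (by gcongr) hs
  have hcc : ∀ A : Finset ι, (0 : ℝ) ≤ A.card * (A.card - 1) := by
    intro A
    rcases Nat.eq_zero_or_pos A.card with h | h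
    · simp [h]
    · have : (1 : ℝ) ≤ A.card := by exact_mod_cast h
      exact mul_nonneg (by linarith) (by linarith)
  have hF0 : ∀ A ∈ B.powerset, 0 ≤ F A := by
    intro A hAB
    have h1 := hA A hAB
    have h2 := hcc A
    have h3 : s ^ 2 * (A.card : ℝ) ≤ s ^ 2 * (A.card : ℝ) ^ 2 :=
      mul_le_mul_of_nonneg_left (by linarith) (sq_nonneg s)
    have h4 : 0 ≤ s ^ 2 * (∑ i ∈ A, w i) ^ 2 := by positivity
    have h5 : 0 ≤ 8 * (s ^ 2) ^ 2 * ((A.card : ℝ) * (A.card - 1) +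
        ((∑ i ∈ A, w i) ^ 2 - A.card) ^ 2) :=
      mul_nonneg (by positivity) (add_nonneg h2 (sq_nonneg _))
    rw [hF]
    linarith
  calc _ ≤ ∑ A ∈ B.powerset, ENNReal.ofReal (a ^ A.card * (1 - a) ^ (B \ A).card * F A) := by
        refine Finset.sum_le_sum fun A hAB => ?_
        rw [ENNReal.ofReal_mul (q := F A) (by positivity)]
        exact mul_le_mul_right (lintegral_prod_mehler_le hw A (hA A hAB) hs1) _
    _ = ENNReal.ofReal (thin a B F) :=
        (ENNReal.ofReal_sum_of_nonneg fun A hAB =>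
          mul_nonneg (by positivity) (hF0 A hAB)).symm
    _ ≤ _ := by
        refine ENNReal.ofReal_le_ofReal ((thin_expansion_le ha0 ha1 hw B).trans ?_)
        rw [add_comm]
        exact Real.add_one_le_exp _

end RandomSubset

/-! ### The chi-square divergence of the prior -/

section ChiSquare

variable {p : ℕ}

/-- The sum of the signs `w i` over the block `c`. -/
noncomputable def blockSum (b : Fin p → Fin p) (w : Fin p → ℤˣ) (c : Fin p) : ℝ :=
  ∑ i with b i = c, sgn (w i)

lemma sum_card_fiber (b : Fin p → Fin p) :
    ∑ c, ((Finset.univ.filter fun i => b i = c).card : ℝ) = p := by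
  have := Finset.card_eq_sum_card_fiberwise (s := Finset.univ) (t := Finset.univ) (f := b)
    (fun _ _ => Finset.mem_coe.2 (Finset.mem_univ _))
  rw [Finset.card_univ, Fintype.card_fin] at this
  exact_mod_cast this.symm

lemma lintegral_lintegral_pi_prod (μ : Measure ℝ) [IsProbabilityMeasure μ]
    {G : Fin p → ℝ → ℝ → ℝ≥0∞} (hG : ∀ c, Measurable fun q : ℝ × ℝ => G c q.1 q.2) :
    ∫⁻ x : Fin p → ℝ, ∫⁻ y : Fin p → ℝ, ∏ c, G c (x c) (y c) ∂(Measure.pi fun _ => μ)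
      ∂(Measure.pi fun _ => μ) = ∏ c, ∫⁻ x, ∫⁻ y, G c x y ∂μ ∂μ := by
  rw [← lintegral_pi_prod (fun _ : Fin p => μ) fun c => (hG c).lintegral_prod_right']
  refine lintegral_congr fun x => ?_
  exact lintegral_pi_prod (fun _ : Fin p => μ) (f := fun c y => G c (x c) y)
    fun c => (hG c).comp (measurable_prodMk_left (x := x c))

/-- The inner product of the likelihood ratios of one observation, in terms of the squared block
sums of the signs `u v`. -/
lemma lintegral_obsDensity_mul_le (a : unitInterval) {s T : ℝ} (hs0 : 0 ≤ s) (hs : s < 1)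
    (b : Fin p → Fin p) (hb : ∀ c, ((Finset.univ.filter fun i => b i = c).card : ℝ) ≤ T)
    (hT : s ^ 2 * T ^ 2 ≤ 1 / 16) (u v : Fin p → ℤˣ) :
    ∫⁻ y, obsDensity s b u y * obsDensity s b v y ∂(obsLaw a (1 : Matrix (Fin p) (Fin p) ℝ)) ≤
      ENNReal.ofReal (Real.exp (
        (s ^ 2 * (a : ℝ) ^ 2 / 2 + 8 * (s ^ 2) ^ 2 * ((a : ℝ) ^ 4 * T ^ 2)) *
          ∑ c, blockSum b (u * v) c ^ 2 -
        (s ^ 2 * (a : ℝ) ^ 2 / 2 - 32 * (s ^ 2) ^ 2 * ((a : ℝ) ^ 2 * T + (a : ℝ) ^ 3 * T ^ 2)) *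
          p)) := by
  have ha0 := a.2.1
  have ha1 := a.2.2
  set K : Fin p → ℝ → ℝ → ℝ≥0∞ := fun i x y =>
    ENNReal.ofReal (a * mehler s (sgn (u i * v i)) x y + (1 - a)) with hK
  have hKm : ∀ i, Measurable fun q : ℝ × ℝ => K i q.1 q.2 := fun i =>
    (((measurable_mehler s _).const_mul _).add_const _).ennreal_ofReal
  have hGm : ∀ c, Measurable fun q : ℝ × ℝ => ∏ i with b i = c, K i q.1 q.2 := fun c =>
    Finset.measurable_prod _ fun i _ => hKm i
  have hfib : ∀ x y : Fin p → ℝ, ∏ i, K i (x (b i)) (y (b i)) =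
      ∏ c, ∏ i with b i = c, K i (x c) (y c) := by
    intro x y
    rw [← Finset.prod_fiberwise Finset.univ b]
    refine Finset.prod_congr rfl fun c _ => Finset.prod_congr rfl fun i hi => ?_
    rw [(Finset.mem_filter.1 hi).2]
  have hfac : ∫⁻ x : Fin p → ℝ, ∫⁻ y : Fin p → ℝ, ∏ i, K i (x (b i)) (y (b i))
        ∂(Measure.pi fun _ => gaussianReal 0 1) ∂(Measure.pi fun _ => gaussianReal 0 1) =
      ∏ c, ∫⁻ x, ∫⁻ y, ∏ i with b i = c, K i x y ∂(gaussianReal 0 1) ∂(gaussianReal 0 1) := by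
    simp_rw [hfib]
    exact lintegral_lintegral_pi_prod (gaussianReal 0 1)
      (G := fun c x y => ∏ i with b i = c, K i x y) hGm
  rw [lintegral_obsDensity_mul a hs0 hs b u v, hfac]
  have hw : ∀ i, sgn (u i * v i) ^ 2 = 1 := fun i => by rw [pow_two, sgn_mul_self]
  have hc : ∀ c, ∫⁻ x, ∫⁻ y, ∏ i with b i = c, K i x y ∂(gaussianReal 0 1) ∂(gaussianReal 0 1) ≤
      ENNReal.ofReal (Real.exp (
        (s ^ 2 * (a : ℝ) ^ 2 / 2 + 8 * (s ^ 2) ^ 2 * ((a : ℝ) ^ 4 * T ^ 2)) *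
          blockSum b (u * v) c ^ 2 -
        (s ^ 2 * (a : ℝ) ^ 2 / 2 - 32 * (s ^ 2) ^ 2 * ((a : ℝ) ^ 2 * T + (a : ℝ) ^ 3 * T ^ 2)) *
          ((Finset.univ.filter fun i => b i = c).card : ℝ))) := by
    intro c
    have hN0 : (0 : ℝ) ≤ ((Finset.univ.filter fun i => b i = c).card : ℝ) := Nat.cast_nonneg _
    have hNT := hb c
    have hT' : s ^ 2 * ((Finset.univ.filter fun i => b i = c).card : ℝ) ^ 2 ≤ 1 / 16 :=
      le_trans (by gcongr) hT
    refine (lintegral_prod_thinned_mehler_le ha0 ha1 hw _ hT' (by nlinarith)).trans ?_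
    refine ENNReal.ofReal_le_ofReal (Real.exp_le_exp.2 ?_)
    change s ^ 2 * (a : ℝ) ^ 2 / 2 * (blockSum b (u * v) c ^ 2 - _) + 8 * (s ^ 2) ^ 2 * (_ + _ +
      (a : ℝ) ^ 4 * _ * blockSum b (u * v) c ^ 2) ≤ _
    set N := ((Finset.univ.filter fun i => b i = c).card : ℝ)
    set S := blockSum b (u * v) c ^ 2
    have hS0 : 0 ≤ S := sq_nonneg _
    have e1 : (a : ℝ) ^ 2 * N ^ 2 ≤ (a : ℝ) ^ 2 * T * N := by
      rw [mul_assoc, pow_two N]; gcongr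
    have e2 : (a : ℝ) ^ 3 * N ^ 3 ≤ (a : ℝ) ^ 3 * T ^ 2 * N := by
      rw [mul_assoc, pow_succ N]; gcongr
    have e3 : (a : ℝ) ^ 4 * N ^ 2 * S ≤ (a : ℝ) ^ 4 * T ^ 2 * S := by gcongr
    have h1 := mul_le_mul_of_nonneg_left e1 (by positivity : 0 ≤ 32 * (s ^ 2) ^ 2)
    have h2 := mul_le_mul_of_nonneg_left e2 (by positivity : 0 ≤ 32 * (s ^ 2) ^ 2)
    have h3 := mul_le_mul_of_nonneg_left e3 (by positivity : 0 ≤ 8 * (s ^ 2) ^ 2)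
    linarith
  refine (Finset.prod_le_prod' fun c _ => hc c).trans_eq ?_
  rw [← ENNReal.ofReal_prod_of_nonneg fun _ _ => (Real.exp_pos _).le, ← Real.exp_sum,
    Finset.sum_sub_distrib, ← Finset.mul_sum, ← Finset.mul_sum, sum_card_fiber]

lemma lintegral_sampleDensity_mul (n : ℕ) (a : unitInterval) (s : ℝ) (b : Fin p → Fin p)
    (u v : Fin p → ℤˣ) :
    ∫⁻ y, sampleDensity s b u y * sampleDensity s b v y
        ∂(sampleLaw n a (1 : Matrix (Fin p) (Fin p) ℝ)) =
      (∫⁻ y, obsDensity s b u y * obsDensity s b v y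
        ∂(obsLaw a (1 : Matrix (Fin p) (Fin p) ℝ))) ^ n := by
  unfold sampleDensity sampleLaw
  simp_rw [← Finset.prod_mul_distrib]
  rw [lintegral_pi_prod (fun _ : Fin n => obsLaw a (1 : Matrix (Fin p) (Fin p) ℝ))
    (f := fun _ y => obsDensity s b u y * obsDensity s b v y)
    fun _ => (measurable_obsDensity s b u).mul (measurable_obsDensity s b v)]
  simp

/-- The exponential moment of the squared block sums of independent random signs. The squares are
linearized by an independent Gaussian variable in each block. -/
lemma sum_exp_blockSum_sq_le {L T : ℝ} (hL : 0 ≤ L) (b : Fin p → Fin p)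
    (hb : ∀ c, ((Finset.univ.filter fun i => b i = c).card : ℝ) ≤ T) (hLT : 4 * L * T ≤ 1) :
    ∑ w : Fin p → ℤˣ, ENNReal.ofReal (Real.exp (L * ∑ c, blockSum b w c ^ 2)) ≤
      2 ^ p * ENNReal.ofReal (Real.exp (L * p + 4 * L ^ 2 * T * p)) := by
  have hm : ∀ r : ℝ, Measurable fun g : ℝ => ENNReal.ofReal (Real.exp (r * g)) := fun r => by
    fun_prop
  have hlin : ∀ w : Fin p → ℤˣ, ENNReal.ofReal (Real.exp (L * ∑ c, blockSum b w c ^ 2)) =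
      ∫⁻ g : Fin p → ℝ, ∏ i, ENNReal.ofReal (Real.exp (√(2 * L) * sgn (w i) * g (b i)))
        ∂(Measure.pi fun _ => gaussianReal 0 1) := by
    intro w
    have h1 : ∀ g : Fin p → ℝ, ∏ i, ENNReal.ofReal (Real.exp (√(2 * L) * sgn (w i) * g (b i))) =
        ∏ c, ENNReal.ofReal (Real.exp (√(2 * L) * blockSum b w c * g c)) := by
      intro g
      rw [← Finset.prod_fiberwise Finset.univ b]
      refine Finset.prod_congr rfl fun c _ => ?_
      rw [← ENNReal.ofReal_prod_of_nonneg fun _ _ => (Real.exp_pos _).le, ← Real.exp_sum]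
      congr 2
      rw [blockSum, Finset.mul_sum, Finset.sum_mul]
      refine Finset.sum_congr rfl fun i hi => ?_
      rw [(Finset.mem_filter.1 hi).2]
    simp_rw [h1]
    rw [lintegral_pi_prod (fun _ : Fin p => gaussianReal 0 1)
      (f := fun c g => ENNReal.ofReal (Real.exp (√(2 * L) * blockSum b w c * g)))
      fun c => hm _]
    have h2 : ∀ c, ∫⁻ g, ENNReal.ofReal (Real.exp (√(2 * L) * blockSum b w c * g))
        ∂(gaussianReal 0 1) = ENNReal.ofReal (Real.exp (L * blockSum b w c ^ 2)) := by
      intro c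
      have := lintegral_exp_quadratic (√(2 * L) * blockSum b w c) 0 (by norm_num)
      simp only [zero_mul, sub_zero, mul_zero, add_zero, Real.sqrt_one, inv_one, one_mul,
        mul_one] at this
      rw [this, mul_pow, Real.sq_sqrt (by linarith)]
      congr 2; ring
    simp_rw [h2]
    rw [← ENNReal.ofReal_prod_of_nonneg fun _ _ => (Real.exp_pos _).le, ← Real.exp_sum,
      Finset.mul_sum]
  simp_rw [hlin]
  rw [← lintegral_finsetSum _ fun w _ => Finset.measurable_prod _ fun i _ =>
    (hm (√(2 * L) * sgn (w i))).comp (measurable_pi_apply (b i))]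
  have hcosh : ∀ g : Fin p → ℝ, ∑ w : Fin p → ℤˣ,
      ∏ i, ENNReal.ofReal (Real.exp (√(2 * L) * sgn (w i) * g (b i))) ≤
      2 ^ p * ∏ c, ENNReal.ofReal (Real.exp
        (0 * g c - -(L * ((Finset.univ.filter fun i => b i = c).card : ℝ)) * g c ^ 2)) := by
    intro g
    have h1 := Finset.prod_univ_sum (fun _ : Fin p => (Finset.univ : Finset ℤˣ))
      (fun i e => ENNReal.ofReal (Real.exp (√(2 * L) * sgn e * g (b i))))
    rw [Fintype.piFinset_univ] at h1
    rw [← h1]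
    have h2 : ∀ i, ∑ e : ℤˣ, ENNReal.ofReal (Real.exp (√(2 * L) * sgn e * g (b i))) ≤
        2 * ENNReal.ofReal (Real.exp (L * g (b i) ^ 2)) := by
      intro i
      have h3 := Real.cosh_le_exp_half_sq (√(2 * L) * g (b i))
      rw [Real.cosh_eq, mul_pow, Real.sq_sqrt (by linarith)] at h3
      have h4 : (Finset.univ : Finset ℤˣ) = {1, -1} := rfl
      rw [h4, Finset.sum_pair (by decide), ← ENNReal.ofReal_add (Real.exp_pos _).le
        (Real.exp_pos _).le, ← ENNReal.ofReal_ofNat 2, ← ENNReal.ofReal_mul (by norm_num)]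
      refine ENNReal.ofReal_le_ofReal ?_
      have e1 : √(2 * L) * sgn 1 * g (b i) = √(2 * L) * g (b i) := by simp [sgn]
      have e2 : √(2 * L) * sgn (-1) * g (b i) = -(√(2 * L) * g (b i)) := by simp [sgn]
      have e3 : 2 * L * g (b i) ^ 2 / 2 = L * g (b i) ^ 2 := by ring
      rw [e1, e2]
      rw [e3] at h3
      linarith
    refine (Finset.prod_le_prod' fun i _ => h2 i).trans_eq ?_
    rw [Finset.prod_mul_distrib, Finset.prod_const, Finset.card_univ, Fintype.card_fin,
      ← Finset.prod_fiberwise Finset.univ b]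
    congr 1
    refine Finset.prod_congr rfl fun c _ => ?_
    have h5 : ∀ i ∈ Finset.univ.filter fun i => b i = c,
        ENNReal.ofReal (Real.exp (L * g (b i) ^ 2)) = ENNReal.ofReal (Real.exp (L * g c ^ 2)) := by
      intro i hi; rw [(Finset.mem_filter.1 hi).2]
    rw [Finset.prod_congr rfl h5, Finset.prod_const, ← ENNReal.ofReal_pow (Real.exp_pos _).le,
      ← Real.exp_nat_mul]
    congr 2; ring
  refine (lintegral_mono hcosh).trans ?_
  have hm2 : ∀ r : ℝ, Measurable fun g : ℝ => ENNReal.ofReal (Real.exp (0 * g - r * g ^ 2)) :=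
    fun r => by fun_prop
  have hm3 : Measurable fun g : Fin p → ℝ => ∏ c, ENNReal.ofReal (Real.exp
      (0 * g c - -(L * ((Finset.univ.filter fun i => b i = c).card : ℝ)) * g c ^ 2)) :=
    Finset.measurable_prod _ fun c _ => (hm2 _).comp (measurable_pi_apply c)
  rw [lintegral_const_mul _ hm3,
    lintegral_pi_prod (fun _ : Fin p => gaussianReal 0 1) (f := fun c g => ENNReal.ofReal (Real.exp
        (0 * g - -(L * ((Finset.univ.filter fun i => b i = c).card : ℝ)) * g ^ 2))) fun c => hm2 _]
  refine mul_le_mul_right ?_ _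
  have hc : ∀ c, ∫⁻ g, ENNReal.ofReal (Real.exp
        (0 * g - -(L * ((Finset.univ.filter fun i => b i = c).card : ℝ)) * g ^ 2))
        ∂(gaussianReal 0 1) ≤ ENNReal.ofReal (Real.exp
          ((L + 4 * L ^ 2 * T) * ((Finset.univ.filter fun i => b i = c).card : ℝ))) := by
    intro c
    have hNT := hb c
    set N := ((Finset.univ.filter fun i => b i = c).card : ℝ)
    have hN0 : 0 ≤ N := Nat.cast_nonneg _
    have h1 : 4 * L * N ≤ 1 := le_trans (by gcongr) hLT
    have e : 1 + 2 * -(L * N) = 1 - 2 * L * N := by ring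
    rw [lintegral_exp_quadratic _ _ (by linarith), zero_pow two_ne_zero, zero_div, Real.exp_zero,
      mul_one, e]
    refine ENNReal.ofReal_le_ofReal ((inv_sqrt_one_sub_le (by linarith)).trans ?_)
    have h2 : 4 * L ^ 2 * N * N ≤ 4 * L ^ 2 * N * T := by gcongr
    have h3 := Real.add_one_le_exp ((L + 4 * L ^ 2 * T) * N)
    linarith
  refine (Finset.prod_le_prod' fun c _ => hc c).trans_eq ?_
  rw [← ENNReal.ofReal_prod_of_nonneg fun _ _ => (Real.exp_pos _).le, ← Real.exp_sum,
    ← Finset.mul_sum, sum_card_fiber]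
  congr 2; ring

end ChiSquare

/-! ### Second moments of likelihood ratios and minimax errors -/

section SecondMoment

/-- For a mixture with likelihood ratio `M`, `2 δ 1_{Eᶜ} + 2 M ≤ 2 δ M 1_{Eᶜ} + δ² + M² + 1`
holds pointwise; integrated, this bounds the error probabilities of the test with critical region
`E` by the second moment of `M`. -/
lemma one_le_add_of_second_moment {Ω U : Type*} [MeasurableSpace Ω] [Fintype U] [Nonempty U]
    (μ : Measure Ω) [IsProbabilityMeasure μ] {L : U → Ω → ℝ≥0∞} (hL : ∀ u, Measurable (L u))
    (h1 : ∀ u, ∫⁻ y, L u y ∂μ = 1) {δ : ℝ} (hδ : 0 < δ)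
    (h2 : ∑ u, ∑ v, ∫⁻ y, L u y * L v y ∂μ ≤
      (Fintype.card U : ℝ≥0∞) ^ 2 * ENNReal.ofReal (1 + δ ^ 2))
    {E : Set Ω} (hE : MeasurableSet E) {κ : ℝ≥0∞} (hκ : ∀ u, μ.withDensity (L u) Eᶜ ≤ κ) :
    1 ≤ μ E + κ + ENNReal.ofReal δ := by
  set N : ℝ≥0∞ := (Fintype.card U : ℝ≥0∞) with hN
  have hN0 : N ≠ 0 := by simp [hN]
  have hNt : N ≠ ⊤ := by simp [hN]
  have hNN : N⁻¹ * N = 1 := ENNReal.inv_mul_cancel hN0 hNt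
  set M : Ω → ℝ≥0∞ := fun y => N⁻¹ * ∑ u, L u y with hM
  have hsm : Measurable fun y => ∑ u, L u y := Finset.measurable_sum _ fun u _ => hL u
  have hMm : Measurable M := hsm.const_mul _
  have hM1 : ∫⁻ y, M y ∂μ = 1 := by
    rw [hM, lintegral_const_mul _ hsm, lintegral_finsetSum _ fun u _ => hL u]
    simp_rw [h1]
    rw [Finset.sum_const, Finset.card_univ, nsmul_eq_mul, mul_one, hNN]
  have hM2 : ∫⁻ y, M y ^ 2 ∂μ ≤ ENNReal.ofReal (1 + δ ^ 2) := by
    have e : ∀ y, M y ^ 2 = (N⁻¹) ^ 2 * ∑ u, ∑ v, L u y * L v y := by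
      intro y; rw [hM]; simp only; rw [mul_pow, pow_two (∑ u, L u y), Finset.sum_mul_sum]
    simp_rw [e]
    have hm : ∀ u, Measurable fun y => ∑ v, L u y * L v y := fun u =>
      Finset.measurable_sum _ fun v _ => (hL u).mul (hL v)
    rw [lintegral_const_mul _ (Finset.measurable_sum _ fun u _ => hm u),
      lintegral_finsetSum _ fun u _ => hm u]
    have e2 : ∀ u, ∫⁻ y, ∑ v, L u y * L v y ∂μ = ∑ v, ∫⁻ y, L u y * L v y ∂μ := fun u =>
      lintegral_finsetSum _ fun v _ => (hL u).mul (hL v)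
    simp_rw [e2]
    calc (N⁻¹) ^ 2 * ∑ u, ∑ v, ∫⁻ y, L u y * L v y ∂μ
        ≤ (N⁻¹) ^ 2 * (N ^ 2 * ENNReal.ofReal (1 + δ ^ 2)) := mul_le_mul_right h2 _
      _ = ENNReal.ofReal (1 + δ ^ 2) := by
          rw [← mul_assoc, ← mul_pow, hNN, one_pow, one_mul]
  have hMκ : ∫⁻ y in Eᶜ, M y ∂μ ≤ κ := by
    rw [hM, lintegral_const_mul _ hsm, lintegral_finsetSum _ fun u _ => hL u]
    calc N⁻¹ * ∑ u, ∫⁻ y in Eᶜ, L u y ∂μ ≤ N⁻¹ * ∑ _u : U, κ := by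
          refine mul_le_mul_right (Finset.sum_le_sum fun u _ => ?_) _
          rw [← withDensity_apply _ hE.compl]
          exact hκ u
      _ = κ := by
          rw [Finset.sum_const, Finset.card_univ, nsmul_eq_mul, ← mul_assoc, hNN, one_mul]
  set d := ENNReal.ofReal δ with hd
  have hd0 : d ≠ 0 := by simp [hd, hδ]
  have hdt : d ≠ ⊤ := ENNReal.ofReal_ne_top
  have hd2 : ENNReal.ofReal (1 + δ ^ 2) = 1 + d ^ 2 := by
    rw [ENNReal.ofReal_add zero_le_one (sq_nonneg δ), ENNReal.ofReal_one, hd,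
      ENNReal.ofReal_pow hδ.le]
  have hpt : ∀ y, Eᶜ.indicator (fun _ => 2 * d) y + 2 * M y ≤
      Eᶜ.indicator (fun y => 2 * d * M y) y + (d ^ 2 + M y ^ 2 + 1) := by
    intro y
    by_cases hMt : M y = ⊤
    · simp [hMt]
    obtain ⟨r, hr0, hr⟩ : ∃ r : ℝ, 0 ≤ r ∧ M y = ENNReal.ofReal r :=
      ⟨(M y).toReal, ENNReal.toReal_nonneg, (ENNReal.ofReal_toReal hMt).symm⟩
    have h2' : (2 : ℝ≥0∞) = ENNReal.ofReal 2 := by simp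
    have h1' : (1 : ℝ≥0∞) = ENNReal.ofReal 1 := by simp
    by_cases hy : y ∈ Eᶜ
    · rw [Set.indicator_of_mem hy, Set.indicator_of_mem hy, hr, hd, h1', h2',
        ← ENNReal.ofReal_mul (by norm_num), ← ENNReal.ofReal_mul (by norm_num),
        ← ENNReal.ofReal_mul (by positivity), ← ENNReal.ofReal_pow hδ.le, ← ENNReal.ofReal_pow hr0,
        ← ENNReal.ofReal_add (by positivity) (by positivity),
        ← ENNReal.ofReal_add (by positivity) (by positivity),
        ← ENNReal.ofReal_add (by positivity) (by positivity),
        ← ENNReal.ofReal_add (by positivity) (by positivity)]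
      refine ENNReal.ofReal_le_ofReal ?_
      nlinarith [sq_nonneg (δ + r - 1)]
    · rw [Set.indicator_of_notMem hy, Set.indicator_of_notMem hy, hr, hd, h1', h2', zero_add,
        zero_add, ← ENNReal.ofReal_mul (by norm_num), ← ENNReal.ofReal_pow hδ.le,
        ← ENNReal.ofReal_pow hr0, ← ENNReal.ofReal_add (by positivity) (by positivity),
        ← ENNReal.ofReal_add (by positivity) (by positivity)]
      refine ENNReal.ofReal_le_ofReal ?_
      nlinarith [sq_nonneg (r - 1), sq_nonneg δ]
  have hint := lintegral_mono (μ := μ) hpt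
  rw [lintegral_add_left (measurable_const.indicator hE.compl),
    lintegral_add_left ((hMm.const_mul (2 * d)).indicator hE.compl),
    lintegral_indicator hE.compl, lintegral_indicator hE.compl, setLIntegral_const,
    lintegral_const_mul _ hMm, lintegral_const_mul _ hMm, hM1,
    lintegral_add_right _ measurable_const, lintegral_add_left measurable_const, lintegral_const,
    lintegral_const, measure_univ, mul_one, mul_one, mul_one] at hint
  have h3 : 2 * d * μ Eᶜ + 2 ≤ 2 * d * (κ + d) + 2 := by
    refine hint.trans ?_
    calc 2 * d * ∫⁻ y in Eᶜ, M y ∂μ + (d ^ 2 + ∫⁻ y, M y ^ 2 ∂μ + 1)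
        ≤ 2 * d * κ + (d ^ 2 + (1 + d ^ 2) + 1) := by
          rw [hd2] at hM2
          gcongr
      _ = 2 * d * (κ + d) + 2 := by ring
  have h4 : μ Eᶜ ≤ κ + d := by
    have h5 := (ENNReal.add_le_add_iff_right (by norm_num)).1 h3
    exact (ENNReal.mul_le_mul_iff_right (mul_ne_zero two_ne_zero hd0)
      (ENNReal.mul_ne_top (by norm_num) hdt)).1 h5
  calc (1 : ℝ≥0∞) = μ E + μ Eᶜ := by rw [measure_add_measure_compl hE, measure_univ]
    _ ≤ μ E + (κ + d) := by gcongr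
    _ = _ := by rw [add_assoc]

variable {p : ℕ}

lemma card_signs : Fintype.card (Fin p → ℤˣ) = 2 ^ p := by
  simp

/-- The second moment of the mixture of the likelihood ratios. The mean of a squared block sum is
the size of the block, so that the terms of first order in `s² a²` cancel in the exponent. -/
lemma sum_lintegral_sampleDensity_mul_le (n : ℕ) (a : unitInterval) {s T : ℝ} (hs0 : 0 ≤ s)
    (hs : s < 1) (b : Fin p → Fin p)
    (hb : ∀ c, ((Finset.univ.filter fun i => b i = c).card : ℝ) ≤ T) (hT1 : 1 ≤ T)
    (hTn : T ≤ (a : ℝ) ^ 2 * n) (hsT : s ^ 2 * T ^ 2 ≤ 1 / 16)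
    (hnT : 4 * ((a : ℝ) ^ 2 * n * s ^ 2) * T ≤ 1) :
    ∑ u : Fin p → ℤˣ, ∑ v, ∫⁻ y, sampleDensity s b u y * sampleDensity s b v y
      ∂(sampleLaw n a (1 : Matrix (Fin p) (Fin p) ℝ)) ≤
    (Fintype.card (Fin p → ℤˣ) : ℝ≥0∞) ^ 2 *
      ENNReal.ofReal (Real.exp (84 * ((a : ℝ) ^ 2 * n * s ^ 2) ^ 2 * T * p)) := by
  have ha0 := a.2.1
  have ha1 := a.2.2
  have hn0 : (0 : ℝ) ≤ n := Nat.cast_nonneg n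
  have hp0 : (0 : ℝ) ≤ p := Nat.cast_nonneg p
  set c : ℝ := (a : ℝ) with hc
  set l := s ^ 2 * c ^ 2 / 2 + 8 * (s ^ 2) ^ 2 * (c ^ 4 * T ^ 2) with hl
  set β := s ^ 2 * c ^ 2 / 2 - 32 * (s ^ 2) ^ 2 * (c ^ 2 * T + c ^ 3 * T ^ 2) with hβ
  have hl0 : 0 ≤ l := by positivity
  have hnl0 : 0 ≤ n * l := by positivity
  have hl1 : l ≤ s ^ 2 * c ^ 2 := by
    have h1 : s ^ 2 * c ^ 4 * (s ^ 2 * T ^ 2) ≤ s ^ 2 * c ^ 4 * (1 / 16) :=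
      mul_le_mul_of_nonneg_left hsT (by positivity)
    have h2 : s ^ 2 * c ^ 4 ≤ s ^ 2 * c ^ 2 :=
      mul_le_mul_of_nonneg_left (pow_le_pow_of_le_one ha0 ha1 (by norm_num)) (sq_nonneg s)
    rw [hl]; nlinarith
  have hnl : n * l ≤ c ^ 2 * n * s ^ 2 := by
    calc n * l ≤ n * (s ^ 2 * c ^ 2) := mul_le_mul_of_nonneg_left hl1 hn0
      _ = _ := by ring
  have hpair : ∀ u v : Fin p → ℤˣ, ∫⁻ y, sampleDensity s b u y * sampleDensity s b v y
      ∂(sampleLaw n a (1 : Matrix (Fin p) (Fin p) ℝ)) ≤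
      ENNReal.ofReal (Real.exp (n * l * ∑ c, blockSum b (u * v) c ^ 2)) *
        ENNReal.ofReal (Real.exp (-(n * β * p))) := by
    intro u v
    rw [lintegral_sampleDensity_mul]
    refine (pow_le_pow_left' (lintegral_obsDensity_mul_le a hs0 hs b hb hsT u v) n).trans_eq ?_
    rw [← ENNReal.ofReal_pow (Real.exp_pos _).le, ← Real.exp_nat_mul,
      ← ENNReal.ofReal_mul (Real.exp_pos _).le, ← Real.exp_add]
    congr 2
    ring
  have hrow : ∀ u : Fin p → ℤˣ,
      ∑ v, ENNReal.ofReal (Real.exp (n * l * ∑ c, blockSum b (u * v) c ^ 2)) ≤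
      2 ^ p * ENNReal.ofReal (Real.exp (n * l * p + 4 * (n * l) ^ 2 * T * p)) := by
    intro u
    refine le_trans (le_of_eq ?_) (sum_exp_blockSum_sq_le hnl0 b hb ?_)
    · exact Fintype.sum_equiv (Equiv.mulLeft u) _ _ fun v => rfl
    · calc 4 * (n * l) * T ≤ 4 * (c ^ 2 * n * s ^ 2) * T := by gcongr
        _ ≤ 1 := hnT
  calc _ ≤ ∑ u : Fin p → ℤˣ, ∑ v : Fin p → ℤˣ,
        ENNReal.ofReal (Real.exp (n * l * ∑ c, blockSum b (u * v) c ^ 2)) *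
        ENNReal.ofReal (Real.exp (-(n * β * p))) :=
        Finset.sum_le_sum fun u _ => Finset.sum_le_sum fun v _ => hpair u v
    _ ≤ ∑ u : Fin p → ℤˣ, (2 ^ p * ENNReal.ofReal (Real.exp (n * l * p + 4 * (n * l) ^ 2 * T * p)))
        * ENNReal.ofReal (Real.exp (-(n * β * p))) := by
        refine Finset.sum_le_sum fun u _ => ?_
        rw [← Finset.sum_mul]
        exact mul_le_mul_left (hrow u) _
    _ = (Fintype.card (Fin p → ℤˣ) : ℝ≥0∞) ^ 2 * ENNReal.ofReal
        (Real.exp (n * l * p + 4 * (n * l) ^ 2 * T * p + -(n * β * p))) := by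
        rw [Finset.sum_const, Finset.card_univ, nsmul_eq_mul, card_signs, Real.exp_add _ (-_),
          ENNReal.ofReal_mul (Real.exp_pos _).le]
        push_cast
        ring
    _ ≤ _ := by
        refine mul_le_mul_right (ENNReal.ofReal_le_ofReal (Real.exp_le_exp.2 ?_)) _
        have h1 : (n * l) ^ 2 ≤ (c ^ 2 * n * s ^ 2) ^ 2 := pow_le_pow_left₀ hnl0 hnl 2
        have h2 : l - β ≤ 80 * (s ^ 2) ^ 2 * c ^ 2 * T ^ 2 := by
          have e1 : c ^ 4 * T ^ 2 ≤ c ^ 2 * T ^ 2 :=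
            mul_le_mul_of_nonneg_right (pow_le_pow_of_le_one ha0 ha1 (by norm_num)) (sq_nonneg T)
          have e2 : c ^ 3 * T ^ 2 ≤ c ^ 2 * T ^ 2 :=
            mul_le_mul_of_nonneg_right (pow_le_pow_of_le_one ha0 ha1 (by norm_num)) (sq_nonneg T)
          have e3 : c ^ 2 * T ≤ c ^ 2 * T ^ 2 :=
            mul_le_mul_of_nonneg_left (by nlinarith) (sq_nonneg c)
          have e4 := mul_le_mul_of_nonneg_left e1 (by positivity : 0 ≤ 8 * (s ^ 2) ^ 2)
          have e5 := mul_le_mul_of_nonneg_left (add_le_add e3 e2)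
            (by positivity : 0 ≤ 32 * (s ^ 2) ^ 2)
          have e6 : 0 ≤ (s ^ 2) ^ 2 * (c ^ 2 * T ^ 2) := by positivity
          rw [hl, hβ]
          linarith
        have h3 : n * (l - β) ≤ 80 * (c ^ 2 * n * s ^ 2) ^ 2 * T := by
          calc n * (l - β) ≤ n * (80 * (s ^ 2) ^ 2 * c ^ 2 * T ^ 2) :=
                mul_le_mul_of_nonneg_left h2 hn0
            _ = 80 * (s ^ 2) ^ 2 * c ^ 2 * n * T * T := by ring
            _ ≤ 80 * (s ^ 2) ^ 2 * c ^ 2 * n * T * (c ^ 2 * n) := by gcongr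
            _ = _ := by ring
        have h4 : 4 * (n * l) ^ 2 * T ≤ 4 * (c ^ 2 * n * s ^ 2) ^ 2 * T := by gcongr
        calc n * l * p + 4 * (n * l) ^ 2 * T * p + -(n * β * p)
            = (n * (l - β) + 4 * (n * l) ^ 2 * T) * p := by ring
          _ ≤ (80 * (c ^ 2 * n * s ^ 2) ^ 2 * T + 4 * (c ^ 2 * n * s ^ 2) ^ 2 * T) * p := by gcongr
          _ = _ := by ring

/-- A set of covariance matrices which contains the support of the prior cannot be separated from
the identity when the prior is hard to detect. -/
lemma one_le_minimaxError_add (n : ℕ) (a : unitInterval) {s T δ : ℝ} (hs0 : 0 ≤ s)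
    (hs : s < 1) (b : Fin p → Fin p)
    (hb : ∀ c, ((Finset.univ.filter fun i => b i = c).card : ℝ) ≤ T) (hT1 : 1 ≤ T)
    (hTn : T ≤ (a : ℝ) ^ 2 * n) (hsT : s ^ 2 * T ^ 2 ≤ 1 / 16)
    (hnT : 4 * ((a : ℝ) ^ 2 * n * s ^ 2) * T ≤ 1) (hδ : 0 < δ)
    (hexp : Real.exp (84 * ((a : ℝ) ^ 2 * n * s ^ 2) ^ 2 * T * p) ≤ 1 + δ ^ 2)
    {Q : Set (Matrix (Fin p) (Fin p) ℝ)} (hQ : ∀ u, priorCov s b u ∈ Q) :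
    1 ≤ minimaxError n a Q + ENNReal.ofReal δ := by
  rw [← tsub_le_iff_right]
  refine le_iInf fun Δ => le_iInf fun hΔ => ?_
  rw [tsub_le_iff_right]
  have hE : MeasurableSet {y | Δ y = true} := hΔ (measurableSet_singleton true)
  have hEc : {y | Δ y = true}ᶜ = {y | Δ y = false} := by ext y; simp
  refine one_le_add_of_second_moment (sampleLaw n a (1 : Matrix (Fin p) (Fin p) ℝ))
    (L := fun u => sampleDensity s b u) (fun u => measurable_sampleDensity s b u) (fun u => ?_) hδ
    ((sum_lintegral_sampleDensity_mul_le n a hs0 hs b hb hT1 hTn hsT hnT).trans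
      (mul_le_mul_right (ENNReal.ofReal_le_ofReal hexp) _)) hE (κ := typeIIError a Δ Q) fun u => ?_
  · rw [← setLIntegral_univ, ← withDensity_apply _ MeasurableSet.univ,
      ← sampleLaw_priorCov n a hs0 hs b u, measure_univ]
  · rw [hEc, ← sampleLaw_priorCov n a hs0 hs b u]
    exact le_iSup₂ (f := fun S (_ : S ∈ Q) => sampleLaw n a S {y | Δ y = false}) _ (hQ u)

lemma minimaxError_le_one (n : ℕ) (a : unitInterval) (Q : Set (Matrix (Fin p) (Fin p) ℝ)) :
    minimaxError n a Q ≤ 1 := by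
  refine (iInf₂_le (fun _ => false) measurable_const).trans ?_
  simp only [totalError, typeIError, typeIIError]
  simp only [Bool.false_eq_true, Set.ofPred_false, measure_empty, zero_add]
  exact iSup₂_le fun S _ => prob_le_one

lemma totalError_mono {n : ℕ} (a : unitInterval) (Δ : Sample n p → Bool)
    {Q Q' : Set (Matrix (Fin p) (Fin p) ℝ)} (h : Q ⊆ Q') :
    totalError a Δ Q ≤ totalError a Δ Q' := by
  unfold totalError typeIIError
  exact add_le_add le_rfl (biSup_mono h)

lemma minimaxError_mono (n : ℕ) (a : unitInterval) {Q Q' : Set (Matrix (Fin p) (Fin p) ℝ)}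
    (h : Q ⊆ Q') : minimaxError n a Q ≤ minimaxError n a Q' :=
  iInf₂_mono fun Δ _ => totalError_mono a Δ h

lemma alternative_anti (α : ℝ) {φ φ' : ℝ} (h0 : 0 ≤ φ) (h : φ ≤ φ') :
    alternative p α φ' ⊆ alternative p α φ := fun _ hS =>
  ⟨hS.1, (pow_le_pow_left₀ h0 h 2).trans hS.2⟩

end SecondMoment

/-! ### The prior inside the alternative -/

section PriorMembership

variable {p : ℕ}

/-- The map sending a coordinate to its block, for consecutive blocks of length `T`. -/
def blockMap (p T : ℕ) (i : Fin p) : Fin p :=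
  ⟨i / T, (Nat.div_le_self _ _).trans_lt i.2⟩

lemma blockMap_eq_iff {T : ℕ} {i j : Fin p} :
    blockMap p T i = blockMap p T j ↔ (i : ℕ) / T = (j : ℕ) / T := by
  simp [blockMap, Fin.ext_iff]

lemma card_block_le {T : ℕ} (hT : 0 < T) (c : Fin p) :
    ((Finset.univ.filter fun i => blockMap p T i = c).card : ℝ) ≤ T := by
  have h : (Finset.univ.filter fun i => blockMap p T i = c).card ≤ (Finset.range T).card := by
    refine Finset.card_le_card_of_injOn (fun i => (i : ℕ) % T) (fun i _ => ?_) fun i hi j hj h => ?_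
    · simpa using Nat.mod_lt _ hT
    · have hij : blockMap p T i = blockMap p T j :=
        (Finset.mem_filter.1 hi).2.trans (Finset.mem_filter.1 hj).2.symm
      rw [blockMap_eq_iff] at hij
      have h' : (i : ℕ) % T = (j : ℕ) % T := h
      ext
      rw [← Nat.div_add_mod (i : ℕ) T, ← Nat.div_add_mod (j : ℕ) T, hij, h']
  rw [Finset.card_range] at h
  exact_mod_cast h

lemma abs_sub_le_of_blockMap_eq {T : ℕ} (hT : 0 < T) {i j : Fin p}
    (h : blockMap p T i = blockMap p T j) : |((i : ℕ) : ℝ) - ((j : ℕ) : ℝ)| ≤ T := by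
  rw [blockMap_eq_iff] at h
  have h1 := Nat.div_add_mod (i : ℕ) T
  have h2 := Nat.div_add_mod (j : ℕ) T
  have h3 := Nat.mod_lt (i : ℕ) hT
  have h4 := Nat.mod_lt (j : ℕ) hT
  rw [h] at h1
  have h5 : (i : ℕ) ≤ j + T := by omega
  have h6 : (j : ℕ) ≤ i + T := by omega
  have h5' : ((i : ℕ) : ℝ) ≤ (j : ℕ) + T := by exact_mod_cast h5
  have h6' : ((j : ℕ) : ℝ) ≤ (i : ℕ) + T := by exact_mod_cast h6
  rw [abs_le]; constructor <;> linarith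

lemma sum_sum_eq_of_symm (f : Fin p → Fin p → ℝ) (hf : ∀ i j, f i j = f j i) :
    ∑ i, ∑ j, f i j = ∑ i, f i i + 2 * ∑ i, ∑ j ∈ Finset.Ioi i, f i j := by
  have h1 : ∀ i, ∑ j, f i j = f i i + (∑ j ∈ Finset.Ioi i, f i j + ∑ j ∈ Finset.Iio i, f i j) := by
    intro i
    have hu : (Finset.univ : Finset (Fin p)) = insert i (Finset.Ioi i ∪ Finset.Iio i) := by
      ext j
      simp only [Finset.mem_univ, Finset.mem_insert, Finset.mem_union, Finset.mem_Ioi,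
        Finset.mem_Iio, true_iff]
      rcases lt_trichotomy i j with h | h | h
      · exact Or.inr (Or.inl h)
      · exact Or.inl h.symm
      · exact Or.inr (Or.inr h)
    rw [hu, Finset.sum_insert (by simp), Finset.sum_union]
    rw [Finset.disjoint_left]
    intro j hj hj'
    exact absurd (Finset.mem_Ioi.1 hj) (not_lt.2 (Finset.mem_Iio.1 hj').le)
  have h2 : ∑ i, ∑ j ∈ Finset.Iio i, f i j = ∑ i, ∑ j ∈ Finset.Ioi i, f i j := by
    rw [Finset.sum_comm' (t' := Finset.univ) (s' := fun j => Finset.Ioi j) (by simp)]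
    exact Finset.sum_congr rfl fun i _ => Finset.sum_congr rfl fun j _ => hf j i
  simp_rw [h1]
  rw [Finset.sum_add_distrib, Finset.sum_add_distrib, h2]
  ring

/-- The number of pairs of coordinates in a common block: by the Cauchy–Schwarz inequality, few
blocks force large squared block sizes. -/
lemma le_sum_same_block {T : ℕ} (hT : 4 ≤ T) (hTp : T ≤ p) :
    (p : ℝ) * T / 16 ≤
      ∑ i : Fin p, ∑ j ∈ Finset.Ioi i, if blockMap p T i = blockMap p T j then (1 : ℝ) else 0 := by
  have hT0 : 0 < T := by omega
  have hT' : (4 : ℝ) ≤ T := by exact_mod_cast hT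
  have hTp' : (T : ℝ) ≤ p := by exact_mod_cast hTp
  set N : Fin p → ℝ := fun c => ((Finset.univ.filter fun i => blockMap p T i = c).card : ℝ) with hN
  have hsq : ∑ i : Fin p, ∑ j, (if blockMap p T i = blockMap p T j then (1 : ℝ) else 0) =
      ∑ c ∈ Finset.univ.image (blockMap p T), N c ^ 2 := by
    have h1 : ∀ i : Fin p, ∑ j, (if blockMap p T i = blockMap p T j then (1 : ℝ) else 0) =
        N (blockMap p T i) := by
      intro i
      rw [Finset.sum_boole, hN]
      simp only [eq_comm]
    simp_rw [h1]
    rw [Finset.sum_comp N (blockMap p T)]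
    refine Finset.sum_congr rfl fun c _ => ?_
    rw [nsmul_eq_mul, pow_two]
  have hsum : ∑ c ∈ Finset.univ.image (blockMap p T), N c = p := by
    rw [← sum_card_fiber (blockMap p T)]
    refine Finset.sum_subset (Finset.subset_univ _) fun c _ hc => ?_
    rw [hN]
    simp only [Nat.cast_eq_zero, Finset.card_eq_zero, Finset.filter_eq_empty_iff]
    intro i _ hi
    exact hc (Finset.mem_image.2 ⟨i, Finset.mem_univ i, hi⟩)
  have hcard : ((Finset.univ.image (blockMap p T)).card : ℝ) * T ≤ 2 * p := by
    have h1 : (Finset.univ.image (blockMap p T)).card ≤ (Finset.range (p / T + 1)).card := by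
      refine Finset.card_le_card_of_injOn (fun c => (c : ℕ)) (fun c hc => ?_)
        fun c _ d _ h => Fin.ext h
      obtain ⟨i, _, rfl⟩ := Finset.mem_image.1 hc
      simp only [blockMap, Finset.coe_range, Set.mem_Iio]
      exact Nat.lt_succ_of_le (Nat.div_le_div_right i.2.le)
    rw [Finset.card_range] at h1
    have h2 : (Finset.univ.image (blockMap p T)).card * T ≤ 2 * p := by
      calc (Finset.univ.image (blockMap p T)).card * T ≤ (p / T + 1) * T :=
            Nat.mul_le_mul_right _ h1
        _ = p / T * T + T := by ring
        _ ≤ p + p := Nat.add_le_add (Nat.div_mul_le_self p T) hTp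
        _ = 2 * p := by ring
    exact_mod_cast h2
  have hcs := sq_sum_le_card_mul_sum_sq (s := Finset.univ.image (blockMap p T)) (f := N)
  rw [hsum, ← hsq, sum_sum_eq_of_symm _ fun i j => by simp only [eq_comm]] at hcs
  simp only [if_true, Finset.sum_const, Finset.card_univ, Fintype.card_fin, nsmul_eq_mul,
    mul_one] at hcs
  set S := ∑ i : Fin p, ∑ j ∈ Finset.Ioi i, if blockMap p T i = blockMap p T j then (1 : ℝ) else 0
  have hS : 0 ≤ S := Finset.sum_nonneg fun i _ => Finset.sum_nonneg fun j _ => by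
    split_ifs <;> norm_num
  have hp : (0 : ℝ) < p := by linarith
  have h1 : (p : ℝ) * (p * T) ≤ p * (2 * (p + 2 * S)) := by
    calc (p : ℝ) * (p * T) = p ^ 2 * T := by ring
      _ ≤ ((Finset.univ.image (blockMap p T)).card * (p + 2 * S)) * T :=
          mul_le_mul_of_nonneg_right hcs (by linarith)
      _ = ((Finset.univ.image (blockMap p T)).card * T) * (p + 2 * S) := by ring
      _ ≤ (2 * p) * (p + 2 * S) := mul_le_mul_of_nonneg_right hcard (by linarith)
      _ = _ := by ring
  have h2 := le_of_mul_le_mul_left h1 hp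
  have h3 : (p : ℝ) * 4 ≤ p * T := mul_le_mul_of_nonneg_left hT' hp.le
  linarith

lemma priorCov_mem_alternative {α φ : ℝ} (hα : 0 < α) (hφ : 0 < φ) {T : ℕ} (hT : 4 ≤ T)
    (hTp : T ≤ p) (hell : (4 * φ) ^ 2 * (T : ℝ) ^ (2 * α) ≤ 1) (hs : 4 * φ / √T < 1)
    (u : Fin p → ℤˣ) :
    priorCov (4 * φ / √T) (blockMap p T) u ∈ alternative p α φ := by
  have hT0 : 0 < T := by omega
  have hTr : (0 : ℝ) < T := by exact_mod_cast hT0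
  have hp : (0 : ℝ) < p := by exact_mod_cast hT0.trans_le hTp
  have hs2 : (4 * φ / √T) ^ 2 = 16 * φ ^ 2 / T := by
    rw [div_pow, Real.sq_sqrt hTr.le]; ring
  have hs0 : 0 ≤ 4 * φ / √T := by positivity
  have hentry : ∀ i, ∀ j ∈ Finset.Ioi i, priorCov (4 * φ / √T) (blockMap p T) u i j ^ 2 =
      16 * φ ^ 2 / T * if blockMap p T i = blockMap p T j then (1 : ℝ) else 0 := by
    intro i j hj
    rw [priorCov_sq_of_ne _ _ _ (Finset.mem_Ioi.1 hj).ne, hs2]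
    simp
  refine ⟨⟨posDef_priorCov hs0 hs _ u, priorCov_diag _ _ u, ?_⟩, ?_⟩
  · rw [one_div, inv_mul_le_iff₀ hp, mul_one]
    have hrow : ∀ i : Fin p, ∑ j ∈ Finset.Ioi i, priorCov (4 * φ / √T) (blockMap p T) u i j ^ 2 *
        |((i : ℕ) : ℝ) - ((j : ℕ) : ℝ)| ^ (2 * α) ≤ 1 := by
      intro i
      calc _ ≤ ∑ j ∈ Finset.Ioi i, (16 * φ ^ 2 / T * (T : ℝ) ^ (2 * α)) *
            if blockMap p T i = blockMap p T j then (1 : ℝ) else 0 := by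
            refine Finset.sum_le_sum fun j hj => ?_
            rw [hentry i j hj]
            split_ifs with h
            · rw [mul_one, mul_one]
              gcongr
              exact abs_sub_le_of_blockMap_eq hT0 h
            · simp
        _ ≤ ∑ j, (16 * φ ^ 2 / T * (T : ℝ) ^ (2 * α)) *
            if blockMap p T i = blockMap p T j then (1 : ℝ) else 0 := by
            refine Finset.sum_le_sum_of_subset_of_nonneg (Finset.subset_univ _) fun j _ _ => ?_
            have : (0 : ℝ) ≤ if blockMap p T i = blockMap p T j then (1 : ℝ) else 0 := by
              split_ifs <;> norm_num
            positivity
        _ ≤ (16 * φ ^ 2 / T * (T : ℝ) ^ (2 * α)) * T := by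
            rw [← Finset.mul_sum, Finset.sum_boole]
            have := card_block_le hT0 (blockMap p T i)
            simp only [eq_comm] at this ⊢
            gcongr
        _ = (4 * φ) ^ 2 * (T : ℝ) ^ (2 * α) := by field_simp; ring
        _ ≤ 1 := hell
    calc _ ≤ ∑ _i : Fin p, (1 : ℝ) := Finset.sum_le_sum fun i _ => hrow i
      _ = p := by simp
  · rw [Finset.sum_congr rfl fun i _ => Finset.sum_congr rfl (hentry i)]
    simp_rw [← Finset.mul_sum]
    have h := le_sum_same_block hT hTp
    calc φ ^ 2 = 1 / (p : ℝ) * (16 * φ ^ 2 / T * (p * T / 16)) := by field_simp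
      _ ≤ _ := by gcongr

end PriorMembership

/-! ### Undetectable alternatives -/

section LowerBoundAsymptotics

variable {α : ℝ} {n p : ℕ → ℕ} {a : ℕ → unitInterval} {φ : ℕ → ℝ}

/-- The detection boundary when `φ` is large enough for the prior to have room for blocks of the
length `φ^{-1/α}`, which is dictated by the ellipsoid. -/
lemma tendsto_minimaxError_of_room (hα : 1 / 2 < α) (hφ : ∀ ν, 0 < φ ν)
    (hφ0 : Tendsto φ atTop (𝓝 0))
    (hsig : Tendsto (fun ν => signal α (n ν) (p ν) (a ν) (φ ν)) atTop (𝓝 0))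
    (hpφ : Tendsto (fun ν => (p ν : ℝ) * φ ν ^ (1 / α)) atTop atTop)
    (hnφ : Tendsto (fun ν => (a ν : ℝ) ^ 2 * n ν * φ ν ^ (1 / α)) atTop atTop) :
    Tendsto (fun ν => minimaxError (n ν) (a ν) (alternative (p ν) α (φ ν))) atTop (𝓝 1) := by
  have hα0 : 0 < α := by linarith
  -- the length of the blocks, before rounding
  set r : ℕ → ℝ := fun ν => (4 * φ ν) ^ (-(1 / α)) with hr
  have hr0 : ∀ ν, 0 < r ν := fun ν => by have := hφ ν; positivity
  have h4φ : Tendsto (fun ν => 4 * φ ν) atTop (𝓝 0) := by simpa using hφ0.const_mul 4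
  have h4φ' : Tendsto (fun ν => 4 * φ ν) atTop (𝓝[>] 0) :=
    tendsto_nhdsWithin_iff.2 ⟨h4φ, Eventually.of_forall fun ν => mul_pos four_pos (hφ ν)⟩
  have hrt : Tendsto r atTop atTop :=
    (tendsto_rpow_neg_nhdsGT_zero (neg_lt_zero.2 (by positivity))).comp h4φ'
  have hsmall : Tendsto (fun ν => (4 * φ ν) ^ (2 - 1 / α)) atTop (𝓝 0) := by
    have h1 : 0 < 2 - 1 / α := by
      rw [sub_pos, div_lt_iff₀ hα0]; linarith
    have := h4φ.rpow_const (p := 2 - 1 / α) (Or.inr h1.le)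
    rwa [Real.zero_rpow h1.ne'] at this
  set C : ℝ := 512 * 4 ^ (1 / α) with hC
  have hC0 : 0 < C := by positivity
  set θ : ℕ → ℝ := fun ν => C * signal α (n ν) (p ν) (a ν) (φ ν) ^ 2 with hθ
  have hθ0 : ∀ ν, 0 ≤ θ ν := fun ν => by positivity
  have hθt : Tendsto θ atTop (𝓝 0) := by simpa using (hsig.pow 2).const_mul C
  set δ : ℕ → ℝ := fun ν => √(Real.exp (84 * θ ν) - 1) + 1 / ((ν : ℝ) + 1) with hδ
  have hδ0 : ∀ ν, 0 < δ ν := fun ν => by positivity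
  have hδt : Tendsto δ atTop (𝓝 0) := by
    have h1 : Tendsto (fun ν => √(Real.exp (84 * θ ν) - 1)) atTop (𝓝 0) := by
      have h2 : Tendsto (fun ν => Real.exp (84 * θ ν) - 1) atTop (𝓝 0) := by
        have h3 := (Real.continuous_exp.tendsto 0).comp (by simpa using hθt.const_mul 84 :
          Tendsto (fun ν => 84 * θ ν) atTop (𝓝 0))
        simpa using h3.sub_const 1
      simpa using h2.sqrt
    simpa only [add_zero] using
      h1.add (tendsto_one_div_add_atTop_nhds_zero_nat (𝕜 := ℝ))
  have hlim : Tendsto (fun ν => 1 - ENNReal.ofReal (δ ν)) atTop (𝓝 1) := by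
    have h1 := ENNReal.Tendsto.sub (tendsto_const_nhds (x := (1 : ℝ≥0∞)) (f := atTop))
      (ENNReal.tendsto_ofReal hδt) (Or.inl ENNReal.one_ne_top)
    simpa using h1
  refine tendsto_of_tendsto_of_tendsto_of_le_of_le' hlim tendsto_const_nhds ?_
    (Eventually.of_forall fun ν => minimaxError_le_one _ _ _)
  filter_upwards [hrt.eventually_ge_atTop 5, h4φ.eventually_lt_const one_pos,
    hsmall.eventually_le_const (by norm_num : (0 : ℝ) < 1 / 16), hpφ.eventually_ge_atTop 1,
    hnφ.eventually_ge_atTop 1, hθt.eventually_le_const (by norm_num : (0 : ℝ) < 1 / 16)]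
    with ν h5 hlt hsm hp1 hn1 hθ16
  have hφν := hφ ν
  set T := ⌊r ν⌋₊ with hTdef
  have hTr : (T : ℝ) ≤ r ν := Nat.floor_le (hr0 ν).le
  have hT4 : 4 ≤ T := Nat.le_floor (by push_cast; linarith)
  have hT4' : (4 : ℝ) ≤ T := by exact_mod_cast hT4
  have hT0 : (0 : ℝ) < T := by linarith
  have hrT : r ν ≤ 2 * T := by linarith [Nat.lt_floor_add_one (r ν)]
  have hφr : φ ν ^ (1 / α) * r ν ≤ 1 := by
    calc φ ν ^ (1 / α) * r ν ≤ (4 * φ ν) ^ (1 / α) * r ν := by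
          gcongr; linarith
      _ = 1 := by
          rw [hr]; simp only
          rw [← Real.rpow_add (by positivity), add_neg_cancel, Real.rpow_zero]
  have hroom : ∀ y : ℝ, 0 ≤ y → 1 ≤ y * φ ν ^ (1 / α) → (T : ℝ) ≤ y := by
    intro y hy0 hy
    calc (T : ℝ) ≤ 1 * r ν := by linarith
      _ ≤ y * φ ν ^ (1 / α) * r ν := mul_le_mul_of_nonneg_right hy (hr0 ν).le
      _ = y * (φ ν ^ (1 / α) * r ν) := by ring
      _ ≤ y := mul_le_of_le_one_right hy0 hφr
  have hTp' : (T : ℝ) ≤ p ν := hroom _ (Nat.cast_nonneg _) hp1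
  have hTp : T ≤ p ν := by exact_mod_cast hTp'
  have hTn : (T : ℝ) ≤ (a ν : ℝ) ^ 2 * n ν := hroom _ (by positivity) hn1
  have hell : (4 * φ ν) ^ 2 * (T : ℝ) ^ (2 * α) ≤ 1 := by
    calc (4 * φ ν) ^ 2 * (T : ℝ) ^ (2 * α) ≤ (4 * φ ν) ^ 2 * (r ν) ^ (2 * α) := by gcongr
      _ = 1 := by
          rw [hr]; simp only
          have e : -(1 / α) * (2 * α) = -2 := by field_simp
          rw [← Real.rpow_mul (by positivity), e, ← Real.rpow_natCast (4 * φ ν) 2,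
            ← Real.rpow_add (by positivity)]
          norm_num
  have hs : 4 * φ ν / √T < 1 := by
    refine (div_le_self (by positivity) ?_).trans_lt hlt
    exact Real.one_le_sqrt.2 (by linarith)
  have hs2 : (4 * φ ν / √T) ^ 2 = (4 * φ ν) ^ 2 / T := by
    rw [div_pow, Real.sq_sqrt hT0.le]
  have hsT : (4 * φ ν / √T) ^ 2 * (T : ℝ) ^ 2 ≤ 1 / 16 := by
    calc (4 * φ ν / √T) ^ 2 * (T : ℝ) ^ 2 = (4 * φ ν) ^ 2 * T := by rw [hs2]; field_simp
      _ ≤ (4 * φ ν) ^ 2 * r ν := by gcongr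
      _ = (4 * φ ν) ^ (2 - 1 / α) := by
          rw [hr]; simp only
          rw [← Real.rpow_natCast (4 * φ ν) 2, ← Real.rpow_add (by positivity)]
          congr 1
      _ ≤ 1 / 16 := hsm
  set X := (a ν : ℝ) ^ 2 * n ν * (4 * φ ν / √T) ^ 2 with hX
  have hX0 : 0 ≤ X := by positivity
  have hΘ : X ^ 2 * T * p ν ≤ θ ν := by
    have h1 : (T : ℝ)⁻¹ ≤ 2 * 4 ^ (1 / α) * φ ν ^ (1 / α) := by
      have h2 : (r ν)⁻¹ = 4 ^ (1 / α) * φ ν ^ (1 / α) := by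
        rw [hr]; simp only
        rw [Real.rpow_neg (by positivity), inv_inv, Real.mul_rpow (by norm_num) hφν.le]
      have h3 : (T : ℝ)⁻¹ ≤ 2 * (r ν)⁻¹ := by
        rw [← div_eq_mul_inv, le_div_iff₀ (hr0 ν), ← div_eq_inv_mul, div_le_iff₀ hT0]
        exact hrT
      rw [h2] at h3
      linarith
    have h4 : signal α (n ν) (p ν) (a ν) (φ ν) ^ 2 =
        ((a ν : ℝ) ^ 2 * n ν) ^ 2 * p ν * (φ ν ^ 4 * φ ν ^ (1 / α)) := by
      have e1 : (φ ν ^ (2 + 1 / (2 * α))) ^ 2 = φ ν ^ 4 * φ ν ^ (1 / α) := by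
        rw [← Real.rpow_natCast (φ ν) 4, ← Real.rpow_add hφν, ← Real.rpow_natCast,
          ← Real.rpow_mul hφν.le]
        congr 1
        push_cast
        field_simp
        ring
      rw [signal, mul_pow, mul_pow, e1, Real.sq_sqrt (Nat.cast_nonneg _)]
    calc X ^ 2 * T * p ν = 256 * ((a ν : ℝ) ^ 2 * n ν) ^ 2 * p ν * φ ν ^ 4 * (T : ℝ)⁻¹ := by
          rw [hX, hs2]; field_simp; ring
      _ ≤ 256 * ((a ν : ℝ) ^ 2 * n ν) ^ 2 * p ν * φ ν ^ 4 * (2 * 4 ^ (1 / α) * φ ν ^ (1 / α)) := by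
          gcongr
      _ = θ ν := by rw [hθ, hC]; simp only; rw [h4]; ring
  have hnT : 4 * X * T ≤ 1 := by
    have h1 : (X * T) ^ 2 ≤ (1 / 4) ^ 2 := by
      calc (X * T) ^ 2 = X ^ 2 * T * T := by ring
        _ ≤ X ^ 2 * T * p ν := by gcongr
        _ ≤ (1 / 4) ^ 2 := by norm_num; linarith
    have h2 := (le_abs_self _).trans (abs_le_of_sq_le_sq h1 (by norm_num))
    linarith
  have hexp : Real.exp (84 * X ^ 2 * T * p ν) ≤ 1 + δ ν ^ 2 := by
    have h1 : 0 ≤ Real.exp (84 * θ ν) - 1 := by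
      rw [sub_nonneg]; exact Real.one_le_exp (by have := hθ0 ν; positivity)
    have h2 : Real.exp (84 * θ ν) - 1 ≤ δ ν ^ 2 := by
      rw [← Real.sq_sqrt h1]
      refine pow_le_pow_left₀ (Real.sqrt_nonneg _) ?_ 2
      rw [hδ]; simp only
      have : 0 ≤ 1 / ((ν : ℝ) + 1) := by positivity
      linarith
    have h3 : Real.exp (84 * X ^ 2 * T * p ν) ≤ Real.exp (84 * θ ν) :=
      Real.exp_le_exp.2 (by linarith)
    linarith
  rw [tsub_le_iff_right]
  exact one_le_minimaxError_add (n ν) (a ν) (by positivity) hs (blockMap (p ν) T)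
    (card_block_le (by omega)) (by linarith) hTn hsT hnT (hδ0 ν) hexp
    fun u => priorCov_mem_alternative hα0 hφν hT4 hTp hell hs u

end LowerBoundAsymptotics

/-! ### The separation rate -/

section SeparationRate

variable {α : ℝ}

lemma separationRate_pos {n p : ℕ} {a : unitInterval}
    (hS : 0 < (a : ℝ) ^ 2 * n * √(p : ℝ)) : 0 < separationRate α n p a :=
  Real.rpow_pos_of_pos hS _

lemma signal_eq_rpow (hα : 0 < α) {n p : ℕ} {a : unitInterval} {φ : ℝ}
    (hS : 0 < (a : ℝ) ^ 2 * n * √(p : ℝ)) (hφ : 0 ≤ φ) :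
    signal α n p a φ = (φ / separationRate α n p a) ^ (2 + 1 / (2 * α)) := by
  have e : -(2 * α / (4 * α + 1)) * (2 + 1 / (2 * α)) = -1 := by field_simp; ring
  rw [Real.div_rpow hφ (separationRate_pos hS).le, separationRate, ← Real.rpow_mul hS.le, e,
    Real.rpow_neg_one, div_inv_eq_mul, signal, mul_comm]

/-- The room for blocks of length `φ̃^{-1/α}` among the coordinates, at the separation rate `φ̃`. -/
lemma mul_separationRate_rpow_eq (hα : 0 < α) {n p : ℕ} {a : unitInterval}
    (hn : 0 < (a : ℝ) ^ 2 * n) (hp : 0 < (p : ℝ)) :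
    (p : ℝ) * separationRate α n p a ^ (1 / α) =
      ((p : ℝ) ^ (2 * α) / ((a : ℝ) ^ 2 * n)) ^ (2 / (4 * α + 1)) := by
  set N := (a : ℝ) ^ 2 * n with hN
  have e1 : -(2 * α / (4 * α + 1)) * (1 / α) = -(2 / (4 * α + 1)) := by field_simp
  have e2 : (1 : ℝ) + 1 / 2 * -(2 / (4 * α + 1)) = 2 * α * (2 / (4 * α + 1)) := by
    field_simp; ring
  rw [separationRate, ← hN, ← Real.rpow_mul (by positivity), e1,
    Real.mul_rpow hn.le (Real.sqrt_nonneg _), Real.sqrt_eq_rpow, ← Real.rpow_mul hp.le,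
    Real.div_rpow (by positivity) hn.le, ← Real.rpow_mul hp.le, ← e2, Real.rpow_add hp,
    Real.rpow_one, Real.rpow_neg hn.le]
  ring

/-- The size of blocks of length `φ̃^{-1/α}`, compared to the effective sample size `a² n`. -/
lemma sampleSize_mul_separationRate_rpow_eq (hα : 0 < α) {n p : ℕ} {a : unitInterval}
    (hn : 0 < (a : ℝ) ^ 2 * n) (hp : 0 < (p : ℝ)) :
    (a : ℝ) ^ 2 * n * separationRate α n p a ^ (1 / α) =
      (((a : ℝ) ^ 2 * n) ^ (4 * α - 1) / (p : ℝ)) ^ (1 / (4 * α + 1)) := by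
  set N := (a : ℝ) ^ 2 * n with hN
  have e1 : -(2 * α / (4 * α + 1)) * (1 / α) = -(2 / (4 * α + 1)) := by field_simp
  have e2 : (1 : ℝ) + -(2 / (4 * α + 1)) = (4 * α - 1) * (1 / (4 * α + 1)) := by
    field_simp; ring
  have e3 : (1 : ℝ) / 2 * -(2 / (4 * α + 1)) = -(1 / (4 * α + 1)) := by field_simp
  rw [separationRate, ← hN, ← Real.rpow_mul (by positivity), e1,
    Real.mul_rpow hn.le (Real.sqrt_nonneg _), Real.sqrt_eq_rpow, ← Real.rpow_mul hp.le, e3,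
    Real.div_rpow (by positivity) hp.le, ← Real.rpow_mul hn.le, ← e2, Real.rpow_add hn,
    Real.rpow_one, Real.rpow_neg hp.le]
  ring

lemma tendsto_div_atTop_of_isLittleO {f g : ℕ → ℝ} (h : f =o[atTop] g)
    (hf : ∀ᶠ ν in atTop, 0 < f ν) (hg : ∀ᶠ ν in atTop, 0 < g ν) :
    Tendsto (fun ν => g ν / f ν) atTop atTop := by
  have h1 : Tendsto (fun ν => f ν / g ν) atTop (𝓝[>] 0) := by
    refine tendsto_nhdsWithin_iff.2 ⟨h.tendsto_div_nhds_zero, ?_⟩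
    filter_upwards [hf, hg] with ν h1 h2 using div_pos h1 h2
  refine h1.inv_tendsto_nhdsGT_zero.congr fun ν => ?_
  simp [inv_div]

variable {n p : ℕ → ℕ} {a : ℕ → unitInterval} {φ : ℕ → ℝ}

lemma LowerBoundRegime.tendsto_sqrt (hR : LowerBoundRegime α n p a) (hp : Tendsto p atTop atTop) :
    Tendsto (fun ν => (a ν : ℝ) ^ 2 * n ν * √(p ν : ℝ)) atTop atTop :=
  hR.1.atTop_mul_atTop₀ (Real.tendsto_sqrt_atTop.comp (tendsto_natCast_atTop_atTop.comp hp))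

lemma LowerBoundRegime.tendsto_room (hα : 1 / 2 < α) (hR : LowerBoundRegime α n p a)
    (hp : Tendsto p atTop atTop) :
    Tendsto (fun ν => (p ν : ℝ) * separationRate α (n ν) (p ν) (a ν) ^ (1 / α)) atTop atTop ∧
    Tendsto (fun ν => (a ν : ℝ) ^ 2 * n ν * separationRate α (n ν) (p ν) (a ν) ^ (1 / α))
      atTop atTop := by
  have hα0 : 0 < α := by linarith
  have hn0 := hR.1.eventually_gt_atTop 0
  have hp0 : ∀ᶠ ν in atTop, 0 < (p ν : ℝ) :=
    (tendsto_natCast_atTop_atTop.comp hp).eventually_gt_atTop 0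
  constructor
  · have h1 := tendsto_div_atTop_of_isLittleO hR.2.2 hn0
      (hp0.mono fun ν h => Real.rpow_pos_of_pos h _)
    refine ((tendsto_rpow_atTop (by positivity : 0 < 2 / (4 * α + 1))).comp h1).congr' ?_
    filter_upwards [hn0, hp0] with ν hn hp using (mul_separationRate_rpow_eq hα0 hn hp).symm
  · have h1 := tendsto_div_atTop_of_isLittleO hR.2.1 hp0
      (hn0.mono fun ν h => Real.rpow_pos_of_pos h _)
    refine ((tendsto_rpow_atTop (by positivity : 0 < 1 / (4 * α + 1))).comp h1).congr' ?_
    filter_upwards [hn0, hp0] with ν hn hp using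
      (sampleSize_mul_separationRate_rpow_eq hα0 hn hp).symm

lemma tendsto_separationRate (hα : 0 < α)
    (hS : Tendsto (fun ν => (a ν : ℝ) ^ 2 * n ν * √(p ν : ℝ)) atTop atTop) :
    Tendsto (fun ν => separationRate α (n ν) (p ν) (a ν)) atTop (𝓝 0) :=
  (tendsto_rpow_neg_atTop (by positivity : 0 < 2 * α / (4 * α + 1))).comp hS

/-- For `φ` below the separation rate `φ̃`, the radius `δ φ̃` with `δ → 0` slowly is still
undetectable, and it leaves room for the blocks of the prior. -/
theorem tendsto_minimaxError_of_separationRate (hα : 1 / 2 < α) (hp : Tendsto p atTop atTop)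
    (hφ : ∀ ν, 0 < φ ν) (hR : LowerBoundRegime α n p a)
    (hrate : Tendsto (fun ν => φ ν / separationRate α (n ν) (p ν) (a ν)) atTop (𝓝 0)) :
    Tendsto (fun ν => minimaxError (n ν) (a ν) (alternative (p ν) α (φ ν))) atTop (𝓝 1) := by
  have hα0 : 0 < α := by linarith
  have hS := hR.tendsto_sqrt hp
  obtain ⟨hA, hB⟩ := hR.tendsto_room hα hp
  have hψ0 := tendsto_separationRate hα0 hS
  have hψpos : ∀ᶠ ν in atTop, 0 < separationRate α (n ν) (p ν) (a ν) :=
    (hS.eventually_gt_atTop 0).mono fun ν h => separationRate_pos h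
  set ψ : ℕ → ℝ := fun ν => separationRate α (n ν) (p ν) (a ν) with hψ
  set A : ℕ → ℝ := fun ν => (p ν : ℝ) * ψ ν ^ (1 / α) with hAdef
  set B : ℕ → ℝ := fun ν => (a ν : ℝ) ^ 2 * n ν * ψ ν ^ (1 / α) with hBdef
  have hψnn : ∀ ν, 0 ≤ ψ ν := fun ν => Real.rpow_nonneg (by positivity) _
  have hAnn : ∀ ν, 0 ≤ A ν := fun ν => mul_nonneg (by positivity) (Real.rpow_nonneg (hψnn ν) _)
  have hBnn : ∀ ν, 0 ≤ B ν := fun ν => mul_nonneg (by positivity) (Real.rpow_nonneg (hψnn ν) _)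
  set δ : ℕ → ℝ := fun ν => A ν ^ (-(α / 2)) + B ν ^ (-(α / 2)) with hδ
  have hδ0 : Tendsto δ atTop (𝓝 0) := by
    have h := ((tendsto_rpow_neg_atTop (half_pos hα0)).comp hA).add
      ((tendsto_rpow_neg_atTop (half_pos hα0)).comp hB)
    rw [add_zero] at h
    exact h
  have hδnn : ∀ ν, 0 ≤ δ ν := fun ν =>
    add_nonneg (Real.rpow_nonneg (hAnn ν) _) (Real.rpow_nonneg (hBnn ν) _)
  set φ' : ℕ → ℝ := fun ν => max (φ ν) (δ ν * ψ ν) with hφ'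
  have hφ'pos : ∀ ν, 0 < φ' ν := fun ν => lt_max_of_lt_left (hφ ν)
  have hratio : Tendsto (fun ν => φ' ν / ψ ν) atTop (𝓝 0) := by
    have h := hrate.max hδ0
    rw [max_self] at h
    refine h.congr' ?_
    filter_upwards [hψpos] with ν hν
    rw [hφ', ← max_div_div_right hν.le, mul_div_cancel_right₀ _ hν.ne']
  have hφ'0 : Tendsto φ' atTop (𝓝 0) := by
    have h := hratio.mul hψ0
    rw [zero_mul] at h
    refine h.congr' ?_
    filter_upwards [hψpos] with ν hν using div_mul_cancel₀ _ hν.ne'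
  have hsig : Tendsto (fun ν => signal α (n ν) (p ν) (a ν) (φ' ν)) atTop (𝓝 0) := by
    have he : 0 < 2 + 1 / (2 * α) := by positivity
    have h := hratio.rpow_const (p := 2 + 1 / (2 * α)) (Or.inr he.le)
    rw [Real.zero_rpow he.ne'] at h
    refine h.congr' ?_
    filter_upwards [hS.eventually_gt_atTop 0] with ν hν
      using (signal_eq_rpow hα0 hν (hφ'pos ν).le).symm
  -- `y ψ^{1/α} = Y` and `Y^{-α/2} ≤ δ` give `y (δ ψ)^{1/α} ≥ √Y`
  have hroom : ∀ y : ℕ → ℝ, (∀ ν, 0 ≤ y ν) →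
      Tendsto (fun ν => y ν * ψ ν ^ (1 / α)) atTop atTop →
      (∀ ν, (y ν * ψ ν ^ (1 / α)) ^ (-(α / 2)) ≤ δ ν) →
      Tendsto (fun ν => y ν * φ' ν ^ (1 / α)) atTop atTop := by
    intro y hy0 hy hyδ
    refine tendsto_atTop_mono' _ ?_
      ((tendsto_rpow_atTop (by norm_num : (0 : ℝ) < 1 / 2)).comp hy)
    filter_upwards [hy.eventually_gt_atTop 0] with ν hY
    have e : -(α / 2) * (1 / α) = -(1 / 2) := by field_simp
    calc (y ν * ψ ν ^ (1 / α)) ^ (1 / 2 : ℝ)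
        = ((y ν * ψ ν ^ (1 / α)) ^ (-(α / 2))) ^ (1 / α) * (y ν * ψ ν ^ (1 / α)) := by
          rw [← Real.rpow_mul hY.le, e, ← Real.rpow_add_one hY.ne']
          norm_num
      _ ≤ δ ν ^ (1 / α) * (y ν * ψ ν ^ (1 / α)) := by
          gcongr; exact hyδ ν
      _ = y ν * (δ ν * ψ ν) ^ (1 / α) := by
          rw [Real.mul_rpow (hδnn ν) (hψnn ν)]; ring
      _ ≤ y ν * φ' ν ^ (1 / α) := by
          have h1 := hy0 ν
          have h2 := mul_nonneg (hδnn ν) (hψnn ν)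
          gcongr
          exact le_max_right _ _
  have hmain := tendsto_minimaxError_of_room hα hφ'pos hφ'0 hsig
    (hroom (fun ν => (p ν : ℝ)) (fun ν => Nat.cast_nonneg _) hA
      fun ν => le_add_of_nonneg_right (Real.rpow_nonneg (hBnn ν) _))
    (hroom (fun ν => (a ν : ℝ) ^ 2 * n ν) (fun ν => by positivity) hB
      fun ν => le_add_of_nonneg_left (Real.rpow_nonneg (hAnn ν) _))
  refine tendsto_of_tendsto_of_tendsto_of_le_of_le hmain tendsto_const_nhds (fun ν => ?_)
    fun ν => minimaxError_le_one _ _ _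
  exact minimaxError_mono _ _ (alternative_anti α (hφ ν).le (le_max_left _ _))

theorem tendsto_minimaxError_of_signal (hα : 1 / 2 < α) (hp : Tendsto p atTop atTop)
    (hφ : ∀ ν, 0 < φ ν) (hR : LowerBoundRegime α n p a)
    (hsig : Tendsto (fun ν => signal α (n ν) (p ν) (a ν) (φ ν)) atTop (𝓝 0)) :
    Tendsto (fun ν => minimaxError (n ν) (a ν) (alternative (p ν) α (φ ν))) atTop (𝓝 1) := by
  have hα0 : 0 < α := by linarith
  refine tendsto_minimaxError_of_separationRate hα hp hφ hR ?_
  have he : 0 < 2 + 1 / (2 * α) := by positivity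
  have h := hsig.rpow_const (p := (2 + 1 / (2 * α))⁻¹) (Or.inr (inv_pos.2 he).le)
  rw [Real.zero_rpow (inv_pos.2 he).ne'] at h
  refine h.congr' ?_
  filter_upwards [(hR.tendsto_sqrt hp).eventually_gt_atTop 0] with ν hν
  rw [signal_eq_rpow hα0 hν (hφ ν).le,
    Real.rpow_rpow_inv (div_nonneg (hφ ν).le (separationRate_pos hν).le) he.ne']

/-- For `φ` far above the separation rate `φ̃`, the test may be tuned to the smaller radius
`min φ √φ̃`, which tends to zero. -/
theorem exists_tendsto_totalError_uTest (hα : 1 / 2 < α) (hn : Tendsto n atTop atTop)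
    (hp : Tendsto p atTop atTop) (ha : ∀ ν, 0 < (a ν : ℝ)) (hφ : ∀ ν, 0 < φ ν)
    (hR : LowerBoundRegime α n p a)
    (hrate : Tendsto (fun ν => φ ν / separationRate α (n ν) (p ν) (a ν)) atTop atTop) :
    ∃ (m : ℕ → ℕ) (t : ℕ → ℝ),
      Tendsto (fun ν => totalError (n := n ν) (a ν) (uTest (m ν) (t ν))
        (alternative (p ν) α (φ ν))) atTop (𝓝 0) := by
  have hα0 : 0 < α := by linarith
  have hS := hR.tendsto_sqrt hp
  have hψ0 := tendsto_separationRate hα0 hS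
  have hψpos : ∀ᶠ ν in atTop, 0 < separationRate α (n ν) (p ν) (a ν) :=
    (hS.eventually_gt_atTop 0).mono fun ν h => separationRate_pos h
  have hA := (hR.tendsto_room hα hp).1
  set ψ : ℕ → ℝ := fun ν => separationRate α (n ν) (p ν) (a ν) with hψ
  -- the finitely many indices with `φ̃ = 0` are immaterial
  set φ' : ℕ → ℝ := fun ν => if 0 < ψ ν then min (φ ν) √(ψ ν) else φ ν with hφ'
  have hφ'pos : ∀ ν, 0 < φ' ν := fun ν => by
    rw [hφ']; simp only
    split_ifs with h
    · exact lt_min (hφ ν) (Real.sqrt_pos.2 h)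
    · exact hφ ν
  have hφ'le : ∀ ν, φ' ν ≤ φ ν := fun ν => by
    rw [hφ']; simp only
    split_ifs with h
    · exact min_le_left _ _
    · exact le_rfl
  have hφ'eq : ∀ᶠ ν in atTop, φ' ν = min (φ ν) √(ψ ν) :=
    hψpos.mono fun ν h => if_pos h
  have hφ'0 : Tendsto φ' atTop (𝓝 0) := by
    have h : Tendsto (fun ν => √(ψ ν)) atTop (𝓝 0) := by simpa using hψ0.sqrt
    refine squeeze_zero' (Eventually.of_forall fun ν => (hφ'pos ν).le) ?_ h
    exact hφ'eq.mono fun ν h => h.trans_le (min_le_right _ _)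
  have hratio : Tendsto (fun ν => φ' ν / ψ ν) atTop atTop := by
    have h1 : Tendsto (fun ν => (√(ψ ν))⁻¹) atTop atTop := by
      refine Tendsto.inv_tendsto_nhdsGT_zero (tendsto_nhdsWithin_iff.2 ⟨?_, ?_⟩)
      · simpa using hψ0.sqrt
      · exact hψpos.mono fun ν h => Real.sqrt_pos.2 h
    rw [tendsto_atTop] at hrate h1 ⊢
    intro M
    filter_upwards [hrate M, h1 M, hφ'eq, hψpos] with ν h2 h3 h4 h5
    rw [h4, ← min_div_div_right h5.le]
    refine le_min h2 ?_
    rwa [Real.sqrt_div_self', one_div]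
  have hsig : Tendsto (fun ν => signal α (n ν) (p ν) (a ν) (φ' ν)) atTop atTop := by
    have he : 0 < 2 + 1 / (2 * α) := by positivity
    refine ((tendsto_rpow_atTop he).comp hratio).congr' ?_
    filter_upwards [hS.eventually_gt_atTop 0] with ν hν
      using (signal_eq_rpow hα0 hν (hφ'pos ν).le).symm
  have hpφ : Tendsto (fun ν => (p ν : ℝ) * φ' ν ^ (1 / α)) atTop atTop := by
    refine (hA.atTop_mul_atTop₀ ((tendsto_rpow_atTop (by positivity : 0 < 1 / α)).comp
      hratio)).congr' ?_
    filter_upwards [hψpos] with ν hν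
    have h : (0 : ℝ) < ψ ν ^ (1 / α) := Real.rpow_pos_of_pos hν _
    simp only [Function.comp_apply]
    rw [Real.div_rpow (hφ'pos ν).le hν.le, mul_assoc, mul_div_cancel₀ _ h.ne']
  obtain ⟨m, t, hmt⟩ := exists_isTuned hα ha hφ'pos hφ'0 hsig hpφ
  refine ⟨m, t, ?_⟩
  refine tendsto_of_tendsto_of_tendsto_of_le_of_le tendsto_const_nhds
    (tendsto_totalError_uTest hα hn hp ha hφ'pos hsig hmt) (fun _ => zero_le) fun ν => ?_
  exact totalError_mono _ _ (alternative_anti α (hφ'pos ν).le (hφ'le ν))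

end SeparationRate

end MissingCov

theorem mainTheorem1 (α : ℝ) (hα : 1 / 2 < α)
    (n p : ℕ → ℕ) (hn : Tendsto n atTop atTop) (hp : Tendsto p atTop atTop)
    (a : ℕ → unitInterval) (ha : ∀ ν, 0 < (a ν : ℝ) ∧ (a ν : ℝ) < 1)
    (φ : ℕ → ℝ) (hφ : ∀ ν, 0 < φ ν) :
    -- upper bound, and existence of suitable `m` and `t`
    ((Tendsto φ atTop (𝓝 0) ∧
        Tendsto (fun ν => MissingCov.signal α (n ν) (p ν) (a ν) (φ ν)) atTop atTop) →
      (∀ (m : ℕ → ℕ) (t : ℕ → ℝ), MissingCov.IsTuned α n p a φ m t →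
        Tendsto (fun ν => MissingCov.totalError (n := n ν) (a ν) (MissingCov.uTest (m ν) (t ν))
          (MissingCov.alternative (p ν) α (φ ν))) atTop (𝓝 0)) ∧
      (Tendsto (fun ν => (p ν : ℝ) * φ ν ^ (1 / α)) atTop atTop →
        ∃ (m : ℕ → ℕ) (t : ℕ → ℝ), MissingCov.IsTuned α n p a φ m t)) ∧
    -- lower bound
    (MissingCov.LowerBoundRegime α n p a →
      Tendsto (fun ν => MissingCov.signal α (n ν) (p ν) (a ν) (φ ν)) atTop (𝓝 0) →
      Tendsto (fun ν => MissingCov.minimaxError (n ν) (a ν)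
        (MissingCov.alternative (p ν) α (φ ν))) atTop (𝓝 1)) ∧
    -- separation rate
    (MissingCov.LowerBoundRegime α n p a →
      (Tendsto (fun ν => φ ν / MissingCov.separationRate α (n ν) (p ν) (a ν)) atTop atTop →
        ∃ (m : ℕ → ℕ) (t : ℕ → ℝ),
          Tendsto (fun ν => MissingCov.totalError (n := n ν) (a ν) (MissingCov.uTest (m ν) (t ν))
            (MissingCov.alternative (p ν) α (φ ν))) atTop (𝓝 0)) ∧
      (Tendsto (fun ν => φ ν / MissingCov.separationRate α (n ν) (p ν) (a ν)) atTop (𝓝 0) →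
        Tendsto (fun ν => MissingCov.minimaxError (n ν) (a ν)
          (MissingCov.alternative (p ν) α (φ ν))) atTop (𝓝 1))) := by
  have ha0 : ∀ ν, 0 < (a ν : ℝ) := fun ν => (ha ν).1
  refine ⟨fun ⟨hφ0, hsig⟩ => ⟨fun m t hT => ?_, fun hpφ => ?_⟩, fun hR hsig => ?_,
    fun hR => ⟨fun hrate => ?_, fun hrate => ?_⟩⟩
  · exact MissingCov.tendsto_totalError_uTest hα hn hp ha0 hφ hsig hT
  · exact MissingCov.exists_isTuned hα ha0 hφ hφ0 hsig hpφ
  · exact MissingCov.tendsto_minimaxError_of_signal hα hp hφ hR hsig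
  · exact MissingCov.exists_tendsto_totalError_uTest hα hn hp ha0 hφ hR hrate
  · exact MissingCov.tendsto_minimaxError_of_separationRate hα hp hφ hR hrate
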